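/- Let $\mathcal{M}$ be a complete, connected, $n$-dimensional smooth Riemannian manifold (without boundary) with Riemannian distance $d_{\mathcal{M}}$. A geodesic is a smooth curve $\gamma:[0,1]\to\mathcal{M}$ with zero covariant acceleration, $\gamma''=0$; $\operatorname{Exp}_p(v)=\sigma(1)$, where $\sigma:[0,1]\to\mathcal M$ is the geodesic with $\sigma(0)=p$, $\sigma'(0)=v$. Let $d:\mathcal{M}\times\mathcal{M}\to[0,\infty)$ be a distance function (positive, symmetric, satisfying the triangle inequality), possibly different from $d_{\mathcal{M}}$, and suppose there are constants $0<\ell_{\mathcal{M}}\le L_{\mathcal{M}}$ with $$\ell_{\mathcal{M}}\, d_{\mathcal{M}}(x,y)\;\le\; d(x,y)\;\le\; L_{\mathcal{M}}\, d_{\mathcal{M}}(x,y)\qquad\text{for all } x,y\in\mathcal{M}.$$ A set $\mathcal{C}\subseteq\mathcal{M}$ is *uniquely geodesic* if any two points $x,y\in\mathcal{C}$ are joined by exactly one geodesic contained in $\mathcal{C}$. Let $\alpha\in\mathbb{R}$. A uniquely geodesic set $\mathcal{C}$ is - *geodesically $\alpha$-strongly convex* (with respect to $d$) if for all $x,y\in\mathcal{C}$,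 every geodesic $\gamma$ in $\mathcal{C}$ from $x$ to $y$ and every $t\in[0,1]$, $$\{z\in\mathcal{M} : d(\gamma(t),z)\le \alpha\, t(1-t)\, d(x,y)^2\}\subseteq\mathcal{C};$$ - *double geodesically $\alpha$-strongly convex* (with respect to $d$) if for all $x,y\in\mathcal{C}$, every geodesic $\gamma$ in $\mathcal{C}$ from $x$ to $y$, every $t\in[0,1]$ and every $z\in T_{\gamma(t)}\mathcal{M}$ with $\|z\|_{\gamma(t)}\le \alpha\, t(1-t)\, d(x,y)^2$, the point $\operatorname{Exp}_{\gamma(t)}(z)$ exists and belongs to $\mathcal{C}$. Then every geodesically $\alpha$-strongly convex set $\mathcal{C}$ is double geodesically $\frac{\alpha}{L_{\mathcal{M}}}$-strongly convex. Conversely, every double geodesically $\alpha$-strongly convex set $\mathcal{C}$ is geodesically $(\ell_{\mathcal{M}}\alpha)$-strongly convex. -/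

import Mathlib

open Set Bundle
open scoped Manifold ContDiff

noncomputable section

namespace StrongConvexSets

section Geodesics

variable {n : ℕ} {M : Type*} [TopologicalSpace M] [ChartedSpace (EuclideanSpace ℝ (Fin n)) M]

/-- The point `γ t` together with the velocity `γ'(t) ∈ T_{γ t} M`, as an element of the tangent
bundle, for a curve `γ` defined on the set of times `s` (one-sided derivative at an endpoint). -/
def curveLift (n : ℕ) {M : Type*} [TopologicalSpace M]
    [ChartedSpace (EuclideanSpace ℝ (Fin n)) M] (γ : ℝ → M) (s : Set ℝ) (t : ℝ) :
    TangentBundle (𝓡 n) M :=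
  ⟨γ t, mfderivWithin 𝓘(ℝ, ℝ) (𝓡 n) γ s t (1 : ℝ)⟩

variable [RiemannianBundle (fun x : M ↦ TangentSpace (𝓡 n) x)]

/-- The Riemannian metric read in the chart at `x₀`: the value `g_u(v, w)` at the coordinate
point `u`, where coordinate vectors are pushed to `M` by the differential of the inverse chart. -/
def chartMetric (x₀ : M) (u v w : EuclideanSpace ℝ (Fin n)) : ℝ :=
  inner ℝ
    (mfderiv 𝓘(ℝ, EuclideanSpace ℝ (Fin n)) (𝓡 n) (extChartAt (𝓡 n) x₀).symm u v)
    (mfderiv 𝓘(ℝ, EuclideanSpace ℝ (Fin n)) (𝓡 n) (extChartAt (𝓡 n) x₀).symm u w)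

/-- The Christoffel symbol of the first kind of the Levi-Civita connection in the chart at `x₀`,
`½ (∂_a g(b, w) + ∂_b g(a, w) - ∂_w g(a, b))`, that is `g_u(Γ_u(a, b), w)`. -/
def christoffelFirst (x₀ : M) (u a b w : EuclideanSpace ℝ (Fin n)) : ℝ :=
  (1 / 2 : ℝ) *
    (fderiv ℝ (fun p ↦ chartMetric x₀ p b w) u a
      + fderiv ℝ (fun p ↦ chartMetric x₀ p a w) u b
      - fderiv ℝ (fun p ↦ chartMetric x₀ p a b) u w)

/-- A smooth curve `γ` on the set of times `s` (an interval) is a geodesic if its covariant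
acceleration vanishes. In coordinates `c = φ ∘ γ` the covariant acceleration is
`c'' + Γ_c(c', c')`; since the metric is nondegenerate, this vector is zero exactly when its
inner product with every vector `w` is zero, which is the equation below. -/
def IsGeodesicOn (n : ℕ) {M : Type*} [TopologicalSpace M]
    [ChartedSpace (EuclideanSpace ℝ (Fin n)) M]
    [RiemannianBundle (fun x : M ↦ TangentSpace (𝓡 n) x)] (γ : ℝ → M) (s : Set ℝ) : Prop :=
  ContMDiffOn 𝓘(ℝ, ℝ) (𝓡 n) ∞ γ s ∧
    ∀ x₀ : M, ∀ t ∈ s, γ t ∈ (extChartAt (𝓡 n) x₀).source →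
      ∀ w : EuclideanSpace ℝ (Fin n),
        chartMetric x₀ (extChartAt (𝓡 n) x₀ (γ t))
            (derivWithin (derivWithin (fun r ↦ extChartAt (𝓡 n) x₀ (γ r)) s) s t) w
          + christoffelFirst x₀ (extChartAt (𝓡 n) x₀ (γ t))
            (derivWithin (fun r ↦ extChartAt (𝓡 n) x₀ (γ r)) s t)
            (derivWithin (fun r ↦ extChartAt (𝓡 n) x₀ (γ r)) s t) w = 0

/-- `γ : [0, 1] → M` is a geodesic from `x` to `y` (only the values of `γ` on `[0, 1]` matter). -/
def IsGeodesicBetween (n : ℕ) {M : Type*} [TopologicalSpace M]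
    [ChartedSpace (EuclideanSpace ℝ (Fin n)) M]
    [RiemannianBundle (fun x : M ↦ TangentSpace (𝓡 n) x)] (γ : ℝ → M) (x y : M) : Prop :=
  IsGeodesicOn n γ (Icc 0 1) ∧ γ 0 = x ∧ γ 1 = y

/-- `Exp_x(v)` exists and equals `y`: there is a geodesic `σ : [0, 1] → M` with `σ 0 = x`,
`σ'(0) = v` and `σ 1 = y`. -/
def IsExp (x : M) (v : TangentSpace (𝓡 n) x) (y : M) : Prop :=
  ∃ σ : ℝ → M, IsGeodesicOn n σ (Icc 0 1) ∧
    curveLift n σ (Icc 0 1) 0 = (⟨x, v⟩ : TangentBundle (𝓡 n) M) ∧ σ 1 = y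

/-- A set `C` is uniquely geodesic if any two of its points are joined by one and only one
geodesic contained in `C`. -/
def IsUniquelyGeodesic (n : ℕ) {M : Type*} [TopologicalSpace M]
    [ChartedSpace (EuclideanSpace ℝ (Fin n)) M]
    [RiemannianBundle (fun x : M ↦ TangentSpace (𝓡 n) x)] (C : Set M) : Prop :=
  ∀ x ∈ C, ∀ y ∈ C,
    (∃ γ : ℝ → M, IsGeodesicBetween n γ x y ∧ MapsTo γ (Icc 0 1) C) ∧
    ∀ γ₁ γ₂ : ℝ → M,
      IsGeodesicBetween n γ₁ x y → MapsTo γ₁ (Icc 0 1) C →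
      IsGeodesicBetween n γ₂ x y → MapsTo γ₂ (Icc 0 1) C →
      EqOn γ₁ γ₂ (Icc 0 1)

/-- The uniquely geodesic set `C` is geodesically `α`-strongly convex with respect to `d`: for
every geodesic `γ` of `C` joining `x, y ∈ C` and every `t ∈ [0, 1]`, the `d`-ball of center `γ t`
and radius `α t (1 - t) d(x, y)²` is contained in `C`. -/
def IsGeodesicallyStronglyConvex (n : ℕ) {M : Type*} [TopologicalSpace M]
    [ChartedSpace (EuclideanSpace ℝ (Fin n)) M]
    [RiemannianBundle (fun x : M ↦ TangentSpace (𝓡 n) x)]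
    (d : M → M → ℝ) (α : ℝ) (C : Set M) : Prop :=
  IsUniquelyGeodesic n C ∧
    ∀ x ∈ C, ∀ y ∈ C, ∀ γ : ℝ → M, IsGeodesicBetween n γ x y → MapsTo γ (Icc 0 1) C →
      ∀ t ∈ Icc (0 : ℝ) 1, {z : M | d (γ t) z ≤ α * t * (1 - t) * d x y ^ 2} ⊆ C

/-- The uniquely geodesic set `C` is double geodesically `α`-strongly convex with respect to `d`:
for every geodesic `γ` of `C` joining `x, y ∈ C`, every `t ∈ [0, 1]` and every tangent vector `z`
at `γ t` of Riemannian norm at most `α t (1 - t) d(x, y)²`, the point `Exp_{γ t}(z)` exists and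
is in `C`. -/
def IsDoubleGeodesicallyStronglyConvex (n : ℕ) {M : Type*} [TopologicalSpace M]
    [ChartedSpace (EuclideanSpace ℝ (Fin n)) M]
    [RiemannianBundle (fun x : M ↦ TangentSpace (𝓡 n) x)]
    (d : M → M → ℝ) (α : ℝ) (C : Set M) : Prop :=
  IsUniquelyGeodesic n C ∧
    ∀ x ∈ C, ∀ y ∈ C, ∀ γ : ℝ → M, IsGeodesicBetween n γ x y → MapsTo γ (Icc 0 1) C →
      ∀ t ∈ Icc (0 : ℝ) 1, ∀ z : TangentSpace (𝓡 n) (γ t),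
        ‖z‖ ≤ α * t * (1 - t) * d x y ^ 2 → ∃ q ∈ C, IsExp (γ t) z q

end Geodesics

/-- A distance function: positivity, symmetry and the triangle inequality. -/
structure IsDistanceFunction {M : Type*} (d : M → M → ℝ) : Prop where
  nonneg : ∀ x y, 0 ≤ d x y
  eq_zero_iff : ∀ x y, d x y = 0 ↔ x = y
  symm : ∀ x y, d x y = d y x
  triangle : ∀ x y z, d x z ≤ d x y + d y z

end StrongConvexSets

end

noncomputable section

set_option linter.unusedSectionVars false
set_option maxSynthPendingDepth 3

namespace StrongConvexSets

open Metric Filter Topology MeasureTheory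

/-- A metric space in which any two points are joined by Lipschitz curves `[0, 1] → X` whose
Lipschitz constant is as close to the distance as one wishes. -/
def HasAlmostMinimizers (X : Type*) [MetricSpace X] : Prop :=
  ∀ x y : X, ∀ r, dist x y < r → ∃ f : ℝ → X, f 0 = x ∧ f 1 = y ∧
    ∀ s ∈ Icc (0 : ℝ) 1, ∀ t ∈ Icc (0 : ℝ) 1, dist (f s) (f t) ≤ r * |s - t|

namespace HasAlmostMinimizers

variable {X : Type*} [MetricSpace X]

lemma exists_between (h : HasAlmostMinimizers X) {x z : X} {a b : ℝ} (ha : 0 ≤ a) (hb : 0 < b)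
    (hab : dist x z < a + b) : ∃ y, dist x y ≤ a ∧ dist y z < b := by
  by_cases hxz : dist x z ≤ a
  · exact ⟨z, hxz, by simpa using hb⟩
  push Not at hxz
  obtain ⟨r, hr1, hr2⟩ := _root_.exists_between hab
  obtain ⟨f, f0, f1, hf⟩ := h x z r hr1
  have hr : 0 < r := by linarith
  have hs : a / r ∈ Icc (0 : ℝ) 1 := ⟨by positivity, by rw [div_le_one hr]; linarith⟩
  refine ⟨f (a / r), ?_, ?_⟩
  · have := hf 0 (by simp) (a / r) hs
    rw [f0, zero_sub, abs_neg, abs_of_nonneg hs.1, mul_div_cancel₀ _ hr.ne'] at this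
    exact this
  · have := hf (a / r) hs 1 (by simp)
    rw [f1, abs_sub_comm, abs_of_nonneg (by linarith [hs.2]), mul_sub,
      mul_div_cancel₀ _ hr.ne'] at this
    linarith

lemma properSpace [CompleteSpace X] [LocallyCompactSpace X] (h : HasAlmostMinimizers X) :
    ProperSpace X := by
  refine ⟨fun p r₁ ↦ ?_⟩
  by_contra hr₁
  set S : Set ℝ := {r | IsCompact (closedBall p r)} with hS
  have hmono : ∀ r ∈ S, ∀ r' ≤ r, r' ∈ S := fun r hr r' hr' ↦
    IsCompact.of_isClosed_subset hr isClosed_closedBall (closedBall_subset_closedBall hr')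
  have hbdd : BddAbove S := ⟨r₁, fun r hr ↦ by
    by_contra! hlt
    exact hr₁ (hmono r hr r₁ hlt.le)⟩
  have h0 : (0 : ℝ) ∈ S := by simp [hS]
  set R := sSup S with hR
  have hR0 : 0 ≤ R := le_csSup hbdd h0
  have hRS : IsCompact (closedBall p R) := by
    rw [isCompact_iff_totallyBounded_isComplete]
    refine ⟨?_, isClosed_closedBall.isComplete⟩
    rw [totallyBounded_iff]
    intro ε hε
    obtain ⟨r', hr'S, hr'⟩ := exists_lt_of_lt_csSup ⟨0, h0⟩ (show R - ε / 4 < sSup S by linarith)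
    obtain ⟨r, hrS, hr, hr0⟩ : ∃ r ∈ S, R - ε / 4 < r ∧ 0 ≤ r := by
      rcases le_total 0 r' with h' | h'
      · exact ⟨r', hr'S, hr', h'⟩
      · exact ⟨0, h0, by linarith, le_rfl⟩
    obtain ⟨t, ht, htc⟩ := totallyBounded_iff.1 (IsCompact.totallyBounded hrS) (ε / 2) (by linarith)
    refine ⟨t, ht, fun x hx ↦ ?_⟩
    rw [mem_closedBall'] at hx
    obtain ⟨y, hy1, hy2⟩ := h.exists_between (x := p) (z := x) hr0 (half_pos hε) (by linarith)
    obtain ⟨i, hi, hyi⟩ := mem_iUnion₂.1 (htc (mem_closedBall'.2 hy1))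
    refine mem_iUnion₂.2 ⟨i, hi, ?_⟩
    rw [mem_ball] at hyi ⊢
    have := dist_triangle x y i
    rw [dist_comm x y] at this
    linarith
  obtain ⟨δ, hδ, hδc⟩ := hRS.exists_isCompact_cthickening
  have : R + δ / 2 ∈ S := by
    refine hδc.of_isClosed_subset isClosed_closedBall fun x hx ↦ ?_
    rw [mem_closedBall'] at hx
    obtain ⟨y, hy1, hy2⟩ := h.exists_between (x := p) (z := x) hR0 hδ (by linarith)
    refine mem_cthickening_of_dist_le x y δ _ (mem_closedBall'.2 hy1) ?_
    rw [dist_comm]; exact hy2.le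
  linarith [le_csSup hbdd this]

/-- In a proper space with almost minimizing curves, any two points are joined by a curve of
constant metric speed equal to their distance. -/
lemma exists_minimizer [ProperSpace X] (h : HasAlmostMinimizers X) (p z : X) :
    ∃ f : ℝ → X, f 0 = p ∧ f 1 = z ∧
      ∀ s ∈ Icc (0 : ℝ) 1, ∀ t ∈ Icc (0 : ℝ) 1, dist (f s) (f t) = dist p z * |s - t| := by
  set D := dist p z with hD
  have hD0 : 0 ≤ D := dist_nonneg
  set K : ℕ → Set (ℝ → X) := fun n ↦ (univ.pi fun _ ↦ closedBall p (D + 1)) ∩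
    {f | f 0 = p ∧ f 1 = z ∧ ∀ s ∈ Icc (0 : ℝ) 1, ∀ t ∈ Icc (0 : ℝ) 1,
      dist (f s) (f t) ≤ (D + 1 / ((n : ℝ) + 1)) * |s - t|} with hK
  have hcl : ∀ n, IsClosed (K n) := by
    intro n
    refine (isClosed_set_pi fun _ _ ↦ isClosed_closedBall).inter ?_
    simp only [ofPred_and, ofPred_forall]
    refine (isClosed_eq (continuous_apply _) continuous_const).inter
      ((isClosed_eq (continuous_apply _) continuous_const).inter ?_)
    refine isClosed_iInter fun s ↦ isClosed_iInter fun _ ↦ isClosed_iInter fun t ↦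
      isClosed_iInter fun _ ↦ isClosed_le ?_ continuous_const
    exact (continuous_apply s).dist (continuous_apply t)
  obtain ⟨f, hf⟩ : (⋂ n, K n).Nonempty := by
    refine IsCompact.nonempty_iInter_of_sequence_nonempty_isCompact_isClosed K ?_ ?_ ?_ hcl
    · rintro n f ⟨h1, h2, h3, h4⟩
      refine ⟨h1, h2, h3, fun s hs t ht ↦ (h4 s hs t ht).trans ?_⟩
      gcongr
      exact Nat.le_succ n
    · intro n
      have hn : (0 : ℝ) < 1 / ((n : ℝ) + 1) := by positivity
      have hn1 : 1 / ((n : ℝ) + 1) ≤ 1 := by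
        rw [div_le_one (by positivity)]; linarith [n.cast_nonneg (α := ℝ)]
      obtain ⟨f, f0, f1, hf⟩ := h p z (D + 1 / ((n : ℝ) + 1)) (by linarith)
      have hpr : ∀ t ∈ Icc (0 : ℝ) 1, (projIcc (0 : ℝ) 1 zero_le_one t : ℝ) = t :=
        fun t ht ↦ by rw [projIcc_of_mem zero_le_one ht]
      refine ⟨fun t ↦ f (projIcc 0 1 zero_le_one t), ?_, ?_, ?_, ?_⟩
      · intro t _
        have ht := (projIcc (0 : ℝ) 1 zero_le_one t).2
        have := hf 0 (by simp) _ ht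
        rw [f0, zero_sub, abs_neg, abs_of_nonneg ht.1] at this
        rw [mem_closedBall']
        exact this.trans ((mul_le_of_le_one_right (by positivity) ht.2).trans (by linarith))
      · simpa using f0
      · simpa using f1
      · intro s hs t ht
        simp only [hpr s hs, hpr t ht]
        exact hf s hs t ht
    · exact (isCompact_univ_pi fun _ ↦ isCompact_closedBall p (D + 1)).of_isClosed_subset (hcl 0)
        inter_subset_left
  have hfn := fun n ↦ (mem_iInter.1 hf n).2
  have hle : ∀ s ∈ Icc (0 : ℝ) 1, ∀ t ∈ Icc (0 : ℝ) 1, dist (f s) (f t) ≤ D * |s - t| := by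
    intro s hs t ht
    have hlim : Tendsto (fun n : ℕ ↦ (D + 1 / ((n : ℝ) + 1)) * |s - t|) atTop
        (𝓝 ((D + 0) * |s - t|)) :=
      (tendsto_const_nhds.add tendsto_one_div_add_atTop_nhds_zero_nat).mul_const _
    rw [add_zero] at hlim
    exact ge_of_tendsto' hlim fun n ↦ (hfn n).2.2 s hs t ht
  refine ⟨f, (hfn 0).1, (hfn 0).2.1, ?_⟩
  have key : ∀ s ∈ Icc (0 : ℝ) 1, ∀ t ∈ Icc (0 : ℝ) 1, s ≤ t →
      dist (f s) (f t) = D * |s - t| := by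
    intro s hs t ht hst
    refine le_antisymm (hle s hs t ht) ?_
    have h1 := hle 0 (by simp) s hs
    have h2 := hle t ht 1 (by simp)
    have h3 := dist_triangle4 (f 0) (f s) (f t) (f 1)
    rw [(hfn 0).1, (hfn 0).2.1] at h3
    rw [(hfn 0).1] at h1
    rw [(hfn 0).2.1] at h2
    rw [zero_sub, abs_neg, abs_of_nonneg hs.1] at h1
    rw [abs_sub_comm, abs_of_nonneg (by linarith [ht.2])] at h2
    rw [abs_sub_comm, abs_of_nonneg (by linarith)]
    nlinarith
  intro s hs t ht
  rcases le_total s t with hst | hst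
  · exact key s hs t ht hst
  · rw [dist_comm, abs_sub_comm]; exact key t ht s hs hst

end HasAlmostMinimizers

/-- The model space of an `n`-dimensional manifold. -/
abbrev Coord (n : ℕ) := EuclideanSpace ℝ (Fin n)

section Length

variable {n : ℕ} {M : Type*} [MetricSpace M] [ChartedSpace (EuclideanSpace ℝ (Fin n)) M]
  [IsManifold (𝓡 n) ∞ M] [RiemannianBundle (fun x : M ↦ TangentSpace (𝓡 n) x)]

/-- The Riemannian speed of a curve on the set of times `s`. -/
def speedWithin (n : ℕ) {M : Type*} [TopologicalSpace M]
    [ChartedSpace (EuclideanSpace ℝ (Fin n)) M]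
    [RiemannianBundle (fun x : M ↦ TangentSpace (𝓡 n) x)] (γ : ℝ → M) (s : Set ℝ) (t : ℝ) : ℝ :=
  ‖mfderivWithin 𝓘(ℝ, ℝ) (𝓡 n) γ s t (1 : ℝ)‖

lemma speedWithin_nonneg (γ : ℝ → M) (s : Set ℝ) (t : ℝ) : 0 ≤ speedWithin n γ s t :=
  norm_nonneg _

lemma continuousOn_curveLift {γ : ℝ → M} {s : Set ℝ} (hs : UniqueDiffOn ℝ s)
    (hγ : ContMDiffOn 𝓘(ℝ, ℝ) (𝓡 n) 1 γ s) : ContinuousOn (curveLift n γ s) s := by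
  have h1 := hγ.continuousOn_tangentMapWithin le_rfl hs.uniqueMDiffOn
  have h2 : Continuous (fun t : ℝ ↦ (⟨t, (1 : ℝ)⟩ : TangentBundle 𝓘(ℝ, ℝ) ℝ)) := by
    rw [← (tangentBundleModelSpaceHomeomorph 𝓘(ℝ, ℝ)).comp_continuous_iff]
    exact continuous_id.prodMk continuous_const
  exact h1.comp h2.continuousOn (fun t ht ↦ ht)

lemma continuousOn_speedWithin
    [IsContMDiffRiemannianBundle (𝓡 n) ∞ (EuclideanSpace ℝ (Fin n))
      (fun x : M ↦ TangentSpace (𝓡 n) x)]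
    {γ : ℝ → M} {s : Set ℝ} (hs : UniqueDiffOn ℝ s)
    (hγ : ContMDiffOn 𝓘(ℝ, ℝ) (𝓡 n) 1 γ s) : ContinuousOn (speedWithin n γ s) s := by
  have h := continuousOn_curveLift hs hγ
  have : IsContMDiffRiemannianBundle (𝓡 n) 0 (EuclideanSpace ℝ (Fin n))
      (fun x : M ↦ TangentSpace (𝓡 n) x) := IsContMDiffRiemannianBundle.of_le (n := ∞) (by simp)
  have h1 : ContMDiffOn 𝓘(ℝ, ℝ) (𝓡 n).tangent 0 (curveLift n γ s) s := contMDiffOn_zero_iff.2 h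
  have h2 := (ContMDiffOn.inner_bundle (IB := 𝓡 n) (F := EuclideanSpace ℝ (Fin n))
    (E := fun x : M ↦ TangentSpace (𝓡 n) x) (b := γ)
    (v := fun t ↦ mfderivWithin 𝓘(ℝ, ℝ) (𝓡 n) γ s t (1 : ℝ))
    (w := fun t ↦ mfderivWithin 𝓘(ℝ, ℝ) (𝓡 n) γ s t (1 : ℝ)) h1 h1).continuousOn
  exact h2.sqrt.congr fun t _ ↦ norm_eq_sqrt_real_inner _

variable [IsContMDiffRiemannianBundle (𝓡 n) ∞ (EuclideanSpace ℝ (Fin n))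
      (fun x : M ↦ TangentSpace (𝓡 n) x)]
  [IsRiemannianManifold (𝓡 n) M]

lemma pathELength_eq_integral {γ : ℝ → M} {a b : ℝ} (hab : a < b)
    (hγ : ContMDiffOn 𝓘(ℝ, ℝ) (𝓡 n) 1 γ (Icc a b)) :
    Manifold.pathELength (𝓡 n) γ a b =
      ENNReal.ofReal (∫ t in a..b, speedWithin n γ (Icc a b) t) := by
  have hc := continuousOn_speedWithin (uniqueDiffOn_Icc hab) hγ
  rw [Manifold.pathELength_eq_lintegral_mfderivWithin_Icc,
    intervalIntegral.integral_of_le hab.le, ← integral_Icc_eq_integral_Ioc,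
    ofReal_integral_eq_lintegral_ofReal]
  · refine lintegral_congr fun t ↦ ?_
    exact (ofReal_norm _).symm
  · exact hc.integrableOn_compact isCompact_Icc
  · exact Eventually.of_forall fun t ↦ speedWithin_nonneg _ _ _

lemma dist_le_integral_speedWithin {γ : ℝ → M} {a b : ℝ}
    (hγ : ContMDiffOn 𝓘(ℝ, ℝ) (𝓡 n) 1 γ (Icc a b)) {s t : ℝ} (has : a ≤ s) (hst : s ≤ t)
    (htb : t ≤ b) : dist (γ s) (γ t) ≤ ∫ r in s..t, speedWithin n γ (Icc a b) r := by
  rcases hst.eq_or_lt with rfl | hst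
  · simp
  have hγ' : ContMDiffOn 𝓘(ℝ, ℝ) (𝓡 n) 1 γ (Icc s t) := hγ.mono (Icc_subset_Icc has htb)
  have h1 := Manifold.riemannianEDist_le_pathELength hγ' rfl rfl hst.le
  rw [← IsRiemannianManifold.out (I := 𝓡 n), pathELength_eq_integral hst hγ', edist_dist] at h1
  have h2 : ∫ r in s..t, speedWithin n γ (Icc s t) r = ∫ r in s..t, speedWithin n γ (Icc a b) r := by
    rw [intervalIntegral.integral_of_le hst.le, intervalIntegral.integral_of_le hst.le,
      integral_Ioc_eq_integral_Ioo, integral_Ioc_eq_integral_Ioo]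
    refine setIntegral_congr_fun measurableSet_Ioo fun r hr ↦ ?_
    rw [speedWithin, speedWithin, mfderivWithin_of_mem_nhds (Icc_mem_nhds hr.1 hr.2),
      mfderivWithin_of_mem_nhds (Icc_mem_nhds (has.trans_lt hr.1) (hr.2.trans_le htb))]
  rw [h2] at h1
  refine (ENNReal.ofReal_le_ofReal_iff ?_).1 h1
  exact intervalIntegral.integral_nonneg hst.le fun r _ ↦ speedWithin_nonneg _ _ _

lemma dist_lt_of_pathELength_lt {r : ℝ} {x y : M} (h : dist x y < r) : 
    ∃ γ : ℝ → M, γ 0 = x ∧ γ 1 = y ∧ ContMDiffOn 𝓘(ℝ, ℝ) (𝓡 n) 1 γ (Icc 0 1) ∧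
      Manifold.pathELength (𝓡 n) γ 0 1 < ENNReal.ofReal r := by
  have hr : 0 < r := dist_nonneg.trans_lt h
  apply Manifold.exists_lt_of_riemannianEDist_lt
  rw [← IsRiemannianManifold.out (I := 𝓡 n), edist_dist]
  exact (ENNReal.ofReal_lt_ofReal_iff hr).2 h

lemma exists_curve_integral_lt {r : ℝ} {x y : M} (h : dist x y < r) :
    ∃ γ : ℝ → M, γ 0 = x ∧ γ 1 = y ∧ ContMDiffOn 𝓘(ℝ, ℝ) (𝓡 n) 1 γ (Icc 0 1) ∧
      ∫ t in (0 : ℝ)..1, speedWithin n γ (Icc 0 1) t < r := by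
  obtain ⟨γ, h0, h1, hγ, hlt⟩ := dist_lt_of_pathELength_lt (n := n) h
  refine ⟨γ, h0, h1, hγ, ?_⟩
  rw [pathELength_eq_integral zero_lt_one hγ] at hlt
  exact (ENNReal.ofReal_lt_ofReal_iff (dist_nonneg.trans_lt h)).1 hlt

lemma hasAlmostMinimizers (n : ℕ) (M : Type*) [MetricSpace M]
    [ChartedSpace (EuclideanSpace ℝ (Fin n)) M]
    [IsManifold (𝓡 n) ∞ M] [RiemannianBundle (fun x : M ↦ TangentSpace (𝓡 n) x)]
    [IsContMDiffRiemannianBundle (𝓡 n) ∞ (EuclideanSpace ℝ (Fin n))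
      (fun x : M ↦ TangentSpace (𝓡 n) x)]
    [IsRiemannianManifold (𝓡 n) M] : HasAlmostMinimizers M := by
  intro x y r hr
  obtain ⟨γ, h0, h1, hγ, hlt⟩ := exists_curve_integral_lt (n := n) hr
  have hc := continuousOn_speedWithin (uniqueDiffOn_Icc (zero_lt_one (α := ℝ))) hγ
  set L : ℝ → ℝ := fun t ↦ ∫ s in (0 : ℝ)..t, speedWithin n γ (Icc 0 1) s with hL
  have hint : ∀ s ∈ Icc (0 : ℝ) 1, ∀ t ∈ Icc (0 : ℝ) 1,
      IntervalIntegrable (speedWithin n γ (Icc 0 1)) volume s t := fun s hs t ht ↦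
    (hc.mono (uIcc_subset_Icc hs ht)).intervalIntegrable
  have hLsub : ∀ s ∈ Icc (0 : ℝ) 1, ∀ t ∈ Icc (0 : ℝ) 1, s ≤ t → dist (γ s) (γ t) ≤ L t - L s := by
    intro s hs t ht hst
    have := dist_le_integral_speedWithin hγ hs.1 hst ht.2
    rwa [hL, intervalIntegral.integral_interval_sub_left (hint 0 (by simp) t ht)
      (hint 0 (by simp) s hs)]
  have hLabs : ∀ s ∈ Icc (0 : ℝ) 1, ∀ t ∈ Icc (0 : ℝ) 1, dist (γ s) (γ t) ≤ |L s - L t| := by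
    intro s hs t ht
    rcases le_total s t with h | h
    · rw [abs_sub_comm]; exact (hLsub s hs t ht h).trans (le_abs_self _)
    · rw [dist_comm]; exact (hLsub t ht s hs h).trans (le_abs_self _)
  have hLc : ContinuousOn L (Icc 0 1) := by
    have := intervalIntegral.continuousOn_primitive_interval' (hint 0 (by simp) 1 (by simp))
      (a := 0) (by simp)
    rwa [uIcc_of_le zero_le_one] at this
  have hL0 : L 0 = 0 := by simp [hL]
  have hL1 : L 1 < r := hlt
  have hL1' : 0 ≤ L 1 := intervalIntegral.integral_nonneg zero_le_one
    fun r _ ↦ speedWithin_nonneg _ _ _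
  have hex : ∀ s : ℝ, ∃ τ ∈ Icc (0 : ℝ) 1, s ∈ Icc (0 : ℝ) 1 → L τ = s * L 1 := by
    intro s
    by_cases hs : s ∈ Icc (0 : ℝ) 1
    · obtain ⟨τ, hτ, hτ'⟩ := intermediate_value_Icc zero_le_one hLc
        (show s * L 1 ∈ Icc (L 0) (L 1) from ⟨by rw [hL0]; exact mul_nonneg hs.1 hL1',
          mul_le_of_le_one_left hL1' hs.2⟩)
      exact ⟨τ, hτ, fun _ ↦ hτ'⟩
    · exact ⟨0, by simp, fun h ↦ absurd h hs⟩
  choose τ hτ hLτ using hex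
  refine ⟨fun s ↦ γ (τ s), ?_, ?_, fun s hs t ht ↦ ?_⟩
  · have := hLabs (τ 0) (hτ 0) 0 (by simp)
    rw [hLτ 0 (by simp), hL0] at this
    rw [← h0]; simpa using this
  · have := hLabs (τ 1) (hτ 1) 1 (by simp)
    rw [hLτ 1 (by simp)] at this
    rw [← h1]; simpa using this
  · refine (hLabs _ (hτ s) _ (hτ t)).trans ?_
    rw [hLτ s hs, hLτ t ht, ← sub_mul, abs_mul, abs_of_nonneg hL1', mul_comm]
    gcongr

end Length

section ChartMetric

variable {n : ℕ} {M : Type*} [TopologicalSpace M] [ChartedSpace (EuclideanSpace ℝ (Fin n)) M]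
  [IsManifold (𝓡 n) ∞ M]

lemma isOpen_chart_target (x₀ : M) : IsOpen (extChartAt (𝓡 n) x₀).target :=
  isOpen_extChartAt_target x₀

lemma contMDiffOn_symm_lift (x₀ : M) (v : Coord n) :
    ContMDiffOn 𝓘(ℝ, Coord n) (𝓡 n).tangent ∞
      (fun u ↦ (⟨(extChartAt (𝓡 n) x₀).symm u,
        mfderiv 𝓘(ℝ, Coord n) (𝓡 n) (extChartAt (𝓡 n) x₀).symm u v⟩ : TangentBundle (𝓡 n) M))
      (extChartAt (𝓡 n) x₀).target := by
  have ho := isOpen_chart_target (n := n) x₀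
  have h1 := (contMDiffOn_extChartAt_symm (I := 𝓡 n) (n := ∞) x₀).contMDiffOn_tangentMapWithin
    (m := ∞) (by simp) ho.uniqueDiffOn.uniqueMDiffOn
  have h2 : ContMDiff 𝓘(ℝ, Coord n) (𝓘(ℝ, Coord n).tangent) ∞
      (fun u : Coord n ↦ (⟨u, v⟩ : TangentBundle 𝓘(ℝ, Coord n) (Coord n))) := by
    intro u
    rw [contMDiffAt_totalSpace]
    refine ⟨contMDiffAt_id, ?_⟩
    simpa using contMDiffAt_const
  refine (h1.comp h2.contMDiffOn (fun t ht ↦ ht)).congr fun u hu ↦ ?_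
  simp only [Function.comp_apply, tangentMapWithin]
  rw [mfderivWithin_of_mem_nhds (ho.mem_nhds hu)]

variable [RiemannianBundle (fun x : M ↦ TangentSpace (𝓡 n) x)]

/-- The differential of the inverse chart. -/
def pushVec {n : ℕ} {M : Type*} [TopologicalSpace M] [ChartedSpace (EuclideanSpace ℝ (Fin n)) M]
    (x₀ : M) (u : Coord n) :
    Coord n →L[ℝ] TangentSpace (𝓡 n) ((extChartAt (𝓡 n) x₀).symm u) :=
  mfderiv 𝓘(ℝ, Coord n) (𝓡 n) (extChartAt (𝓡 n) x₀).symm u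

lemma chartMetric_eq_inner (x₀ : M) (u v w : Coord n) :
    chartMetric x₀ u v w = inner ℝ (pushVec x₀ u v) (pushVec x₀ u w) :=
  rfl

/-- The metric in the chart at `x₀`, as a bilinear form depending on the coordinate point. -/
def metricForm (x₀ : M) (u : Coord n) : Coord n →L[ℝ] Coord n →L[ℝ] ℝ :=
  (LinearMap.mk₂ ℝ (chartMetric x₀ u)
    (fun _ _ _ ↦ by simp only [chartMetric_eq_inner, map_add, inner_add_left])
    (fun _ _ _ ↦ by simp only [chartMetric_eq_inner, map_smul, real_inner_smul_left, smul_eq_mul])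
    (fun _ _ _ ↦ by simp only [chartMetric_eq_inner, map_add, inner_add_right])
    (fun _ _ _ ↦ by simp only [chartMetric_eq_inner, map_smul, real_inner_smul_right,
      smul_eq_mul])).toContinuousBilinearMap

lemma metricForm_apply (x₀ : M) (u v w : Coord n) : metricForm x₀ u v w = chartMetric x₀ u v w :=
  rfl

lemma metricForm_symm (x₀ : M) (u v w : Coord n) : metricForm x₀ u v w = metricForm x₀ u w v := by
  rw [metricForm_apply, metricForm_apply, chartMetric_eq_inner, chartMetric_eq_inner,
    real_inner_comm]

lemma metricForm_self (x₀ : M) (u v : Coord n) : metricForm x₀ u v v = ‖pushVec x₀ u v‖ ^ 2 := by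
  rw [metricForm_apply, chartMetric_eq_inner, real_inner_self_eq_norm_sq]

lemma isInvertible_pushVec {x₀ : M} {u : Coord n} (hu : u ∈ (extChartAt (𝓡 n) x₀).target) :
    (pushVec x₀ u).IsInvertible := by
  have h := isInvertible_mfderivWithin_extChartAt_symm (I := 𝓡 n) hu
  rw [mfderivWithin_of_mem_nhds (by simp)] at h
  exact h

lemma metricForm_pos {x₀ : M} {u v : Coord n} (hu : u ∈ (extChartAt (𝓡 n) x₀).target)
    (hv : v ≠ 0) : 0 < metricForm x₀ u v v := by
  rw [metricForm_self]
  have : pushVec x₀ u v ≠ 0 := fun h ↦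
    hv ((isInvertible_pushVec hu).injective (h.trans (map_zero _).symm))
  positivity

lemma contDiffOn_metricForm
    [IsContMDiffRiemannianBundle (𝓡 n) ∞ (EuclideanSpace ℝ (Fin n))
      (fun x : M ↦ TangentSpace (𝓡 n) x)] (x₀ : M) :
    ContDiffOn ℝ ∞ (metricForm (n := n) x₀) (extChartAt (𝓡 n) x₀).target := by
  rw [contDiffOn_clm_apply]
  intro v
  rw [contDiffOn_clm_apply]
  intro w
  rw [← contMDiffOn_iff_contDiffOn]
  exact ContMDiffOn.inner_bundle (IB := 𝓡 n) (F := EuclideanSpace ℝ (Fin n))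
    (E := fun x : M ↦ TangentSpace (𝓡 n) x) (contMDiffOn_symm_lift x₀ v)
    (contMDiffOn_symm_lift x₀ w)

/-- The coordinate expression of a curve in the chart at `x₀`. -/
def coordCurve (n : ℕ) {M : Type*} [TopologicalSpace M]
    [ChartedSpace (EuclideanSpace ℝ (Fin n)) M] (x₀ : M) (γ : ℝ → M) (t : ℝ) : Coord n :=
  extChartAt (𝓡 n) x₀ (γ t)

lemma contDiffWithinAt_coordCurve {k : ℕ∞} {γ : ℝ → M} {s : Set ℝ} {t : ℝ}
    (hγ : ContMDiffWithinAt 𝓘(ℝ, ℝ) (𝓡 n) k γ s t) {x₀ : M}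
    (hx : γ t ∈ (extChartAt (𝓡 n) x₀).source) :
    ContDiffWithinAt ℝ k (coordCurve n x₀ γ) s t := by
  rw [← contMDiffWithinAt_iff_contDiffWithinAt]
  have hx' : γ t ∈ (chartAt (EuclideanSpace ℝ (Fin n)) x₀).source := by
    rwa [extChartAt_source] at hx
  have h1 : ContMDiffAt (𝓡 n) 𝓘(ℝ, Coord n) k (extChartAt (𝓡 n) x₀) (γ t) :=
    (contMDiffAt_extChartAt' (n := ∞) hx').of_le (by exact_mod_cast le_top)
  exact h1.comp_contMDiffWithinAt t hγ

/-- The velocity of a curve computed in a chart. -/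
lemma mfderivWithin_eq_pushVec {γ : ℝ → M} {s : Set ℝ} {t : ℝ} (hs : UniqueDiffWithinAt ℝ s t)
    {x₀ : M} (hc : DifferentiableWithinAt ℝ (coordCurve n x₀ γ) s t)
    (hγ : ContinuousWithinAt γ s t)
    (hx : γ t ∈ (extChartAt (𝓡 n) x₀).source) :
    HEq (mfderivWithin 𝓘(ℝ, ℝ) (𝓡 n) γ s t (1 : ℝ))
      (pushVec x₀ (coordCurve n x₀ γ t) (derivWithin (coordCurve n x₀ γ) s t)) := by
  have hu : coordCurve n x₀ γ t ∈ (extChartAt (𝓡 n) x₀).target := (extChartAt (𝓡 n) x₀).map_source hx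
  have hev : γ =ᶠ[𝓝[s] t] (extChartAt (𝓡 n) x₀).symm ∘ coordCurve n x₀ γ := by
    filter_upwards [hγ ((isOpen_extChartAt_source x₀).mem_nhds hx)] with r hr
    exact ((extChartAt (𝓡 n) x₀).left_inv hr).symm
  have hs' : MDifferentiableAt 𝓘(ℝ, Coord n) (𝓡 n) (extChartAt (𝓡 n) x₀).symm
      (coordCurve n x₀ γ t) :=
    (mdifferentiableOn_extChartAt_symm (I := 𝓡 n)).mdifferentiableAt
      ((isOpen_chart_target x₀).mem_nhds hu)
  have hval : γ t = ((extChartAt (𝓡 n) x₀).symm ∘ coordCurve n x₀ γ) t :=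
    ((extChartAt (𝓡 n) x₀).left_inv hx).symm
  have h1 : mfderivWithin 𝓘(ℝ, ℝ) (𝓡 n) ((extChartAt (𝓡 n) x₀).symm ∘ coordCurve n x₀ γ) s t =
      (pushVec x₀ (coordCurve n x₀ γ t)).comp
        (mfderivWithin 𝓘(ℝ, ℝ) 𝓘(ℝ, Coord n) (coordCurve n x₀ γ) s t) :=
    mfderiv_comp_mfderivWithin t hs' hc.mdifferentiableWithinAt hs.uniqueMDiffWithinAt
  have h2 : mfderivWithin 𝓘(ℝ, ℝ) (𝓡 n) γ s t = _ := hev.mfderivWithin_eq hval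
  rw [h2, h1]
  apply heq_of_eq
  rw [mfderivWithin_eq_fderivWithin]
  rfl

lemma curveLift_eq {γ : ℝ → M} {s : Set ℝ} {t : ℝ} (hs : UniqueDiffWithinAt ℝ s t)
    {x₀ : M} (hc : DifferentiableWithinAt ℝ (coordCurve n x₀ γ) s t)
    (hγ : ContinuousWithinAt γ s t)
    (hx : γ t ∈ (extChartAt (𝓡 n) x₀).source) :
    curveLift n γ s t = (⟨(extChartAt (𝓡 n) x₀).symm (coordCurve n x₀ γ t),
      pushVec x₀ (coordCurve n x₀ γ t) (derivWithin (coordCurve n x₀ γ) s t)⟩ :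
        TangentBundle (𝓡 n) M) := by
  have h1 : γ t = (extChartAt (𝓡 n) x₀).symm (coordCurve n x₀ γ t) :=
    ((extChartAt (𝓡 n) x₀).left_inv hx).symm
  rw [curveLift]
  exact Bundle.TotalSpace.ext h1 (mfderivWithin_eq_pushVec hs hc hγ hx)

lemma speedWithin_sq {γ : ℝ → M} {s : Set ℝ} {t : ℝ} (hs : UniqueDiffWithinAt ℝ s t)
    {x₀ : M} (hc : DifferentiableWithinAt ℝ (coordCurve n x₀ γ) s t)
    (hγ : ContinuousWithinAt γ s t)
    (hx : γ t ∈ (extChartAt (𝓡 n) x₀).source) :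
    speedWithin n γ s t ^ 2 = metricForm x₀ (coordCurve n x₀ γ t)
      (derivWithin (coordCurve n x₀ γ) s t) (derivWithin (coordCurve n x₀ γ) s t) := by
  have h := curveLift_eq hs hc hγ hx
  have h2 := congrArg (fun z : TangentBundle (𝓡 n) M ↦ ‖(z.2 : TangentSpace (𝓡 n) z.1)‖) h
  rw [metricForm_self]
  exact congrArg (· ^ 2) h2

end ChartMetric

section CoordinateMetric

variable {E : Type*} [NormedAddCommGroup E] [NormedSpace ℝ E]

/-- A smooth Riemannian metric on an open subset `U` of a vector space. -/
structure IsMetricOn (g : E → E →L[ℝ] E →L[ℝ] ℝ) (U : Set E) : Prop where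
  isOpen : IsOpen U
  contDiffOn : ContDiffOn ℝ ∞ g U
  symm : ∀ u v w, g u v w = g u w v
  pos : ∀ u ∈ U, ∀ v, v ≠ 0 → 0 < g u v v

/-- The linear form `g(Γ(v, v), ·)` of the Levi-Civita connection of `g`. -/
def lowerChristoffel (g : E → E →L[ℝ] E →L[ℝ] ℝ) (u v : E) : E →L[ℝ] ℝ :=
  fderiv ℝ g u v v - (1 / 2 : ℝ) • ((fderiv ℝ g u).flip v).flip v

lemma lowerChristoffel_apply (g : E → E →L[ℝ] E →L[ℝ] ℝ) (u v w : E) :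
    lowerChristoffel g u v w = fderiv ℝ g u v v w - (1 / 2 : ℝ) * fderiv ℝ g u w v v := by
  simp [lowerChristoffel]

/-- The coordinate acceleration `-Γ(v, v)` of a geodesic with velocity `v` at `u`. -/
def geodAcc (g : E → E →L[ℝ] E →L[ℝ] ℝ) (u v : E) : E :=
  -(g u).inverse (lowerChristoffel g u v)

/-- The geodesic spray of `g`. -/
def spray (g : E → E →L[ℝ] E →L[ℝ] ℝ) (p : E × E) : E × E := (p.2, geodAcc g p.1 p.2)

/-- The curve `c` solves the geodesic equation of `g` near the time `t`. -/
def IsSolAt (g : E → E →L[ℝ] E →L[ℝ] ℝ) (c : ℝ → E) (t : ℝ) : Prop :=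
  ∀ᶠ s in 𝓝 t, DifferentiableAt ℝ c s ∧ HasDerivAt (deriv c) (geodAcc g (c s) (deriv c s)) s

lemma geodAcc_neg (g : E → E →L[ℝ] E →L[ℝ] ℝ) (u v : E) : geodAcc g u (-v) = geodAcc g u v := by
  have : lowerChristoffel g u (-v) = lowerChristoffel g u v := by
    ext w; simp [lowerChristoffel_apply]
  rw [geodAcc, this, geodAcc]

namespace IsSolAt

variable {g : E → E →L[ℝ] E →L[ℝ] ℝ} {c c₁ c₂ : ℝ → E} {t : ℝ}

lemma differentiableAt (h : IsSolAt g c t) : DifferentiableAt ℝ c t := h.self_of_nhds.1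

lemma hasDerivAt_deriv (h : IsSolAt g c t) :
    HasDerivAt (deriv c) (geodAcc g (c t) (deriv c t)) t := h.self_of_nhds.2

lemma eventually (h : IsSolAt g c t) : ∀ᶠ s in 𝓝 t, IsSolAt g c s :=
  h.eventually_nhds

lemma congr (h : IsSolAt g c₁ t) (hc : c₂ =ᶠ[𝓝 t] c₁) : IsSolAt g c₂ t := by
  filter_upwards [h, hc.eventually_nhds] with s hs hs'
  refine ⟨hs.1.congr_of_eventuallyEq hs', ?_⟩
  rw [show c₂ s = c₁ s from hs'.self_of_nhds, EventuallyEq.deriv_eq hs']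
  exact hs.2.congr_of_eventuallyEq (EventuallyEq.deriv hs')

lemma of_hasDerivAt {v : ℝ → E} (hc : ∀ᶠ s in 𝓝 t, HasDerivAt c (v s) s)
    (hv : ∀ᶠ s in 𝓝 t, HasDerivAt v (geodAcc g (c s) (v s)) s) : IsSolAt g c t := by
  filter_upwards [hc.eventually_nhds, hv] with s hs hs'
  have : deriv c =ᶠ[𝓝 s] v := hs.mono fun r hr ↦ hr.deriv
  refine ⟨hs.self_of_nhds.differentiableAt, ?_⟩
  rw [this.self_of_nhds]
  exact hs'.congr_of_eventuallyEq this

lemma hasDerivAt_spray (h : IsSolAt g c t) :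
    HasDerivAt (fun s ↦ (c s, deriv c s)) (spray g (c t, deriv c t)) t :=
  h.differentiableAt.hasDerivAt.prodMk h.hasDerivAt_deriv

lemma comp_add (a : ℝ) (h : IsSolAt g c (t + a)) : IsSolAt g (fun s ↦ c (s + a)) t := by
  have ht : Tendsto (fun s : ℝ ↦ s + a) (𝓝 t) (𝓝 (t + a)) :=
    (continuous_add_const a).tendsto t
  refine of_hasDerivAt (v := fun s ↦ deriv c (s + a)) ?_ ?_
  · filter_upwards [ht.eventually h] with s hs
    exact hs.1.hasDerivAt.comp_add_const s a
  · filter_upwards [ht.eventually h] with s hs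
    exact hs.2.comp_add_const s a

lemma comp_neg (h : IsSolAt g c (-t)) : IsSolAt g (fun s ↦ c (-s)) t := by
  have ht : Tendsto (fun s : ℝ ↦ -s) (𝓝 t) (𝓝 (-t)) := continuous_neg.tendsto t
  refine of_hasDerivAt (v := fun s ↦ -deriv c (-s)) ?_ ?_
  · filter_upwards [ht.eventually h] with s hs
    have := hs.1.hasDerivAt.scomp s (hasDerivAt_neg s)
    simpa [Function.comp_def] using this
  · filter_upwards [ht.eventually h] with s hs
    have := (hs.2.scomp s (hasDerivAt_neg s)).neg
    rw [geodAcc_neg]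
    simp only [neg_smul, one_smul, neg_neg] at this
    exact this

end IsSolAt

namespace IsMetricOn

variable [FiniteDimensional ℝ E] {g : E → E →L[ℝ] E →L[ℝ] ℝ} {U : Set E} {u : E}

lemma isInvertible (hg : IsMetricOn g U) (hu : u ∈ U) : (g u).IsInvertible := by
  have hinj : Function.Injective (g u : E →ₗ[ℝ] E →L[ℝ] ℝ) := by
    rw [← LinearMap.ker_eq_bot, LinearMap.ker_eq_bot']
    intro v hv
    by_contra hne
    have h1 := hg.pos u hu v hne
    have h2 : g u v = 0 := hv
    simp [h2] at h1
  have hfin : Module.finrank ℝ E = Module.finrank ℝ (E →L[ℝ] ℝ) := by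
    rw [← (LinearMap.toContinuousLinearMap : (E →ₗ[ℝ] ℝ) ≃ₗ[ℝ] E →L[ℝ] ℝ).finrank_eq]
    exact (Subspace.dual_finrank_eq (K := ℝ) (V := E)).symm
  refine ⟨(LinearEquiv.ofInjectiveOfFinrankEq _ hinj hfin).toContinuousLinearEquiv, ?_⟩
  ext v w
  rfl

lemma geodAcc_iff (hg : IsMetricOn g U) (hu : u ∈ U) {v a : E} :
    a = geodAcc g u v ↔ ∀ w, g u a w + lowerChristoffel g u v w = 0 := by
  obtain ⟨e, he⟩ := hg.isInvertible hu
  rw [geodAcc, ← he, ContinuousLinearMap.inverse_equiv]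
  constructor
  · rintro rfl w
    simp
  · intro h
    have : (e : E →L[ℝ] E →L[ℝ] ℝ) a = -lowerChristoffel g u v := by
      ext w
      have := h w
      rw [neg_apply]
      linarith
    rw [← map_neg, ContinuousLinearEquiv.coe_coe, ← this]
    simp

lemma apply_geodAcc (hg : IsMetricOn g U) (hu : u ∈ U) (v w : E) :
    g u (geodAcc g u v) w = -lowerChristoffel g u v w := by
  linarith [(hg.geodAcc_iff hu).1 (rfl : geodAcc g u v = _) w]

lemma contDiffOn_spray (hg : IsMetricOn g U) : ContDiffOn ℝ ∞ (spray g) (U ×ˢ univ) := by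
  have hfst : ContDiffOn ℝ ∞ (Prod.fst : E × E → E) (U ×ˢ univ) := contDiff_fst.contDiffOn
  have hsnd : ContDiffOn ℝ ∞ (Prod.snd : E × E → E) (U ×ˢ univ) := contDiff_snd.contDiffOn
  have hmaps : MapsTo (Prod.fst : E × E → E) (U ×ˢ univ) U := fun p hp ↦ hp.1
  have hdg : ContDiffOn ℝ ∞ (fun p : E × E ↦ fderiv ℝ g p.1) (U ×ˢ univ) :=
    (hg.contDiffOn.fderiv_of_isOpen hg.isOpen (by simp)).comp hfst hmaps
  have hlow : ContDiffOn ℝ ∞ (fun p : E × E ↦ lowerChristoffel g p.1 p.2) (U ×ˢ univ) := by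
    rw [contDiffOn_clm_apply]
    intro w
    simp only [lowerChristoffel_apply]
    refine (((hdg.clm_apply hsnd).clm_apply hsnd).clm_apply contDiffOn_const).sub
      (contDiffOn_const.mul ?_)
    exact ((hdg.clm_apply contDiffOn_const).clm_apply hsnd).clm_apply hsnd
  have hinv : ContDiffOn ℝ ∞ (fun p : E × E ↦ (g p.1).inverse) (U ×ˢ univ) := by
    intro p hp
    obtain ⟨e, he⟩ := hg.isInvertible hp.1
    have h1 : ContDiffAt ℝ ∞ (ContinuousLinearMap.inverse : (E →L[ℝ] E →L[ℝ] ℝ) → _) (g p.1) := by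
      rw [← he]; exact contDiffAt_map_inverse e
    exact h1.comp_contDiffWithinAt p ((hg.contDiffOn.comp hfst hmaps) p hp)
  exact hsnd.prodMk (hinv.clm_apply hlow).neg

lemma contDiffAt_spray (hg : IsMetricOn g U) (hu : u ∈ U) (v : E) :
    ContDiffAt ℝ ∞ (spray g) (u, v) :=
  hg.contDiffOn_spray.contDiffAt ((hg.isOpen.prod isOpen_univ).mem_nhds ⟨hu, trivial⟩)

/-- Solutions of the geodesic equation are smooth. -/
lemma contDiffAt_of_isSolAt (hg : IsMetricOn g U) {c : ℝ → E} {t : ℝ} (hc : IsSolAt g c t)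
    (hu : c t ∈ U) : ContDiffAt ℝ ∞ c t := by
  have h1 : ∀ᶠ s in 𝓝 t, c s ∈ U :=
    hc.differentiableAt.continuousAt.eventually_mem (hg.isOpen.mem_nhds hu)
  obtain ⟨δ, hδ, hball⟩ := nhds_basis_closedBall.eventually_iff.1 (h1.and hc.eventually)
  have h2 : ContDiffOn ℝ ((⊤ : ℕ∞)) (fun s ↦ (c s, deriv c s)) (Icc (t - δ) (t + δ)) := by
    refine ODE.contDiffOn_enat_Icc_of_hasDerivWithinAt (f := fun _ ↦ spray g) (u := U ×ˢ univ)
      ?_ ?_ ?_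
    · exact hg.contDiffOn_spray.comp contDiff_snd.contDiffOn fun p hp ↦ hp.2
    · intro s hs
      rw [← Real.closedBall_eq_Icc] at hs
      exact (hball hs).2.hasDerivAt_spray.hasDerivWithinAt
    · intro s hs
      rw [← Real.closedBall_eq_Icc] at hs
      exact ⟨(hball hs).1, trivial⟩
  exact contDiff_fst.contDiffAt.comp t
    (h2.contDiffAt (Icc_mem_nhds (by linarith) (by linarith)))

/-- Local uniqueness of geodesics with given position and velocity. -/
lemma eventuallyEq_of_isSolAt (hg : IsMetricOn g U) {c₁ c₂ : ℝ → E} {t : ℝ}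
    (h₁ : IsSolAt g c₁ t) (h₂ : IsSolAt g c₂ t) (hu : c₁ t ∈ U) (heq : c₁ t = c₂ t)
    (hd : deriv c₁ t = deriv c₂ t) : c₁ =ᶠ[𝓝 t] c₂ := by
  obtain ⟨K, s, hs, hlip⟩ :=
    ((hg.contDiffAt_spray hu (deriv c₁ t)).of_le (m := 1) (by simp)).exists_lipschitzOnWith
  have key : ∀ c : ℝ → E, IsSolAt g c t → (c t, deriv c t) = (c₁ t, deriv c₁ t) →
      ∀ᶠ r in 𝓝 t, HasDerivAt (fun s ↦ (c s, deriv c s)) (spray g (c r, deriv c r)) r ∧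
        (c r, deriv c r) ∈ s := by
    intro c hc he
    refine (hc.eventually.mono fun r hr ↦ hr.hasDerivAt_spray).and ?_
    exact hc.hasDerivAt_spray.continuousAt.eventually_mem (by rw [he]; exact hs)
  have := ODE_solution_unique_of_eventually (v := fun _ ↦ spray g) (s := fun _ ↦ s) (K := K)
    (Eventually.of_forall fun _ ↦ hlip) (key c₁ h₁ rfl) (key c₂ h₂ (by rw [heq, hd]))
    (by simp only [heq, hd])
  exact this.mono fun r hr ↦ congrArg Prod.fst hr

/-- Geodesics have constant speed. -/
lemma hasDerivAt_energy (hg : IsMetricOn g U) {c : ℝ → E} {t : ℝ} (hc : IsSolAt g c t)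
    (hu : c t ∈ U) : HasDerivAt (fun s ↦ g (c s) (deriv c s) (deriv c s)) 0 t := by
  have h1 : HasDerivAt (fun s ↦ g (c s)) (fderiv ℝ g (c t) (deriv c t)) t :=
    ((hg.contDiffOn.contDiffAt (hg.isOpen.mem_nhds hu)).differentiableAt
      (by simp)).hasFDerivAt.comp_hasDerivAt t hc.differentiableAt.hasDerivAt
  have h2 := (h1.clm_apply hc.hasDerivAt_deriv).clm_apply hc.hasDerivAt_deriv
  refine h2.congr_deriv ?_
  have h3 := hg.apply_geodAcc hu (deriv c t) (deriv c t)
  rw [lowerChristoffel_apply] at h3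
  rw [add_apply, hg.symm _ (deriv c t) (geodAcc g (c t) (deriv c t)), h3]
  ring

/-- The transformation law of the geodesic acceleration under a local isometry. -/
lemma geodAcc_map {E' : Type*} [NormedAddCommGroup E'] [NormedSpace ℝ E'] [FiniteDimensional ℝ E']
    {g' : E' → E' →L[ℝ] E' →L[ℝ] ℝ} {U' : Set E'} (hg : IsMetricOn g U) (hg' : IsMetricOn g' U')
    {ψ : E → E'} (hψ : ContDiffAt ℝ ∞ ψ u) (hu : u ∈ U) (hu' : ψ u ∈ U')
    (hiso : ∀ᶠ p in 𝓝 u, ∀ a b, g p a b = g' (ψ p) (fderiv ℝ ψ p a) (fderiv ℝ ψ p b))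
    (hsurj : Function.Surjective (fderiv ℝ ψ u)) (v : E) :
    fderiv ℝ (fderiv ℝ ψ) u v v + fderiv ℝ ψ u (geodAcc g u v) =
      geodAcc g' (ψ u) (fderiv ℝ ψ u v) := by
  have hdψ : ContDiffAt ℝ ∞ (fderiv ℝ ψ) u := hψ.fderiv_right (by simp)
  have hψ1 : HasFDerivAt ψ (fderiv ℝ ψ u) u := (hψ.differentiableAt (by simp)).hasFDerivAt
  have hψ2 : HasFDerivAt (fderiv ℝ ψ) (fderiv ℝ (fderiv ℝ ψ) u) u :=
    (hdψ.differentiableAt (by simp)).hasFDerivAt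
  have hsym : ∀ a b, fderiv ℝ (fderiv ℝ ψ) u a b = fderiv ℝ (fderiv ℝ ψ) u b a :=
    fun a b ↦ (hψ.isSymmSndFDerivAt (by rw [minSmoothness_of_isRCLikeNormedField]; exact ENat.LEInfty.out)) a b
  have hg1 : HasFDerivAt g (fderiv ℝ g u) u :=
    ((hg.contDiffOn.contDiffAt (hg.isOpen.mem_nhds hu)).differentiableAt (by simp)).hasFDerivAt
  have hg1' : HasFDerivAt g' (fderiv ℝ g' (ψ u)) (ψ u) :=
    ((hg'.contDiffOn.contDiffAt (hg'.isOpen.mem_nhds hu')).differentiableAt (by simp)).hasFDerivAt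
  have key : ∀ a b d, fderiv ℝ g u a b d =
      fderiv ℝ g' (ψ u) (fderiv ℝ ψ u a) (fderiv ℝ ψ u b) (fderiv ℝ ψ u d)
      + g' (ψ u) (fderiv ℝ (fderiv ℝ ψ) u a b) (fderiv ℝ ψ u d)
      + g' (ψ u) (fderiv ℝ ψ u b) (fderiv ℝ (fderiv ℝ ψ) u a d) := by
    intro a b d
    have e1 : HasFDerivAt (fun p ↦ g p b d) _ u :=
      (hg1.clm_apply (hasFDerivAt_const b u)).clm_apply (hasFDerivAt_const d u)
    have e2 : HasFDerivAt (fun p ↦ g' (ψ p) (fderiv ℝ ψ p b) (fderiv ℝ ψ p d)) _ u :=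
      ((hg1'.comp u hψ1).clm_apply (hψ2.clm_apply (hasFDerivAt_const b u))).clm_apply
        (hψ2.clm_apply (hasFDerivAt_const d u))
    have e3 := (e2.congr_of_eventuallyEq (hiso.mono fun p hp ↦ hp b d)).unique e1
    have e4 := congrArg (fun L : E →L[ℝ] ℝ ↦ L a) e3
    simp at e4
    linarith
  rw [hg'.geodAcc_iff hu']
  intro w'
  obtain ⟨w, rfl⟩ := hsurj w'
  have h1 := hg.apply_geodAcc hu v w
  rw [hiso.self_of_nhds] at h1
  rw [lowerChristoffel_apply, key, key] at h1
  rw [lowerChristoffel_apply, map_add, add_apply, h1, hsym w v,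
    hg'.symm (ψ u) (fderiv ℝ (fderiv ℝ ψ) u v w) (fderiv ℝ ψ u v)]
  ring

lemma isSolAt_comp {E' : Type*} [NormedAddCommGroup E'] [NormedSpace ℝ E'] [FiniteDimensional ℝ E']
    {g' : E' → E' →L[ℝ] E' →L[ℝ] ℝ} {U' : Set E'} (hg : IsMetricOn g U) (hg' : IsMetricOn g' U')
    {ψ : E → E'} {V : Set E} (hV : IsOpen V) (hVU : V ⊆ U) (hψ : ContDiffOn ℝ ∞ ψ V)
    (hmaps : MapsTo ψ V U')
    (hiso : ∀ p ∈ V, ∀ a b, g p a b = g' (ψ p) (fderiv ℝ ψ p a) (fderiv ℝ ψ p b))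
    (hsurj : ∀ p ∈ V, Function.Surjective (fderiv ℝ ψ p)) {c : ℝ → E} {t : ℝ} (hc : IsSolAt g c t)
    (ht : c t ∈ V) : IsSolAt g' (fun s ↦ ψ (c s)) t := by
  have hev : ∀ᶠ s in 𝓝 t, c s ∈ V :=
    hc.differentiableAt.continuousAt.eventually_mem (hV.mem_nhds ht)
  refine IsSolAt.of_hasDerivAt (v := fun s ↦ fderiv ℝ ψ (c s) (deriv c s)) ?_ ?_
  · filter_upwards [hev, hc] with s hs hs'
    exact ((hψ.contDiffAt (hV.mem_nhds hs)).differentiableAt (by simp)).hasFDerivAt.comp_hasDerivAt s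
      hs'.1.hasDerivAt
  · filter_upwards [hev, hc] with s hs hs'
    have hψs := hψ.contDiffAt (hV.mem_nhds hs)
    rw [← hg.geodAcc_map hg' hψs (hVU hs) (hmaps hs)
      (by filter_upwards [hV.mem_nhds hs] with p hp using hiso p hp) (hsurj _ hs)]
    have h1 : HasDerivAt (fun s ↦ fderiv ℝ ψ (c s)) (fderiv ℝ (fderiv ℝ ψ) (c s) (deriv c s)) s :=
      ((hψs.fderiv_right (m := ∞) (by simp)).differentiableAt (by simp)).hasFDerivAt.comp_hasDerivAt s
        hs'.1.hasDerivAt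
    exact h1.clm_apply hs'.2

end IsMetricOn

end CoordinateMetric

section LocalGeodesics

variable {n : ℕ} {M : Type*} [MetricSpace M] [ChartedSpace (EuclideanSpace ℝ (Fin n)) M]
  [IsManifold (𝓡 n) ∞ M] [RiemannianBundle (fun x : M ↦ TangentSpace (𝓡 n) x)]
  [IsContMDiffRiemannianBundle (𝓡 n) ∞ (EuclideanSpace ℝ (Fin n))
      (fun x : M ↦ TangentSpace (𝓡 n) x)]

lemma isMetricOn_metricForm (x₀ : M) :
    IsMetricOn (metricForm (n := n) x₀) (extChartAt (𝓡 n) x₀).target where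
  isOpen := isOpen_chart_target x₀
  contDiffOn := contDiffOn_metricForm x₀
  symm := metricForm_symm x₀
  pos _ hu _ hv := metricForm_pos hu hv

lemma christoffelFirst_eq {x₀ : M} {u : Coord n} (hu : u ∈ (extChartAt (𝓡 n) x₀).target)
    (v w : Coord n) :
    christoffelFirst x₀ u v v w = lowerChristoffel (metricForm x₀) u v w := by
  have hg : HasFDerivAt (metricForm (n := n) x₀) (fderiv ℝ (metricForm x₀) u) u :=
    (((contDiffOn_metricForm x₀).contDiffAt ((isOpen_chart_target x₀).mem_nhds hu)).differentiableAt
      (by simp)).hasFDerivAt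
  have key : ∀ a b d : Coord n, fderiv ℝ (fun p ↦ chartMetric x₀ p a b) u d =
      fderiv ℝ (metricForm x₀) u d a b := by
    intro a b d
    have e1 : HasFDerivAt (fun p ↦ metricForm x₀ p a b) _ u :=
      (hg.clm_apply (hasFDerivAt_const a u)).clm_apply (hasFDerivAt_const b u)
    have e2 := congrArg (fun L : Coord n →L[ℝ] ℝ ↦ L d) e1.fderiv
    simp at e2
    exact e2
  rw [christoffelFirst, lowerChristoffel_apply, key, key]
  ring

lemma inner_eq_of_heq {x y : M} (h : x = y) {a b : TangentSpace (𝓡 n) x}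
    {a' b' : TangentSpace (𝓡 n) y} (ha : HEq a a') (hb : HEq b b') :
    (inner ℝ a b : ℝ) = inner ℝ a' b' := by
  subst h
  rw [eq_of_heq ha, eq_of_heq hb]

/-- The change of coordinates between two charts. -/
def chartChange (n : ℕ) {M : Type*} [TopologicalSpace M]
    [ChartedSpace (EuclideanSpace ℝ (Fin n)) M] (x₀ x₁ : M) (u : Coord n) : Coord n :=
  extChartAt (𝓡 n) x₁ ((extChartAt (𝓡 n) x₀).symm u)

/-- The domain of the change of coordinates between two charts. -/
def chartChangeDomain (n : ℕ) {M : Type*} [TopologicalSpace M]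
    [ChartedSpace (EuclideanSpace ℝ (Fin n)) M] (x₀ x₁ : M) : Set (Coord n) :=
  (extChartAt (𝓡 n) x₀).target ∩ (extChartAt (𝓡 n) x₀).symm ⁻¹' (extChartAt (𝓡 n) x₁).source

lemma isOpen_chartChangeDomain (x₀ x₁ : M) : IsOpen (chartChangeDomain n x₀ x₁) :=
  (continuousOn_extChartAt_symm x₀).isOpen_inter_preimage (isOpen_chart_target x₀)
    (isOpen_extChartAt_source x₁)

lemma contDiffOn_chartChange (x₀ x₁ : M) :
    ContDiffOn ℝ ∞ (chartChange n x₀ x₁) (chartChangeDomain n x₀ x₁) := by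
  rw [← contMDiffOn_iff_contDiffOn]
  exact (contMDiffOn_extChartAt (I := 𝓡 n) (n := ∞)).comp
    ((contMDiffOn_extChartAt_symm (I := 𝓡 n) (n := ∞) x₀).mono inter_subset_left)
    (fun u hu ↦ by rw [← extChartAt_source (𝓡 n)]; exact hu.2)

lemma pushVec_chartChange {x₀ x₁ : M} {u : Coord n} (hu : u ∈ chartChangeDomain n x₀ x₁)
    (v : Coord n) :
    HEq (pushVec x₀ u v)
      (pushVec x₁ (chartChange n x₀ x₁ u) (fderiv ℝ (chartChange n x₀ x₁) u v)) := by
  have hV := (isOpen_chartChangeDomain x₀ x₁).mem_nhds hu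
  have hev : (extChartAt (𝓡 n) x₀).symm =ᶠ[𝓝 u]
      (extChartAt (𝓡 n) x₁).symm ∘ chartChange n x₀ x₁ := by
    filter_upwards [hV] with p hp
    exact ((extChartAt (𝓡 n) x₁).left_inv hp.2).symm
  have hu1 : chartChange n x₀ x₁ u ∈ (extChartAt (𝓡 n) x₁).target :=
    (extChartAt (𝓡 n) x₁).map_source hu.2
  have hs' : MDifferentiableAt 𝓘(ℝ, Coord n) (𝓡 n) (extChartAt (𝓡 n) x₁).symm
      (chartChange n x₀ x₁ u) :=
    (mdifferentiableOn_extChartAt_symm (I := 𝓡 n)).mdifferentiableAt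
      ((isOpen_chart_target x₁).mem_nhds hu1)
  have hd : DifferentiableAt ℝ (chartChange n x₀ x₁) u :=
    ((contDiffOn_chartChange x₀ x₁).contDiffAt hV).differentiableAt (by simp)
  have h1 : mfderiv 𝓘(ℝ, Coord n) (𝓡 n) ((extChartAt (𝓡 n) x₁).symm ∘ chartChange n x₀ x₁) u =
      (pushVec x₁ (chartChange n x₀ x₁ u)).comp
        (mfderiv 𝓘(ℝ, Coord n) 𝓘(ℝ, Coord n) (chartChange n x₀ x₁) u) :=
    mfderiv_comp u hs' hd.mdifferentiableAt
  have h2 : pushVec x₀ u = _ := hev.mfderiv_eq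
  rw [h2, h1]
  apply heq_of_eq
  rw [mfderiv_eq_fderiv]
  rfl

lemma metricForm_chartChange {x₀ x₁ : M} {u : Coord n} (hu : u ∈ chartChangeDomain n x₀ x₁)
    (a b : Coord n) :
    metricForm x₀ u a b = metricForm x₁ (chartChange n x₀ x₁ u)
      (fderiv ℝ (chartChange n x₀ x₁) u a) (fderiv ℝ (chartChange n x₀ x₁) u b) :=
  inner_eq_of_heq ((extChartAt (𝓡 n) x₁).left_inv hu.2).symm (pushVec_chartChange hu a)
    (pushVec_chartChange hu b)

lemma surjective_fderiv_chartChange {x₀ x₁ : M} {u : Coord n}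
    (hu : u ∈ chartChangeDomain n x₀ x₁) :
    Function.Surjective (fderiv ℝ (chartChange n x₀ x₁) u) := by
  have hinj : Function.Injective (fderiv ℝ (chartChange n x₀ x₁) u : Coord n →ₗ[ℝ] Coord n) := by
    rw [← LinearMap.ker_eq_bot, LinearMap.ker_eq_bot']
    intro v hv
    by_contra hne
    have h1 := metricForm_pos hu.1 hne
    have h2 : fderiv ℝ (chartChange n x₀ x₁) u v = 0 := hv
    rw [metricForm_chartChange hu, h2] at h1
    simp at h1
  exact LinearMap.injective_iff_surjective.1 hinj

/-- In the chart at `x₀`, the curve `γ` is a geodesic near the time `t`. -/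
def IsGeodInChart (n : ℕ) {M : Type*} [TopologicalSpace M]
    [ChartedSpace (EuclideanSpace ℝ (Fin n)) M]
    [RiemannianBundle (fun x : M ↦ TangentSpace (𝓡 n) x)] (x₀ : M) (γ : ℝ → M) (t : ℝ) : Prop :=
  (∀ᶠ s in 𝓝 t, γ s ∈ (extChartAt (𝓡 n) x₀).source) ∧
    IsSolAt (metricForm x₀) (coordCurve n x₀ γ) t

/-- The curve `γ` is a geodesic near the time `t`. -/
def IsGeodAt (n : ℕ) {M : Type*} [TopologicalSpace M]
    [ChartedSpace (EuclideanSpace ℝ (Fin n)) M]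
    [RiemannianBundle (fun x : M ↦ TangentSpace (𝓡 n) x)] (γ : ℝ → M) (t : ℝ) : Prop :=
  IsGeodInChart n (γ t) γ t

lemma coordCurve_mem_target {x₀ : M} {γ : ℝ → M} {t : ℝ}
    (h : γ t ∈ (extChartAt (𝓡 n) x₀).source) :
    coordCurve n x₀ γ t ∈ (extChartAt (𝓡 n) x₀).target :=
  (extChartAt (𝓡 n) x₀).map_source h

lemma eventuallyEq_symm_coordCurve {x₀ : M} {γ : ℝ → M} {l : Filter ℝ}
    (h : ∀ᶠ s in l, γ s ∈ (extChartAt (𝓡 n) x₀).source) :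
    γ =ᶠ[l] fun s ↦ (extChartAt (𝓡 n) x₀).symm (coordCurve n x₀ γ s) :=
  h.mono fun _ hs ↦ ((extChartAt (𝓡 n) x₀).left_inv hs).symm

namespace IsGeodInChart

variable {x₀ x₁ : M} {γ γ' : ℝ → M} {t : ℝ}

lemma mem_source (h : IsGeodInChart n x₀ γ t) : γ t ∈ (extChartAt (𝓡 n) x₀).source :=
  h.1.self_of_nhds

lemma contMDiffAt (h : IsGeodInChart n x₀ γ t) : ContMDiffAt 𝓘(ℝ, ℝ) (𝓡 n) ∞ γ t := by
  have h1 := (isMetricOn_metricForm x₀).contDiffAt_of_isSolAt h.2 (coordCurve_mem_target h.mem_source)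
  have h2 : ContMDiffAt 𝓘(ℝ, Coord n) (𝓡 n) ∞ (extChartAt (𝓡 n) x₀).symm (coordCurve n x₀ γ t) :=
    (contMDiffOn_extChartAt_symm x₀).contMDiffAt
      ((isOpen_chart_target x₀).mem_nhds (coordCurve_mem_target h.mem_source))
  exact (h2.comp t h1.contMDiffAt).congr_of_eventuallyEq (eventuallyEq_symm_coordCurve h.1)

lemma continuousAt (h : IsGeodInChart n x₀ γ t) : ContinuousAt γ t := h.contMDiffAt.continuousAt

lemma eventually (h : IsGeodInChart n x₀ γ t) : ∀ᶠ s in 𝓝 t, IsGeodInChart n x₀ γ s :=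
  h.1.eventually_nhds.and h.2.eventually

lemma congr (h : IsGeodInChart n x₀ γ t) (he : γ' =ᶠ[𝓝 t] γ) : IsGeodInChart n x₀ γ' t := by
  refine ⟨?_, h.2.congr ?_⟩
  · filter_upwards [he, h.1] with s hs hs'
    rwa [hs]
  · filter_upwards [he] with s hs
    rw [coordCurve, coordCurve, hs]

lemma comp_add (a : ℝ) (h : IsGeodInChart n x₀ γ (t + a)) :
    IsGeodInChart n x₀ (fun s ↦ γ (s + a)) t :=
  ⟨((continuous_add_const a).tendsto t).eventually h.1, h.2.comp_add a⟩

lemma comp_neg (h : IsGeodInChart n x₀ γ (-t)) : IsGeodInChart n x₀ (fun s ↦ γ (-s)) t :=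
  ⟨(continuous_neg.tendsto t).eventually h.1, h.2.comp_neg⟩

lemma of_symm {c : ℝ → Coord n} (hc : IsSolAt (metricForm x₀) c t)
    (hu : c t ∈ (extChartAt (𝓡 n) x₀).target) :
    IsGeodInChart n x₀ (fun s ↦ (extChartAt (𝓡 n) x₀).symm (c s)) t := by
  have h1 : ∀ᶠ s in 𝓝 t, c s ∈ (extChartAt (𝓡 n) x₀).target :=
    hc.differentiableAt.continuousAt.eventually_mem ((isOpen_chart_target x₀).mem_nhds hu)
  refine ⟨h1.mono fun s hs ↦ (extChartAt (𝓡 n) x₀).map_target hs, hc.congr ?_⟩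
  exact h1.mono fun s hs ↦ (extChartAt (𝓡 n) x₀).right_inv hs

/-- Being a geodesic does not depend on the chart. -/
lemma change (h : IsGeodInChart n x₀ γ t) (hx : γ t ∈ (extChartAt (𝓡 n) x₁).source) :
    IsGeodInChart n x₁ γ t := by
  have hev1 : ∀ᶠ s in 𝓝 t, γ s ∈ (extChartAt (𝓡 n) x₁).source :=
    h.continuousAt.eventually_mem ((isOpen_extChartAt_source x₁).mem_nhds hx)
  refine ⟨hev1, ?_⟩
  have hmem : coordCurve n x₀ γ t ∈ chartChangeDomain n x₀ x₁ :=
    ⟨coordCurve_mem_target h.mem_source, by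
      rw [mem_preimage, coordCurve, (extChartAt (𝓡 n) x₀).left_inv h.mem_source]; exact hx⟩
  have h1 := (isMetricOn_metricForm x₀).isSolAt_comp (isMetricOn_metricForm x₁)
    (isOpen_chartChangeDomain x₀ x₁) inter_subset_left (contDiffOn_chartChange x₀ x₁)
    (fun u hu ↦ (extChartAt (𝓡 n) x₁).map_source hu.2) (fun p hp ↦ metricForm_chartChange hp)
    (fun p hp ↦ surjective_fderiv_chartChange hp) h.2 hmem
  refine h1.congr ?_
  filter_upwards [h.1] with s hs
  rw [chartChange, coordCurve, coordCurve, (extChartAt (𝓡 n) x₀).left_inv hs]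

lemma isGeodAt (h : IsGeodInChart n x₀ γ t) : IsGeodAt n γ t :=
  h.change (mem_extChartAt_source _)

lemma speedWithin_sq (h : IsGeodInChart n x₀ γ t) : speedWithin n γ univ t ^ 2 =
    metricForm x₀ (coordCurve n x₀ γ t) (deriv (coordCurve n x₀ γ) t)
      (deriv (coordCurve n x₀ γ) t) := by
  have := StrongConvexSets.speedWithin_sq uniqueDiffWithinAt_univ
    h.2.differentiableAt.differentiableWithinAt h.continuousAt.continuousWithinAt h.mem_source
  rwa [derivWithin_univ] at this

end IsGeodInChart

namespace IsGeodAt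

variable {x₀ : M} {γ γ' : ℝ → M} {t : ℝ}

lemma inChart (h : IsGeodAt n γ t) (hx : γ t ∈ (extChartAt (𝓡 n) x₀).source) :
    IsGeodInChart n x₀ γ t :=
  IsGeodInChart.change h hx

lemma contMDiffAt (h : IsGeodAt n γ t) : ContMDiffAt 𝓘(ℝ, ℝ) (𝓡 n) ∞ γ t :=
  IsGeodInChart.contMDiffAt h

lemma continuousAt (h : IsGeodAt n γ t) : ContinuousAt γ t :=
  IsGeodInChart.continuousAt h

lemma congr (h : IsGeodAt n γ t) (he : γ' =ᶠ[𝓝 t] γ) : IsGeodAt n γ' t :=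
  (IsGeodInChart.congr h he).isGeodAt

lemma comp_add (a : ℝ) (h : IsGeodAt n γ (t + a)) : IsGeodAt n (fun s ↦ γ (s + a)) t :=
  IsGeodInChart.comp_add a h

lemma comp_neg (h : IsGeodAt n γ (-t)) : IsGeodAt n (fun s ↦ γ (-s)) t :=
  IsGeodInChart.comp_neg h

lemma eventuallyEq {γ₁ γ₂ : ℝ → M} (h₁ : IsGeodAt n γ₁ t) (h₂ : IsGeodAt n γ₂ t)
    (heq : γ₁ t = γ₂ t) (hx : γ₁ t ∈ (extChartAt (𝓡 n) x₀).source)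
    (hd : deriv (coordCurve n x₀ γ₁) t = deriv (coordCurve n x₀ γ₂) t) : γ₁ =ᶠ[𝓝 t] γ₂ := by
  have g₁ := h₁.inChart hx
  have g₂ := h₂.inChart (x₀ := x₀) (by rwa [← heq])
  have h := (isMetricOn_metricForm x₀).eventuallyEq_of_isSolAt g₁.2 g₂.2
    (coordCurve_mem_target hx) (by rw [coordCurve, coordCurve, heq]) hd
  filter_upwards [h, eventuallyEq_symm_coordCurve g₁.1, eventuallyEq_symm_coordCurve g₂.1]
    with s hs hs₁ hs₂
  rw [hs₁, hs₂, hs]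

/-- Unique continuation of geodesics. -/
lemma eqOn_Ioo {γ₁ γ₂ : ℝ → M} {a b t₀ : ℝ} (h₁ : ∀ t ∈ Ioo a b, IsGeodAt n γ₁ t)
    (h₂ : ∀ t ∈ Ioo a b, IsGeodAt n γ₂ t) (ht₀ : t₀ ∈ Ioo a b) (heq : γ₁ =ᶠ[𝓝 t₀] γ₂) :
    EqOn γ₁ γ₂ (Ioo a b) := by
  have hsub : Ioo a b ⊆ {t | γ₁ =ᶠ[𝓝 t] γ₂} := by
    refine isPreconnected_Ioo.subset_of_closure_inter_subset isOpen_setOfPred_eventually_nhds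
      ⟨t₀, ht₀, heq⟩ ?_
    rintro t ⟨htc, ht⟩
    have g₁ := h₁ t ht
    have g₂ := h₂ t ht
    have hfr : ∃ᶠ s in 𝓝 t, γ₁ =ᶠ[𝓝 s] γ₂ := mem_closure_iff_frequently.1 htc
    have hpt : γ₁ t = γ₂ t := by
      refine tendsto_nhds_unique_of_frequently_eq g₁.continuousAt g₂.continuousAt ?_
      exact hfr.mono fun s hs ↦ hs.self_of_nhds
    refine g₁.eventuallyEq g₂ hpt (mem_extChartAt_source _) ?_
    have c₁ := g₁.2.hasDerivAt_deriv.continuousAt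
    have c₂ := (g₂.inChart (x₀ := γ₁ t) (by rw [← hpt]; simp)).2.hasDerivAt_deriv.continuousAt
    refine tendsto_nhds_unique_of_frequently_eq c₁ c₂ (hfr.mono fun s hs ↦ ?_)
    refine EventuallyEq.deriv_eq (hs.mono fun r hr ↦ ?_)
    rw [coordCurve, coordCurve, hr]
  exact fun t ht ↦ (hsub ht).self_of_nhds

lemma hasDerivAt_speed_sq (h : IsGeodAt n γ t) :
    HasDerivAt (fun s ↦ speedWithin n γ univ s ^ 2) 0 t := by
  refine ((isMetricOn_metricForm (γ t)).hasDerivAt_energy h.2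
    (coordCurve_mem_target (IsGeodInChart.mem_source h))).congr_of_eventuallyEq ?_
  filter_upwards [IsGeodInChart.eventually h] with s hs using hs.speedWithin_sq

lemma speed_eq {a b s t : ℝ} (h : ∀ t ∈ Ioo a b, IsGeodAt n γ t) (hs : s ∈ Ioo a b)
    (ht : t ∈ Ioo a b) : speedWithin n γ univ s = speedWithin n γ univ t := by
  have h1 : speedWithin n γ univ s ^ 2 = speedWithin n γ univ t ^ 2 :=
    isOpen_Ioo.is_const_of_deriv_eq_zero isPreconnected_Ioo
      (fun r hr ↦ (h r hr).hasDerivAt_speed_sq.differentiableAt.differentiableWithinAt)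
      (fun r hr ↦ (h r hr).hasDerivAt_speed_sq.deriv) hs ht
  exact (sq_eq_sq₀ (speedWithin_nonneg _ _ _) (speedWithin_nonneg _ _ _)).1 h1

lemma dist_le [IsRiemannianManifold (𝓡 n) M] {a b s t r : ℝ} (h : ∀ t ∈ Ioo a b, IsGeodAt n γ t)
    (hs : s ∈ Ioo a b) (ht : t ∈ Ioo a b) (hr : r ∈ Ioo a b) :
    dist (γ s) (γ t) ≤ speedWithin n γ univ r * |s - t| := by
  wlog hst : s ≤ t generalizing s t
  · rw [dist_comm, abs_sub_comm]; exact this ht hs (le_of_not_ge hst)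
  have hsub : Icc s t ⊆ Ioo a b := Icc_subset_Ioo hs.1 ht.2
  have hγ : ContMDiffOn 𝓘(ℝ, ℝ) (𝓡 n) 1 γ (Icc s t) := fun x hx ↦
    ((h x (hsub hx)).contMDiffAt.of_le (by simp)).contMDiffWithinAt
  refine (dist_le_integral_speedWithin hγ le_rfl hst le_rfl).trans ?_
  rw [abs_sub_comm, abs_of_nonneg (sub_nonneg.2 hst), mul_comm]
  have : ∫ x in s..t, speedWithin n γ (Icc s t) x = ∫ x in s..t, speedWithin n γ univ r := by
    rw [intervalIntegral.integral_of_le hst, intervalIntegral.integral_of_le hst,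
      integral_Ioc_eq_integral_Ioo, integral_Ioc_eq_integral_Ioo]
    refine setIntegral_congr_fun measurableSet_Ioo fun x hx ↦ ?_
    rw [← speed_eq h (hsub (Ioo_subset_Icc_self hx)) hr, speedWithin, speedWithin,
      mfderivWithin_of_mem_nhds (Icc_mem_nhds hx.1 hx.2), mfderivWithin_univ]
  rw [this, intervalIntegral.integral_const, smul_eq_mul]

end IsGeodAt

/-- Local geodesics are geodesics in the sense of vanishing covariant acceleration. -/
lemma isGeodesicOn_of_isGeodAt {γ : ℝ → M} {a b : ℝ} (hab : a < b)
    (h : ∀ t ∈ Icc a b, IsGeodAt n γ t) : IsGeodesicOn n γ (Icc a b) := by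
  have hud := uniqueDiffOn_Icc hab
  refine ⟨fun t ht ↦ (h t ht).contMDiffAt.contMDiffWithinAt, fun x₀ t ht hx w ↦ ?_⟩
  have hg := (h t ht).inChart hx
  have hu := coordCurve_mem_target hx
  have e1 : ∀ s ∈ Icc a b, γ s ∈ (extChartAt (𝓡 n) x₀).source →
      derivWithin (coordCurve n x₀ γ) (Icc a b) s = deriv (coordCurve n x₀ γ) s := fun s hs hxs ↦
    ((h s hs).inChart hxs).2.differentiableAt.derivWithin (hud s hs)
  have e2 : derivWithin (derivWithin (coordCurve n x₀ γ) (Icc a b)) (Icc a b) t =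
      geodAcc (metricForm x₀) (coordCurve n x₀ γ t) (deriv (coordCurve n x₀ γ) t) := by
    refine HasDerivWithinAt.derivWithin ?_ (hud t ht)
    refine hg.2.hasDerivAt_deriv.hasDerivWithinAt.congr_of_eventuallyEq ?_ (e1 t ht hx)
    filter_upwards [nhdsWithin_le_nhds hg.1, self_mem_nhdsWithin] with s hs hs' using e1 s hs' hs
  change chartMetric x₀ (coordCurve n x₀ γ t)
      (derivWithin (derivWithin (coordCurve n x₀ γ) (Icc a b)) (Icc a b) t) w +
    christoffelFirst x₀ (coordCurve n x₀ γ t) (derivWithin (coordCurve n x₀ γ) (Icc a b) t)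
      (derivWithin (coordCurve n x₀ γ) (Icc a b) t) w = 0
  rw [e2, e1 t ht hx, christoffelFirst_eq hu, ← metricForm_apply,
    (isMetricOn_metricForm x₀).apply_geodAcc hu]
  ring

end LocalGeodesics

section CoordinateMetric

variable {E : Type*} [NormedAddCommGroup E] [NormedSpace ℝ E] [FiniteDimensional ℝ E]
  {g : E → E →L[ℝ] E →L[ℝ] ℝ} {U : Set E}

namespace IsMetricOn

lemma abs_sub_le (u u' v w : E) : |g u v w - g u' v w| ≤ ‖g u - g u'‖ * ‖v‖ * ‖w‖ := by
  rw [← Real.norm_eq_abs]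
  exact (g u - g u').le_opNorm₂ v w

/-- Locally, a metric is Lipschitz and comparable to the norm. -/
lemma exists_bounds (hg : IsMetricOn g U) {u₀ : E} (hu : u₀ ∈ U) :
    ∃ r > 0, ∃ lam > 0, ∃ K > 0, closedBall u₀ r ⊆ U ∧
      (∀ u ∈ closedBall u₀ r, ∀ w, lam * ‖w‖ ^ 2 ≤ g u w w ∧ g u w w ≤ K * ‖w‖ ^ 2) ∧
      ∀ u ∈ closedBall u₀ r, ∀ u' ∈ closedBall u₀ r, ‖g u - g u'‖ ≤ K * ‖u - u'‖ := by
  have hcd : ContDiffAt ℝ ∞ g u₀ := hg.contDiffOn.contDiffAt (hg.isOpen.mem_nhds hu)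
  obtain ⟨K₀, s, hs, hlip⟩ := (hcd.of_le (m := 1) (by simp)).exists_lipschitzOnWith
  obtain ⟨lam, hlam, hlow⟩ := (isCompact_sphere (0 : E) 1).exists_forall_le'
    (f := fun w ↦ g u₀ w w) (by fun_prop) (a := 0) fun w hw ↦ hg.pos u₀ hu w (by
      rintro rfl; simp at hw)
  have hlow' : ∀ w, lam * ‖w‖ ^ 2 ≤ g u₀ w w := by
    intro w
    rcases eq_or_ne w 0 with rfl | hw
    · simp
    have hw' : 0 < ‖w‖ := norm_pos_iff.2 hw
    have h1 := hlow (‖w‖⁻¹ • w) (by simp [norm_smul, hw'.ne'])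
    simp only [map_smul, smul_apply, smul_eq_mul] at h1
    calc lam * ‖w‖ ^ 2 ≤ (‖w‖⁻¹ * (‖w‖⁻¹ * g u₀ w w)) * ‖w‖ ^ 2 := by gcongr
      _ = g u₀ w w := by field_simp
  have hcont : ∀ᶠ u in 𝓝 u₀, ‖g u - g u₀‖ < lam / 2 := by
    have : Tendsto (fun u ↦ ‖g u - g u₀‖) (𝓝 u₀) (𝓝 ‖g u₀ - g u₀‖) :=
      (hcd.continuousAt.sub continuousAt_const).norm
    rw [sub_self, norm_zero] at this
    exact this.eventually_lt_const (by positivity)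
  obtain ⟨r, hr, hball⟩ := nhds_basis_closedBall.eventually_iff.1
    ((hcont.and hs).and (hg.isOpen.mem_nhds hu))
  refine ⟨r, hr, lam / 2, by positivity, K₀ + ‖g u₀‖ + lam, by positivity,
    fun u hu ↦ (hball hu).2, fun u hu w ↦ ?_, fun u hu u' hu' ↦ ?_⟩
  · have h1 := abs_le.1 (abs_sub_le (g := g) u u₀ w w)
    have h2 : ‖g u - g u₀‖ * ‖w‖ * ‖w‖ ≤ lam / 2 * ‖w‖ ^ 2 := by
      rw [mul_assoc, ← sq]
      exact mul_le_mul_of_nonneg_right (hball hu).1.1.le (by positivity)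
    have h3 := (abs_le.1 ((Real.norm_eq_abs _).symm.le.trans ((g u₀).le_opNorm₂ w w))).2
    constructor
    · linarith [hlow' w]
    · nlinarith [sq_nonneg ‖w‖, K₀.2]
  · have := hlip.norm_sub_le (hball hu).1.2 (hball hu').1.2
    refine this.trans (mul_le_mul_of_nonneg_right ?_ (norm_nonneg _))
    linarith [norm_nonneg (g u₀)]

/-- Existence of geodesics, uniformly in the initial data. -/
lemma exists_isSolAt (hg : IsMetricOn g U) {u₀ : E} (hu : u₀ ∈ U) (v₀ : E) :
    ∃ r > 0, ∃ ε > 0, ∀ p ∈ closedBall (u₀, v₀) r, ∃ c : ℝ → E, c 0 = p.1 ∧ deriv c 0 = p.2 ∧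
      ∀ t ∈ Ioo (-ε) ε, IsSolAt g c t ∧ c t ∈ U := by
  obtain ⟨ε, hε, a, r, L, K, hr, hpl⟩ := IsPicardLindelof.of_contDiffAt_one
    ((hg.contDiffAt_spray hu v₀).of_le (m := 1) (by simp))
  obtain ⟨α, hα, hαc⟩ := (hpl 0).exists_forall_mem_closedBall_eq_hasDerivWithinAt_continuousOn
  have hαz : ∀ x ∈ closedBall (u₀, v₀) r, α (x, 0) = x := fun x hx ↦ (hα x hx).1
  have hα0 := (hα (u₀, v₀) (mem_closedBall_self r.2)).1
  have hnhds : closedBall (u₀, v₀) r ×ˢ Icc (0 - ε) (0 + ε) ∈ 𝓝 ((u₀, v₀), (0 : ℝ)) :=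
    prod_mem_nhds (closedBall_mem_nhds _ hr) (Icc_mem_nhds (by linarith) (by linarith))
  have hcont : ContinuousAt α ((u₀, v₀), 0) := hαc.continuousAt hnhds
  have hev : ∀ᶠ q in 𝓝 ((u₀, v₀), (0 : ℝ)), (α q).1 ∈ U :=
    (continuous_fst.continuousAt.comp hcont).eventually_mem
      (hg.isOpen.mem_nhds (by simp only [Function.comp_apply]; rw [hα0]; exact hu))
  obtain ⟨ρ, hρ, hball⟩ := nhds_basis_closedBall.eventually_iff.1 (hev.and hnhds)
  refine ⟨ρ, hρ, ρ, hρ, fun p hp ↦ ⟨fun t ↦ (α (p, t)).1, ?_⟩⟩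
  have hmem : ∀ t ∈ Ioo (-ρ) ρ, (p, t) ∈ closedBall ((u₀, v₀), (0 : ℝ)) ρ := by
    intro t ht
    rw [← closedBall_prod_same]
    refine ⟨hp, ?_⟩
    rw [Real.closedBall_eq_Icc]
    exact ⟨by linarith [ht.1], by linarith [ht.2]⟩
  have hp' : p ∈ closedBall (u₀, v₀) r := (hball (hmem 0 ⟨by linarith, hρ⟩)).2.1
  have hderiv : ∀ t ∈ Ioo (-ρ) ρ,
      HasDerivAt (fun s ↦ α (p, s)) (spray g (α (p, t))) t := by
    intro t ht
    have hsub : Ioo (-ρ) ρ ⊆ Icc (0 - ε) (0 + ε) := fun s hs ↦ (hball (hmem s hs)).2.2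
    exact ((hα p hp').2 t (hsub ht)).hasDerivAt
      (mem_of_superset (Ioo_mem_nhds ht.1 ht.2) hsub)
  have hd1 : ∀ t ∈ Ioo (-ρ) ρ, HasDerivAt (fun s ↦ (α (p, s)).1) (α (p, t)).2 t :=
    fun t ht ↦ (ContinuousLinearMap.fst ℝ E E).hasFDerivAt.comp_hasDerivAt t (hderiv t ht)
  have hd2 : ∀ t ∈ Ioo (-ρ) ρ, HasDerivAt (fun s ↦ (α (p, s)).2)
      (geodAcc g (α (p, t)).1 (α (p, t)).2) t :=
    fun t ht ↦ (ContinuousLinearMap.snd ℝ E E).hasFDerivAt.comp_hasDerivAt t (hderiv t ht)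
  have h0 : (0 : ℝ) ∈ Ioo (-ρ) ρ := ⟨by linarith, hρ⟩
  refine ⟨by simp only [hαz p hp'], ?_, fun t ht ↦ ⟨?_, (hball (hmem t ht)).1⟩⟩
  · rw [(hd1 0 h0).deriv, hαz p hp']
  · exact IsSolAt.of_hasDerivAt (v := fun s ↦ (α (p, s)).2)
      (by filter_upwards [Ioo_mem_nhds ht.1 ht.2] with s hs using hd1 s hs)
      (by filter_upwards [Ioo_mem_nhds ht.1 ht.2] with s hs using hd2 s hs)

end IsMetricOn

end CoordinateMetric

section Completeness

variable {n : ℕ} {M : Type*} [MetricSpace M] [ChartedSpace (EuclideanSpace ℝ (Fin n)) M]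
  [IsManifold (𝓡 n) ∞ M] [RiemannianBundle (fun x : M ↦ TangentSpace (𝓡 n) x)]
  [IsContMDiffRiemannianBundle (𝓡 n) ∞ (EuclideanSpace ℝ (Fin n))
      (fun x : M ↦ TangentSpace (𝓡 n) x)]

lemma exists_isGeodAt_zero (p : M) (v : Coord n) :
    ∃ γ : ℝ → M, IsGeodAt n γ 0 ∧ γ 0 = p ∧ deriv (coordCurve n p γ) 0 = v := by
  have hu : extChartAt (𝓡 n) p p ∈ (extChartAt (𝓡 n) p).target := mem_extChartAt_target p
  obtain ⟨r, hr, ε, hε, h⟩ := (isMetricOn_metricForm p).exists_isSolAt hu v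
  obtain ⟨c, hc0, hc1, hc⟩ := h _ (mem_closedBall_self hr.le)
  have h0 : (0 : ℝ) ∈ Ioo (-ε) ε := ⟨by linarith, hε⟩
  refine ⟨fun s ↦ (extChartAt (𝓡 n) p).symm (c s),
    (IsGeodInChart.of_symm (hc 0 h0).1 (hc 0 h0).2).isGeodAt, ?_, ?_⟩
  · simp only [hc0]; exact (extChartAt (𝓡 n) p).left_inv (mem_extChartAt_source p)
  · refine Eq.trans ?_ hc1
    refine EventuallyEq.deriv_eq ?_
    filter_upwards [Ioo_mem_nhds h0.1 h0.2] with s hs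
    exact (extChartAt (𝓡 n) p).right_inv (hc s hs).2

variable [IsRiemannianManifold (𝓡 n) M] [CompleteSpace M]

lemma exists_tendsto_of_isGeodAt {γ : ℝ → M} {a b : ℝ} (hab : a < b)
    (h : ∀ t ∈ Ioo a b, IsGeodAt n γ t) : ∃ q, Tendsto γ (𝓝[<] b) (𝓝 q) := by
  have hm : (a + b) / 2 ∈ Ioo a b := ⟨by linarith, by linarith⟩
  set S := speedWithin n γ univ ((a + b) / 2) with hS
  have hS0 : 0 ≤ S := speedWithin_nonneg _ _ _
  rw [← cauchy_map_iff_exists_tendsto, Metric.cauchy_iff]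
  refine ⟨inferInstance, fun ε hε ↦ ?_⟩
  set δ := ε / (S + 1) with hδ
  have hδ0 : 0 < δ := by positivity
  refine ⟨γ '' Ioo (max a (b - δ)) b, image_mem_map (Ioo_mem_nhdsLT (by
    rw [max_lt_iff]; exact ⟨hab, by linarith⟩)), ?_⟩
  rintro _ ⟨s, hs, rfl⟩ _ ⟨t, ht, rfl⟩
  have hs' := max_lt_iff.1 hs.1
  have ht' := max_lt_iff.1 ht.1
  refine (IsGeodAt.dist_le h ⟨hs'.1, hs.2⟩ ⟨ht'.1, ht.2⟩ hm).trans_lt ?_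
  have h1 : |s - t| < δ := by rw [abs_lt]; constructor <;> linarith [hs.2, ht.2]
  calc S * |s - t| ≤ (S + 1) * |s - t| := by gcongr; linarith
    _ < (S + 1) * δ := by gcongr
    _ = ε := by rw [hδ]; field_simp

/-- A geodesic on a bounded interval extends beyond its right end. -/
lemma exists_extend_right {γ : ℝ → M} {a b : ℝ} (hab : a < b)
    (h : ∀ t ∈ Ioo a b, IsGeodAt n γ t) :
    ∃ ε > 0, ∃ σ : ℝ → M, (∀ t ∈ Ioo a (b + ε), IsGeodAt n σ t) ∧ EqOn σ γ (Ioo a b) := by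
  obtain ⟨q, hq⟩ := exists_tendsto_of_isGeodAt hab h
  have hm : (a + b) / 2 ∈ Ioo a b := ⟨by linarith, by linarith⟩
  set S := speedWithin n γ univ ((a + b) / 2) with hS
  set g := metricForm (n := n) q with hgdef
  have hg := isMetricOn_metricForm (n := n) q
  obtain ⟨r, hr, lam, hlam, K, hK, hrU, hbd, -⟩ :=
    hg.exists_bounds (mem_extChartAt_target (I := 𝓡 n) q)
  have hsrc : ∀ᶠ t in 𝓝[<] b, γ t ∈ (extChartAt (𝓡 n) q).source :=
    hq.eventually_mem ((isOpen_extChartAt_source q).mem_nhds (mem_extChartAt_source q))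
  have hcoord : ∀ᶠ t in 𝓝[<] b, coordCurve n q γ t ∈ closedBall (extChartAt (𝓡 n) q q) r :=
    ((continuousAt_extChartAt q).tendsto.comp hq).eventually_mem (closedBall_mem_nhds _ hr)
  have hIoo : ∀ᶠ t in 𝓝[<] b, t ∈ Ioo a b := Ioo_mem_nhdsLT hab
  have hcpt : ∀ᶠ t in 𝓝[<] b, (coordCurve n q γ t, deriv (coordCurve n q γ) t) ∈
      closedBall (extChartAt (𝓡 n) q q) r ×ˢ closedBall (0 : Coord n) (S / √lam) := by
    filter_upwards [hsrc, hcoord, hIoo] with t ht1 ht2 ht3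
    refine ⟨ht2, ?_⟩
    rw [mem_closedBall_zero_iff, le_div_iff₀ (by positivity)]
    have h1 := (hbd _ ht2 (deriv (coordCurve n q γ) t)).1
    have h2 := ((h t ht3).inChart ht1).speedWithin_sq
    rw [← h2, IsGeodAt.speed_eq h ht3 hm, ← hS] at h1
    refine le_of_sq_le_sq ?_ (speedWithin_nonneg _ _ _)
    rw [mul_pow, Real.sq_sqrt hlam.le]
    linarith
  obtain ⟨⟨u₁, v₁⟩, hmem, hclus⟩ :=
    ((isCompact_closedBall (extChartAt (𝓡 n) q q) r).prod
      (isCompact_closedBall (0 : Coord n) (S / √lam))).exists_mapClusterPt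
        (u := fun t ↦ (coordCurve n q γ t, deriv (coordCurve n q γ) t)) (f := 𝓝[<] b)
        (le_principal_iff.2 hcpt)
  obtain ⟨ρ, hρ, ε, hε, hsol⟩ := hg.exists_isSolAt (hrU hmem.1) v₁
  have hfr := (hclus.frequently (closedBall_mem_nhds _ hρ)).and_eventually
    ((hsrc.and hIoo).and (Ioo_mem_nhdsLT (show b - ε / 2 < b by linarith)))
  obtain ⟨t₀, ht₀b, ⟨ht₀s, ht₀⟩, ht₀ε⟩ := hfr.exists
  obtain ⟨c, hc0, hc1, hc⟩ := hsol _ ht₀b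
  set τ : ℝ → M := fun s ↦ (extChartAt (𝓡 n) q).symm (c (s - t₀)) with hτ
  have hτg : ∀ t ∈ Ioo (t₀ - ε) (t₀ + ε), IsGeodInChart n q τ t := by
    intro t ht
    have h1 := hc (t - t₀) ⟨by linarith [ht.1], by linarith [ht.2]⟩
    have h2 : IsSolAt g (fun s ↦ c (s - t₀)) t := by
      simpa only [sub_eq_add_neg] using IsSolAt.comp_add (t := t) (-t₀) h1.1
    exact IsGeodInChart.of_symm h2 h1.2
  have ht₀τ : t₀ ∈ Ioo (t₀ - ε) (t₀ + ε) := ⟨by linarith, by linarith⟩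
  have hτt₀ : γ t₀ = τ t₀ := by
    simp only [hτ, sub_self, hc0]
    exact ((extChartAt (𝓡 n) q).left_inv ht₀s).symm
  have hgerm : γ =ᶠ[𝓝 t₀] τ := by
    refine (h t₀ ht₀).eventuallyEq (hτg t₀ ht₀τ).isGeodAt hτt₀ ht₀s ?_
    have h1 : coordCurve n q τ =ᶠ[𝓝 t₀] fun s ↦ c (s - t₀) := by
      filter_upwards [Ioo_mem_nhds ht₀τ.1 ht₀τ.2] with s hs
      exact (extChartAt (𝓡 n) q).right_inv (hc (s - t₀) ⟨by linarith [hs.1], by linarith [hs.2]⟩).2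
    rw [h1.deriv_eq, deriv_comp_sub_const, sub_self, hc1]
  set a' := max a (t₀ - ε) with ha'
  have ha't₀ : a' < t₀ := max_lt ht₀.1 ht₀τ.1
  have heq : EqOn γ τ (Ioo a' b) := by
    refine IsGeodAt.eqOn_Ioo (n := n) (t₀ := t₀) (fun t ht ↦ h t ⟨(le_max_left _ _).trans_lt ht.1, ht.2⟩)
      (fun t ht ↦ (hτg t ⟨(le_max_right _ _).trans_lt ht.1, ?_⟩).isGeodAt) ⟨ha't₀, ht₀.2⟩ hgerm
    linarith [ht.2, ht₀ε.1]
  refine ⟨ε / 2, by positivity, fun t ↦ if t < b then γ t else τ t, fun t ht ↦ ?_, fun t ht ↦ ?_⟩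
  · rcases lt_or_ge t b with htb | htb
    · refine (h t ⟨ht.1, htb⟩).congr ?_
      filter_upwards [Iio_mem_nhds htb] with s hs
      exact if_pos hs
    · have ht' : t ∈ Ioo (t₀ - ε) (t₀ + ε) := ⟨by linarith [ht₀.2], by linarith [ht.2, ht₀ε.1]⟩
      refine (hτg t ht').isGeodAt.congr ?_
      filter_upwards [Ioi_mem_nhds (show a' < t by linarith [ht₀.2])] with s hs
      by_cases hsb : s < b
      · rw [if_pos hsb]; exact heq ⟨hs, hsb⟩
      · rw [if_neg hsb]
  · exact if_pos ht.2

lemma exists_extend_left {γ : ℝ → M} {a b : ℝ} (hab : a < b)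
    (h : ∀ t ∈ Ioo a b, IsGeodAt n γ t) :
    ∃ ε > 0, ∃ σ : ℝ → M, (∀ t ∈ Ioo (a - ε) b, IsGeodAt n σ t) ∧ EqOn σ γ (Ioo a b) := by
  obtain ⟨ε, hε, σ, hσ, heq⟩ := exists_extend_right (n := n) (γ := fun s ↦ γ (-s))
    (neg_lt_neg hab) (fun t ht ↦ (h (-t) ⟨by linarith [ht.2], by linarith [ht.1]⟩).comp_neg)
  refine ⟨ε, hε, fun s ↦ σ (-s), fun t ht ↦ ?_, fun t ht ↦ ?_⟩
  · exact (hσ (-t) ⟨by linarith [ht.2], by linarith [ht.1]⟩).comp_neg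
  · have := heq (show -t ∈ Ioo (-b) (-a) from ⟨by linarith [ht.2], by linarith [ht.1]⟩)
    simpa using this

/-- Geodesic completeness: a local geodesic extends to all times. -/
lemma exists_complete_geodesic {γ : ℝ → M} (h : IsGeodAt n γ 0) :
    ∃ σ : ℝ → M, (∀ t, IsGeodAt n σ t) ∧ σ =ᶠ[𝓝 0] γ := by
  set S : Set ℝ := {A | 0 < A ∧ ∃ σ : ℝ → M, (∀ t ∈ Ioo (-A) A, IsGeodAt n σ t) ∧ σ =ᶠ[𝓝 0] γ}
    with hS
  have hagree : ∀ A A' : ℝ, 0 < A → 0 < A' → ∀ σ σ' : ℝ → M, (∀ t ∈ Ioo (-A) A, IsGeodAt n σ t) →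
      (∀ t ∈ Ioo (-A') A', IsGeodAt n σ' t) → σ =ᶠ[𝓝 0] γ → σ' =ᶠ[𝓝 0] γ →
      ∀ t, |t| < A → |t| < A' → σ t = σ' t := by
    intro A A' hA hA' σ σ' hσ hσ' e e' t ht ht'
    have hB : 0 < min A A' := lt_min hA hA'
    refine IsGeodAt.eqOn_Ioo (n := n) (a := -min A A') (b := min A A') (t₀ := 0)
      (fun s hs ↦ hσ s ?_) (fun s hs ↦ hσ' s ?_) ⟨by linarith, hB⟩ (e.trans e'.symm)
      (abs_lt.1 (lt_min ht ht'))
    · exact ⟨by linarith [hs.1, min_le_left A A'], by linarith [hs.2, min_le_left A A']⟩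
    · exact ⟨by linarith [hs.1, min_le_right A A'], by linarith [hs.2, min_le_right A A']⟩
  have hchoose : ∀ t : ℝ, ∃ A : ℝ, ∃ σ : ℝ → M, (∃ B ∈ S, |t| < B) →
      |t| < A ∧ (∀ s ∈ Ioo (-A) A, IsGeodAt n σ s) ∧ σ =ᶠ[𝓝 0] γ := by
    intro t
    by_cases ht : ∃ B ∈ S, |t| < B
    · obtain ⟨B, ⟨hB0, σ, hσ, he⟩, hB⟩ := ht
      exact ⟨B, σ, fun _ ↦ ⟨hB, hσ, he⟩⟩
    · exact ⟨0, γ, fun h ↦ absurd h ht⟩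
  choose A τ hτ using hchoose
  set W : Set ℝ := {t | ∃ B ∈ S, |t| < B} with hW
  have hWopen : IsOpen W := by
    have : W = ⋃ B ∈ S, {t | |t| < B} := by ext; simp [hW]
    rw [this]
    exact isOpen_biUnion fun B _ ↦ isOpen_lt continuous_abs continuous_const
  set σ : ℝ → M := fun t ↦ τ t t with hσ
  have hnear : ∀ t ∈ W, σ =ᶠ[𝓝 t] τ t := by
    intro t ht
    obtain ⟨h1, h2, h3⟩ := hτ t ht
    filter_upwards [hWopen.mem_nhds ht, (continuous_abs.tendsto t).eventually_lt_const h1]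
      with s hs hs'
    obtain ⟨h1', h2', h3'⟩ := hτ s hs
    exact hagree (A s) (A t) ((abs_nonneg _).trans_lt h1') ((abs_nonneg _).trans_lt h1) _ _ h2' h2
      h3' h3 s h1' hs'
  have hσW : ∀ t ∈ W, IsGeodAt n σ t := fun t ht ↦
    ((hτ t ht).2.1 t (abs_lt.1 (hτ t ht).1)).congr (hnear t ht)
  obtain ⟨δ, hδ, hball⟩ := nhds_basis_ball.eventually_iff.1 (IsGeodInChart.eventually h)
  have hδS : δ ∈ S := ⟨hδ, γ, fun t ht ↦ (hball (by
    rw [Real.ball_eq_Ioo]; exact ⟨by linarith [ht.1], by linarith [ht.2]⟩)).isGeodAt,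
    EventuallyEq.rfl⟩
  have h0W : (0 : ℝ) ∈ W := ⟨δ, hδS, by simpa using hδ⟩
  have hσ0 : σ =ᶠ[𝓝 0] γ := (hnear 0 h0W).trans (hτ 0 h0W).2.2
  refine ⟨σ, fun t ↦ hσW t ?_, hσ0⟩
  by_contra htW
  have hbdd : BddAbove S := ⟨|t|, fun B hB ↦ by
    by_contra! hlt
    exact htW ⟨B, hB, hlt⟩⟩
  set T := sSup S with hT
  have hT0 : 0 < T := hδ.trans_le (le_csSup hbdd hδS)
  have hIoo : ∀ s ∈ Ioo (-T) T, IsGeodAt n σ s := by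
    intro s hs
    obtain ⟨B, hB, hlt⟩ := exists_lt_of_lt_csSup ⟨δ, hδS⟩ (abs_lt.2 hs)
    exact hσW s ⟨B, hB, hlt⟩
  obtain ⟨ε₁, hε₁, σ₁, hσ₁, heq₁⟩ := exists_extend_right (by linarith) hIoo
  obtain ⟨ε₂, hε₂, σ₂, hσ₂, heq₂⟩ := exists_extend_left (by linarith) hσ₁
  have hmem : T + min ε₁ ε₂ ∈ S := by
    refine ⟨by positivity, σ₂, fun s hs ↦ hσ₂ s ⟨?_, ?_⟩, ?_⟩
    · linarith [hs.1, min_le_right ε₁ ε₂]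
    · linarith [hs.2, min_le_left ε₁ ε₂]
    · refine EventuallyEq.trans ?_ hσ0
      filter_upwards [Ioo_mem_nhds (show -T < 0 by linarith) hT0] with s hs
      rw [heq₂ ⟨hs.1, by linarith [hs.2]⟩, heq₁ hs]
  have := le_csSup hbdd hmem
  have hpos : 0 < min ε₁ ε₂ := lt_min hε₁ hε₂
  linarith

end Completeness

section Uniqueness

variable {n : ℕ} {M : Type*} [MetricSpace M] [ChartedSpace (EuclideanSpace ℝ (Fin n)) M]
  [IsManifold (𝓡 n) ∞ M] [RiemannianBundle (fun x : M ↦ TangentSpace (𝓡 n) x)]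
  [IsContMDiffRiemannianBundle (𝓡 n) ∞ (EuclideanSpace ℝ (Fin n))
      (fun x : M ↦ TangentSpace (𝓡 n) x)]

namespace IsGeodesicOn

variable {γ γ₁ γ₂ : ℝ → M} {a b t : ℝ} {x₀ : M}

lemma continuousOn (h : IsGeodesicOn n γ (Icc a b)) : ContinuousOn γ (Icc a b) :=
  h.1.continuousOn

/-- The geodesic equation in a chart, as a first order system. -/
lemma hasDerivWithinAt_spray (hab : a < b) (h : IsGeodesicOn n γ (Icc a b)) (ht : t ∈ Icc a b)
    (hx : γ t ∈ (extChartAt (𝓡 n) x₀).source) :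
    HasDerivWithinAt (fun s ↦ (coordCurve n x₀ γ s, derivWithin (coordCurve n x₀ γ) (Icc a b) s))
      (spray (metricForm x₀) (coordCurve n x₀ γ t, derivWithin (coordCurve n x₀ γ) (Icc a b) t))
      (Icc a b) t := by
  have hud := uniqueDiffOn_Icc hab
  have hc : ContDiffWithinAt ℝ ∞ (coordCurve n x₀ γ) (Icc a b) t :=
    contDiffWithinAt_coordCurve (h.1 t ht) hx
  have h1 : HasDerivWithinAt (coordCurve n x₀ γ) (derivWithin (coordCurve n x₀ γ) (Icc a b) t)
      (Icc a b) t := (hc.differentiableWithinAt (by simp)).hasDerivWithinAt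
  have h2 : DifferentiableWithinAt ℝ (derivWithin (coordCurve n x₀ γ) (Icc a b)) (Icc a b) t := by
    have := (hc.fderivWithin_right (m := 1) hud
      (by rw [one_add_one_eq_two]; exact ENat.LEInfty.out) ht).differentiableWithinAt
      (by simp)
    exact this.clm_apply (differentiableWithinAt_const (1 : ℝ))
  have hu := coordCurve_mem_target hx
  have h3 : derivWithin (derivWithin (coordCurve n x₀ γ) (Icc a b)) (Icc a b) t =
      geodAcc (metricForm x₀) (coordCurve n x₀ γ t)
        (derivWithin (coordCurve n x₀ γ) (Icc a b) t) := by
    rw [(isMetricOn_metricForm x₀).geodAcc_iff hu]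
    intro w
    rw [← christoffelFirst_eq hu]
    exact h.2 x₀ t ht hx w
  have h4 := h2.hasDerivWithinAt
  rw [h3] at h4
  exact h1.prodMk h4

lemma exists_eqOn_right (hab : a < b) (h₁ : IsGeodesicOn n γ₁ (Icc a b))
    (h₂ : IsGeodesicOn n γ₂ (Icc a b)) (ht : t ∈ Ico a b) (heq : γ₁ t = γ₂ t)
    (hd : derivWithin (coordCurve n (γ₁ t) γ₁) (Icc a b) t =
      derivWithin (coordCurve n (γ₁ t) γ₂) (Icc a b) t) :
    ∃ δ > 0, EqOn γ₁ γ₂ (Icc t (t + δ)) := by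
  set x₀ := γ₁ t with hx₀
  have hg := isMetricOn_metricForm (n := n) x₀
  have ht' : t ∈ Icc a b := ⟨ht.1, ht.2.le⟩
  obtain ⟨K, s, hs, hlip⟩ := ((hg.contDiffAt_spray (mem_extChartAt_target x₀)
    (derivWithin (coordCurve n x₀ γ₁) (Icc a b) t)).of_le (m := 1) (by simp)).exists_lipschitzOnWith
  have key : ∀ γ : ℝ → M, IsGeodesicOn n γ (Icc a b) → γ t = x₀ →
      derivWithin (coordCurve n x₀ γ₁) (Icc a b) t = derivWithin (coordCurve n x₀ γ) (Icc a b) t →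
      ∀ᶠ r in 𝓝[≥] t, γ r ∈ (extChartAt (𝓡 n) x₀).source ∧
        (coordCurve n x₀ γ r, derivWithin (coordCurve n x₀ γ) (Icc a b) r) ∈ s := by
    intro γ h he hd
    have hle : 𝓝[≥] t ≤ 𝓝[Icc a b] t :=
      nhdsWithin_le_of_mem (Icc_mem_nhdsGE_of_mem ht)
    have hx : γ t ∈ (extChartAt (𝓡 n) x₀).source := by rw [he]; simp
    refine Filter.Eventually.and (hle ?_) (hle ?_)
    · exact (h.continuousOn t ht').eventually_mem ((isOpen_extChartAt_source x₀).mem_nhds hx)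
    · refine (h.hasDerivWithinAt_spray hab ht' hx).continuousWithinAt.eventually_mem ?_
      change s ∈ 𝓝 (extChartAt (𝓡 n) x₀ (γ t), derivWithin (coordCurve n x₀ γ) (Icc a b) t)
      rw [← hd, he]
      exact hs
  obtain ⟨e, he, hsub⟩ := mem_nhdsGE_iff_exists_Icc_subset.1
    ((key γ₁ h₁ rfl rfl).and ((key γ₂ h₂ heq.symm hd).and (Icc_mem_nhdsGE_of_mem ht)))
  refine ⟨e - t, sub_pos.2 he, ?_⟩
  rw [add_sub_cancel]
  have hab' : ∀ r ∈ Ico t e, Icc a b ∈ 𝓝[≥] r := fun r hr ↦ by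
    have h1 := (hsub (⟨hr.1, hr.2.le⟩ : r ∈ Icc t e)).2.2
    have h2 := (hsub (⟨he.le, le_rfl⟩ : e ∈ Icc t e)).2.2
    exact Icc_mem_nhdsGE_of_mem ⟨h1.1, hr.2.trans_le h2.2⟩
  have hode : ∀ γ : ℝ → M, IsGeodesicOn n γ (Icc a b) →
      (∀ r ∈ Icc t e, γ r ∈ (extChartAt (𝓡 n) x₀).source ∧ r ∈ Icc a b) →
      ContinuousOn (fun s ↦ (coordCurve n x₀ γ s, derivWithin (coordCurve n x₀ γ) (Icc a b) s))
        (Icc t e) ∧ ∀ r ∈ Ico t e,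
      HasDerivWithinAt (fun s ↦ (coordCurve n x₀ γ s, derivWithin (coordCurve n x₀ γ) (Icc a b) s))
        (spray (metricForm x₀) (coordCurve n x₀ γ r, derivWithin (coordCurve n x₀ γ) (Icc a b) r))
        (Ici r) r := by
    intro γ h hr
    constructor
    · intro r hr'
      exact (h.hasDerivWithinAt_spray hab (hr r hr').2 (hr r hr').1).continuousWithinAt.mono
        fun y hy ↦ (hr y hy).2
    · intro r hr'
      have hr'' := hr r ⟨hr'.1, hr'.2.le⟩
      exact (h.hasDerivWithinAt_spray hab hr''.2 hr''.1).mono_of_mem_nhdsWithin (hab' r hr')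
  have o₁ := hode γ₁ h₁ fun r hr ↦ ⟨(hsub hr).1.1, (hsub hr).2.2⟩
  have o₂ := hode γ₂ h₂ fun r hr ↦ ⟨(hsub hr).2.1.1, (hsub hr).2.2⟩
  have := ODE_solution_unique_of_mem_Icc_right (v := fun _ ↦ spray (metricForm x₀)) (s := fun _ ↦ s)
    (K := K) (fun _ _ ↦ hlip) o₁.1 o₁.2 (fun r hr ↦ (hsub ⟨hr.1, hr.2.le⟩).1.2) o₂.1 o₂.2
    (fun r hr ↦ (hsub ⟨hr.1, hr.2.le⟩).2.1.2) (by simp only [coordCurve, ← heq, hd]; rfl)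
  intro r hr
  have h1 := congrArg Prod.fst (this hr)
  exact (extChartAt (𝓡 n) x₀).injOn (hsub hr).1.1 (hsub hr).2.1.1 h1

lemma derivWithin_eq_of_curveLift_eq (hab : a < b) (h₁ : IsGeodesicOn n γ₁ (Icc a b))
    (h₂ : IsGeodesicOn n γ₂ (Icc a b)) (ht : t ∈ Icc a b)
    (h : curveLift n γ₁ (Icc a b) t = curveLift n γ₂ (Icc a b) t)
    (hx : γ₁ t ∈ (extChartAt (𝓡 n) x₀).source) :
    derivWithin (coordCurve n x₀ γ₁) (Icc a b) t =
      derivWithin (coordCurve n x₀ γ₂) (Icc a b) t := by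
  have heq : γ₁ t = γ₂ t := congrArg Bundle.TotalSpace.proj h
  have hx₂ : γ₂ t ∈ (extChartAt (𝓡 n) x₀).source := by rwa [← heq]
  have hud := uniqueDiffOn_Icc hab t ht
  have key : ∀ γ : ℝ → M, IsGeodesicOn n γ (Icc a b) → γ t ∈ (extChartAt (𝓡 n) x₀).source →
      DifferentiableWithinAt ℝ (coordCurve n x₀ γ) (Icc a b) t := fun γ h hx ↦
    (contDiffWithinAt_coordCurve (h.1 t ht) hx).differentiableWithinAt (by simp)
  rw [curveLift_eq hud (key γ₁ h₁ hx) (h₁.continuousOn t ht) hx,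
    curveLift_eq hud (key γ₂ h₂ hx₂) (h₂.continuousOn t ht) hx₂,
    show coordCurve n x₀ γ₂ t = coordCurve n x₀ γ₁ t by rw [coordCurve, coordCurve, heq]] at h
  exact (isInvertible_pushVec (coordCurve_mem_target hx)).injective
    (Bundle.TotalSpace.mk_injective _ h)

/-- A geodesic is determined by its initial position and velocity. -/
lemma eqOn_of_curveLift_eq (hab : a < b) (h₁ : IsGeodesicOn n γ₁ (Icc a b))
    (h₂ : IsGeodesicOn n γ₂ (Icc a b))
    (h : curveLift n γ₁ (Icc a b) a = curveLift n γ₂ (Icc a b) a) : EqOn γ₁ γ₂ (Icc a b) := by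
  have heqa : γ₁ a = γ₂ a := congrArg Bundle.TotalSpace.proj h
  set S : Set ℝ := {t | ∀ r ∈ Icc a b, r < t → γ₁ r = γ₂ r} with hS
  have hclosed : ∀ t ∈ S, t ∈ Icc a b → EqOn γ₁ γ₂ (Icc a t) := by
    intro t ht htab
    rcases htab.1.eq_or_lt with rfl | hat
    · intro r hr
      rw [Icc_self, mem_singleton_iff] at hr
      rw [hr, heqa]
    · have h1 : EqOn γ₁ γ₂ (Ico a t) := fun r hr ↦ ht r ⟨hr.1, hr.2.le.trans htab.2⟩ hr.2
      refine h1.of_subset_closure (h₁.continuousOn.mono (Icc_subset_Icc_right htab.2))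
        (h₂.continuousOn.mono (Icc_subset_Icc_right htab.2)) Ico_subset_Icc_self ?_
      rw [closure_Ico hat.ne]
  have hsub : Icc a b ⊆ S := by
    refine IsClosed.Icc_subset_of_forall_exists_gt (IsClosed.inter ?_ isClosed_Icc) ?_ ?_
    · have : S = ⋂ r ∈ {r | r ∈ Icc a b ∧ γ₁ r ≠ γ₂ r}, Iic r := by
        ext t
        simp only [hS, mem_ofPred_eq, mem_iInter, mem_Iic]
        refine ⟨fun ht r hr ↦ ?_, fun ht r hr hrt ↦ ?_⟩
        · by_contra! hlt
          exact hr.2 (ht r hr.1 hlt)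
        · by_contra hne
          exact absurd (ht r ⟨hr, hne⟩) (not_le.2 hrt)
      rw [this]
      exact isClosed_biInter fun _ _ ↦ isClosed_Iic
    · exact fun r hr hra ↦ absurd hr.1 (not_le.2 hra)
    · rintro t ⟨htS, ht⟩ y hy
      have heq := hclosed t htS ⟨ht.1, ht.2.le⟩
      have htt : γ₁ t = γ₂ t := heq ⟨ht.1, le_rfl⟩
      have hd : derivWithin (coordCurve n (γ₁ t) γ₁) (Icc a b) t =
          derivWithin (coordCurve n (γ₁ t) γ₂) (Icc a b) t := by
        rcases ht.1.eq_or_lt with rfl | hat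
        · exact derivWithin_eq_of_curveLift_eq hab h₁ h₂ ⟨le_rfl, hab.le⟩ h (by simp)
        · have hud : UniqueDiffWithinAt ℝ (Icc a t) t := uniqueDiffOn_Icc hat t ⟨hat.le, le_rfl⟩
          have hsub : Icc a t ⊆ Icc a b := Icc_subset_Icc_right ht.2.le
          have key : ∀ γ : ℝ → M, IsGeodesicOn n γ (Icc a b) → γ t = γ₁ t →
              derivWithin (coordCurve n (γ₁ t) γ) (Icc a t) t =
                derivWithin (coordCurve n (γ₁ t) γ) (Icc a b) t := fun γ hγ he ↦
            derivWithin_subset hsub hud ((contDiffWithinAt_coordCurve (hγ.1 t ⟨ht.1, ht.2.le⟩)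
              (by rw [he]; simp)).differentiableWithinAt (by simp))
          rw [← key γ₁ h₁ rfl, ← key γ₂ h₂ htt.symm]
          refine derivWithin_congr (fun r hr ↦ ?_) ?_
          · rw [coordCurve, coordCurve, heq hr]
          · rw [coordCurve, coordCurve, htt]
      obtain ⟨δ, hδ, heq'⟩ := exists_eqOn_right hab h₁ h₂ ht htt hd
      refine ⟨min y (t + δ), fun r hr hlt ↦ ?_, lt_min hy (by linarith), min_le_left _ _⟩
      rcases le_total r t with h' | h'
      · exact heq ⟨hr.1, h'⟩
      · exact heq' ⟨h', (hlt.trans_le (min_le_right _ _)).le⟩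
  exact hclosed b (hsub ⟨hab.le, le_rfl⟩) ⟨hab.le, le_rfl⟩

end IsGeodesicOn

lemma IsExp.unique {x y y' : M} {v : TangentSpace (𝓡 n) x} (h : IsExp x v y) (h' : IsExp x v y') :
    y = y' := by
  obtain ⟨σ, hσ, h0, rfl⟩ := h
  obtain ⟨σ', hσ', h0', rfl⟩ := h'
  exact hσ.eqOn_of_curveLift_eq zero_lt_one hσ' (h0.trans h0'.symm) ⟨zero_le_one, le_rfl⟩

lemma curveLift_Icc_eq {γ : ℝ → M} (h : IsGeodAt n γ 0) :
    curveLift n γ (Icc 0 1) 0 = (⟨γ 0, mfderiv 𝓘(ℝ, ℝ) (𝓡 n) γ 0 (1 : ℝ)⟩ : TangentBundle (𝓡 n) M) := by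
  have hud : UniqueMDiffWithinAt 𝓘(ℝ, ℝ) (Icc (0 : ℝ) 1) 0 :=
    (uniqueDiffOn_Icc zero_lt_one 0 (by simp)).uniqueMDiffWithinAt
  rw [curveLift, mfderivWithin_eq_mfderiv hud (h.contMDiffAt.mdifferentiableAt (by simp))]

/-- The exponential map exists for all tangent vectors, and does not increase distances. -/
lemma exists_isExp [IsRiemannianManifold (𝓡 n) M] [CompleteSpace M] (x : M)
    (v : TangentSpace (𝓡 n) x) : ∃ y, IsExp x v y ∧ dist x y ≤ ‖v‖ := by
  have hinv := isInvertible_pushVec (mem_extChartAt_target (I := 𝓡 n) x)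
  have hx : (extChartAt (𝓡 n) x).symm (extChartAt (𝓡 n) x x) = x :=
    (extChartAt (𝓡 n) x).left_inv (mem_extChartAt_source x)
  obtain ⟨w, hw⟩ : ∃ w, (⟨(extChartAt (𝓡 n) x).symm (extChartAt (𝓡 n) x x),
      pushVec x (extChartAt (𝓡 n) x x) w⟩ : TangentBundle (𝓡 n) M) = ⟨x, v⟩ := by
    have : ∀ y : M, ∀ hy : y = x, ∃ v' : TangentSpace (𝓡 n) y,
        (⟨y, v'⟩ : TangentBundle (𝓡 n) M) = ⟨x, v⟩ := by
      rintro y rfl; exact ⟨v, rfl⟩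
    obtain ⟨v', hv'⟩ := this _ hx
    obtain ⟨w, hw⟩ := hinv.surjective v'
    exact ⟨w, by rw [hw]; exact hv'⟩
  obtain ⟨γ, hγ, hγ0, hγ1⟩ := exists_isGeodAt_zero x w
  obtain ⟨σ, hσ, he⟩ := exists_complete_geodesic hγ
  have hσ0 : σ 0 = x := he.self_of_nhds.trans hγ0
  have hσs : σ 0 ∈ (extChartAt (𝓡 n) x).source := by rw [hσ0]; simp
  have hlift : curveLift n σ univ 0 = (⟨x, v⟩ : TangentBundle (𝓡 n) M) := by
    have hG := (hσ 0).inChart hσs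
    have hc : coordCurve n x σ =ᶠ[𝓝 0] coordCurve n x γ := he.mono fun r hr ↦ by
      rw [coordCurve, coordCurve, hr]
    rw [curveLift_eq uniqueDiffWithinAt_univ hG.2.differentiableAt.differentiableWithinAt
      hG.continuousAt.continuousWithinAt hσs, derivWithin_univ, hc.deriv_eq, hγ1, ← hw,
      coordCurve, hσ0]
  have hspeed : speedWithin n σ univ 0 = ‖v‖ :=
    congrArg (fun z : TangentBundle (𝓡 n) M ↦ ‖(z.2 : TangentSpace (𝓡 n) z.1)‖) hlift
  refine ⟨σ 1, ⟨σ, isGeodesicOn_of_isGeodAt zero_lt_one fun t _ ↦ hσ t, ?_, rfl⟩, ?_⟩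
  · rw [curveLift_Icc_eq (hσ 0), ← hlift, curveLift, mfderivWithin_univ]
  · have := IsGeodAt.dist_le (n := n) (γ := σ) (a := -1) (b := 2) (s := 0) (t := 1) (r := 0)
      (fun t _ ↦ hσ t) (by norm_num) (by norm_num) (by norm_num)
    rw [hspeed, hσ0] at this
    simpa using this

end Uniqueness

lemma sq_integral_le {f : ℝ → ℝ} {a b : ℝ} (hab : a < b) (hf : ContinuousOn f (Icc a b)) :
    (∫ t in a..b, f t) ^ 2 ≤ (b - a) * ∫ t in a..b, f t ^ 2 := by
  set m := (∫ t in a..b, f t) / (b - a) with hm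
  have hab' : 0 < b - a := sub_pos.2 hab
  have hu : uIcc a b = Icc a b := uIcc_of_le hab.le
  have hi : IntervalIntegrable f volume a b := (hu ▸ hf).intervalIntegrable
  have hi2 : IntervalIntegrable (fun t ↦ f t ^ 2) volume a b :=
    (hu ▸ (hf.pow 2 : ContinuousOn (fun t ↦ f t ^ 2) (Icc a b))).intervalIntegrable
  have h0 : 0 ≤ ∫ t in a..b, (f t - m) ^ 2 :=
    intervalIntegral.integral_nonneg hab.le fun t _ ↦ sq_nonneg _
  have h1 : ∫ t in a..b, (f t - m) ^ 2 =
      (∫ t in a..b, f t ^ 2) - 2 * m * (∫ t in a..b, f t) + (b - a) * m ^ 2 := by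
    have : ∀ t, (f t - m) ^ 2 = f t ^ 2 - 2 * m * f t + m ^ 2 := fun t ↦ by ring
    simp only [this]
    rw [intervalIntegral.integral_add (hi2.sub (hi.const_mul _)) intervalIntegrable_const,
      intervalIntegral.integral_sub hi2 (hi.const_mul _), intervalIntegral.integral_const_mul,
      intervalIntegral.integral_const, smul_eq_mul]
  have h2 : (∫ t in a..b, f t) = m * (b - a) := by rw [hm]; field_simp
  rw [h1, h2] at h0
  rw [h2]
  nlinarith

section CoordinateMetric

variable {E : Type*} [NormedAddCommGroup E] [NormedSpace ℝ E] [FiniteDimensional ℝ E]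
  {g : E → E →L[ℝ] E →L[ℝ] ℝ} {U : Set E} {u : E}

namespace IsMetricOn

lemma self_nonneg (hg : IsMetricOn g U) (hu : u ∈ U) (v : E) : 0 ≤ g u v v := by
  rcases eq_or_ne v 0 with rfl | hv
  · simp
  · exact (hg.pos u hu v hv).le

lemma cauchy_schwarz (hg : IsMetricOn g U) (hu : u ∈ U) (a b : E) :
    g u a b ≤ √(g u a a) * √(g u b b) := by
  rw [← Real.sqrt_mul (hg.self_nonneg hu a)]
  refine Real.le_sqrt_of_sq_le ?_
  rcases eq_or_ne b 0 with rfl | hb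
  · simp
  have hr := hg.pos u hu b hb
  have h := hg.self_nonneg hu (g u b b • a - g u a b • b)
  simp only [map_sub, map_smul, sub_apply, smul_apply, smul_eq_mul, hg.symm u b a] at h
  have h' : 0 ≤ g u b b * (g u a a * g u b b - g u a b ^ 2) := by nlinarith
  nlinarith [nonneg_of_mul_nonneg_right h' hr]

end IsMetricOn

/-- The displacement of a curve measured with a fixed scalar product is controlled by any
function bounding its speed. -/
lemma displacement_le {g : E → E →L[ℝ] E →L[ℝ] ℝ} (hg : IsMetricOn g U) (hu : u ∈ U) {c : ℝ → E}
    {s : ℝ → ℝ} {t A : ℝ} (ht : 0 ≤ t) (hA : 0 ≤ A) (hc : ContDiffOn ℝ 1 c (Icc 0 1)) (ht1 : t ≤ 1)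
    (hs : ContinuousOn s (Icc 0 1)) (hs0 : ∀ r ∈ Icc (0 : ℝ) 1, 0 ≤ s r)
    (h : ∀ r ∈ Icc (0 : ℝ) 1, g u (derivWithin c (Icc 0 1) r) (derivWithin c (Icc 0 1) r) ≤
      A * s r ^ 2) :
    g u (c t - c 0) (c t - c 0) ≤ A * (∫ r in 0..t, s r) ^ 2 := by
  set w := c t - c 0 with hw
  have hsub : Icc 0 t ⊆ Icc (0 : ℝ) 1 := Icc_subset_Icc_right ht1
  have hd : ContinuousOn (derivWithin c (Icc 0 1)) (Icc 0 1) :=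
    hc.continuousOn_derivWithin (uniqueDiffOn_Icc zero_lt_one) le_rfl
  have hui : uIcc 0 t = Icc 0 t := uIcc_of_le ht
  have hds : ∀ r ∈ Ioo 0 t, HasDerivAt c (derivWithin c (Icc 0 1) r) r := fun r hr ↦
    ((hc.differentiableOn (by simp)) r (hsub (Ioo_subset_Icc_self hr))).hasDerivWithinAt.hasDerivAt
      (Icc_mem_nhds hr.1 (hr.2.trans_le ht1))
  have hint : IntervalIntegrable (fun r ↦ g u (derivWithin c (Icc 0 1) r) w) volume 0 t := by
    refine ContinuousOn.intervalIntegrable ?_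
    rw [hui]
    exact ((g u).continuous.comp_continuousOn (hd.mono hsub)).clm_apply continuousOn_const
  have hftc : ∫ r in 0..t, g u (derivWithin c (Icc 0 1) r) w = g u w w := by
    rw [intervalIntegral.integral_eq_sub_of_hasDeriv_right_of_le (f := fun r ↦ g u (c r) w) ht]
    · rw [← sub_apply, ← map_sub]
    · exact ((g u).continuous.comp_continuousOn (hc.continuousOn.mono hsub)).clm_apply
        continuousOn_const
    · intro r hr
      have := ((g u).hasFDerivAt.comp_hasDerivAt r (hds r hr)).clm_apply (hasDerivAt_const r w)
      simp only [map_zero, add_zero] at this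
      exact this.hasDerivWithinAt
    · exact hint
  have hle : g u w w ≤ ∫ r in 0..t, √A * √(g u w w) * s r := by
    rw [← hftc]
    refine intervalIntegral.integral_mono_on ht hint ?_ fun r hr ↦ ?_
    · refine ContinuousOn.intervalIntegrable ?_
      rw [hui]
      exact continuousOn_const.mul (hs.mono hsub)
    · refine (hg.cauchy_schwarz hu _ _).trans ?_
      rw [hftc]
      have : √(g u (derivWithin c (Icc 0 1) r) (derivWithin c (Icc 0 1) r)) ≤ √A * s r := by
        refine (Real.sqrt_le_sqrt (h r (hsub hr))).trans ?_
        rw [Real.sqrt_mul hA, Real.sqrt_sq (hs0 r (hsub hr))]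
      nlinarith [Real.sqrt_nonneg (g u w w)]
  rw [intervalIntegral.integral_const_mul] at hle
  set I := ∫ r in 0..t, s r
  have hgw := hg.self_nonneg hu w
  have hsq := Real.sq_sqrt hgw
  have hsqA := Real.sq_sqrt hA
  rcases hgw.eq_or_lt with h0 | h0
  · rw [← h0]; positivity
  · have hpos : 0 < √(g u w w) := Real.sqrt_pos.2 h0
    have h1 : √(g u w w) ≤ √A * I := by
      by_contra! hlt
      nlinarith
    calc g u w w = √(g u w w) ^ 2 := hsq.symm
      _ ≤ (√A * I) ^ 2 := by gcongr
      _ = A * I ^ 2 := by rw [mul_pow, hsqA]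

end CoordinateMetric

section Comparison

variable {n : ℕ} {M : Type*} [MetricSpace M] [ChartedSpace (EuclideanSpace ℝ (Fin n)) M]
  [IsManifold (𝓡 n) ∞ M] [RiemannianBundle (fun x : M ↦ TangentSpace (𝓡 n) x)]
  [IsContMDiffRiemannianBundle (𝓡 n) ∞ (EuclideanSpace ℝ (Fin n))
      (fun x : M ↦ TangentSpace (𝓡 n) x)]
  [IsRiemannianManifold (𝓡 n) M]

/-- The squared distance is bounded by the energy of a curve in a chart. -/
lemma dist_sq_le_energy {x₀ : M} {c : ℝ → Coord n} {a b : ℝ} (hab : a < b)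
    (hc : ContDiffOn ℝ 1 c (Icc a b)) (hU : MapsTo c (Icc a b) (extChartAt (𝓡 n) x₀).target) :
    dist ((extChartAt (𝓡 n) x₀).symm (c a)) ((extChartAt (𝓡 n) x₀).symm (c b)) ^ 2 ≤
      (b - a) * ∫ t in a..b, metricForm x₀ (c t) (derivWithin c (Icc a b) t)
        (derivWithin c (Icc a b) t) := by
  set γ : ℝ → M := fun t ↦ (extChartAt (𝓡 n) x₀).symm (c t) with hγ
  have hsm : ContMDiffOn 𝓘(ℝ, ℝ) (𝓡 n) 1 γ (Icc a b) :=
    ((contMDiffOn_extChartAt_symm (n := ∞) x₀).of_le (by simp)).comp hc.contMDiffOn hU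
  have hud := uniqueDiffOn_Icc hab
  have hcoord : EqOn (coordCurve n x₀ γ) c (Icc a b) := fun t ht ↦
    (extChartAt (𝓡 n) x₀).right_inv (hU ht)
  have hsp : ∀ t ∈ Icc a b, speedWithin n γ (Icc a b) t ^ 2 = metricForm x₀ (c t)
      (derivWithin c (Icc a b) t) (derivWithin c (Icc a b) t) := by
    intro t ht
    rw [speedWithin_sq (hud t ht) (((hc t ht).differentiableWithinAt (by simp)).congr hcoord
      (hcoord ht)) (hsm.continuousOn t ht) ((extChartAt (𝓡 n) x₀).map_target (hU ht)),
      hcoord ht, derivWithin_congr hcoord (hcoord ht)]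
  have hcs := continuousOn_speedWithin hud hsm
  calc dist (γ a) (γ b) ^ 2 ≤ (∫ t in a..b, speedWithin n γ (Icc a b) t) ^ 2 :=
        pow_le_pow_left₀ dist_nonneg (dist_le_integral_speedWithin hsm le_rfl hab.le le_rfl) 2
    _ ≤ (b - a) * ∫ t in a..b, speedWithin n γ (Icc a b) t ^ 2 := sq_integral_le hab hcs
    _ = _ := by
      congr 1
      refine intervalIntegral.integral_congr fun t ht ↦ ?_
      rw [uIcc_of_le hab.le] at ht
      exact hsp t ht

/-- Near a point, the Riemannian distance agrees to second order with the metric in a chart. -/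
lemma exists_comparison (q : M) : ∃ r > 0, ∃ K > 0,
    closedBall (extChartAt (𝓡 n) q q) r ⊆ (extChartAt (𝓡 n) q).target ∧
    ∀ x ∈ closedBall (extChartAt (𝓡 n) q q) r, ∀ y ∈ closedBall (extChartAt (𝓡 n) q q) r,
      ‖y - x‖ ≤ K * dist ((extChartAt (𝓡 n) q).symm x) ((extChartAt (𝓡 n) q).symm y) ∧
      |dist ((extChartAt (𝓡 n) q).symm x) ((extChartAt (𝓡 n) q).symm y) ^ 2 -
        metricForm q x (y - x) (y - x)| ≤ K * ‖y - x‖ ^ 3 := by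
  set φ := extChartAt (𝓡 n) q with hφ
  set g := metricForm (n := n) q with hgdef
  set u₀ := φ q with hu₀
  have hg : IsMetricOn g φ.target := isMetricOn_metricForm (n := n) q
  obtain ⟨r₀, hr₀, lam, hlam, K, hK, hrU, hbd, hlip⟩ :=
    hg.exists_bounds (mem_extChartAt_target (I := 𝓡 n) q)
  have hsl : 0 < √lam := Real.sqrt_pos.2 hlam
  obtain ⟨ρ, hρ, hρsub⟩ := Metric.mem_nhds_iff.1 (Filter.inter_mem
    ((isOpen_extChartAt_source (I := 𝓡 n) q).mem_nhds (mem_extChartAt_source q))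
    ((continuousAt_extChartAt (I := 𝓡 n) q).preimage_mem_nhds (closedBall_mem_nhds _ hr₀)))
  have hsymm : ContinuousAt φ.symm u₀ := continuousAt_extChartAt_symm q
  have hq : φ.symm u₀ = q := φ.left_inv (mem_extChartAt_source q)
  obtain ⟨r₁, hr₁, hr₁sub⟩ := nhds_basis_closedBall.mem_iff.1
    (hsymm.preimage_mem_nhds (t := ball q (ρ / 4)) (by rw [hq]; exact ball_mem_nhds _ (by positivity)))
  set r := min r₀ r₁ with hr
  have hrr₀ : closedBall u₀ r ⊆ closedBall u₀ r₀ := closedBall_subset_closedBall (min_le_left _ _)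
  set C := K / (lam * √lam) with hC
  have hC0 : 0 < C := by positivity
  refine ⟨r, lt_min hr₀ hr₁, K + 1 / √lam + C * √K ^ 3, by positivity, hrr₀.trans hrU,
    fun x hx y hy ↦ ?_⟩
  set D := dist (φ.symm x) (φ.symm y) with hD
  have hD0 : 0 ≤ D := dist_nonneg
  have hx0 := hrr₀ hx
  have hy0 := hrr₀ hy
  have hXq : dist (φ.symm x) q < ρ / 4 :=
    hr₁sub (closedBall_subset_closedBall (min_le_right _ _) hx)
  have hYq : dist (φ.symm y) q < ρ / 4 :=
    hr₁sub (closedBall_subset_closedBall (min_le_right _ _) hy)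
  have hDρ : D < ρ / 2 := by
    have := dist_triangle_right (φ.symm x) (φ.symm y) q
    linarith
  -- upper bounds, from the straight segment
  have hup : ∀ S, (∀ z ∈ segment ℝ x y, g z (y - x) (y - x) ≤ S) → D ^ 2 ≤ S := by
    intro S hS
    set c : ℝ → Coord n := fun t ↦ x + t • (y - x) with hc
    have hcd : ∀ t, HasDerivAt c (y - x) t := fun t ↦ by
      have := ((hasDerivAt_id t).smul_const (y - x)).const_add x
      rwa [one_smul] at this
    have hseg : ∀ t ∈ Icc (0 : ℝ) 1, c t ∈ segment ℝ x y := fun t ht ↦ by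
      rw [segment_eq_image']; exact ⟨t, ht, rfl⟩
    have hmaps : MapsTo c (Icc 0 1) φ.target := fun t ht ↦
      hrU ((convex_closedBall u₀ r₀).segment_subset hx0 hy0 (hseg t ht))
    have hcs : ContDiffOn ℝ 1 c (Icc 0 1) := by
      refine ContDiff.contDiffOn ?_
      exact contDiff_const.add (contDiff_id.smul contDiff_const)
    have h := dist_sq_le_energy zero_lt_one hcs hmaps
    have e0 : c 0 = x := by simp [hc]
    have e1 : c 1 = y := by simp [hc]
    rw [e0, e1, sub_zero, one_mul] at h
    refine h.trans ?_
    have hder : ∀ t ∈ Icc (0 : ℝ) 1, derivWithin c (Icc 0 1) t = y - x := fun t ht ↦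
      (hcd t).hasDerivWithinAt.derivWithin (uniqueDiffOn_Icc zero_lt_one t ht)
    have hcongr : ∫ t in (0 : ℝ)..1, g (c t) (derivWithin c (Icc 0 1) t) (derivWithin c (Icc 0 1) t)
        = ∫ t in (0 : ℝ)..1, g (c t) (y - x) (y - x) := by
      refine intervalIntegral.integral_congr fun t ht ↦ ?_
      rw [uIcc_of_le zero_le_one] at ht
      simp only [hder t ht]
    rw [hcongr]
    have : ∫ t in (0 : ℝ)..1, g (c t) (y - x) (y - x) ≤ ∫ t in (0 : ℝ)..1, S := by
      refine intervalIntegral.integral_mono_on zero_le_one ?_ intervalIntegrable_const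
        fun t ht ↦ hS _ (hseg t ht)
      refine ContinuousOn.intervalIntegrable ?_
      rw [uIcc_of_le zero_le_one]
      exact ((hg.contDiffOn.continuousOn.comp hcs.continuousOn hmaps).clm_apply
        continuousOn_const).clm_apply continuousOn_const
    simpa using this
  have hup1 : D ^ 2 ≤ K * ‖y - x‖ ^ 2 := hup _ fun z hz ↦
    (hbd z ((convex_closedBall u₀ r₀).segment_subset hx0 hy0 hz) _).2
  have hup2 : D ^ 2 ≤ g x (y - x) (y - x) + K * ‖y - x‖ ^ 3 := hup _ fun z hz ↦ by
    have hz' := (convex_closedBall u₀ r₀).segment_subset hx0 hy0 hz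
    have h1 := (abs_le.1 (IsMetricOn.abs_sub_le (g := g) z x (y - x) (y - x))).2
    have h2 := hlip z hz' x hx0
    have h3 : ‖z - x‖ ≤ ‖y - x‖ := by
      rw [segment_eq_image'] at hz
      obtain ⟨t, ht, rfl⟩ := hz
      rw [add_sub_cancel_left, norm_smul, Real.norm_eq_abs, abs_of_nonneg ht.1]
      exact mul_le_of_le_one_left (norm_nonneg _) ht.2
    have h4 : ‖g z - g x‖ * ‖y - x‖ * ‖y - x‖ ≤ K * ‖y - x‖ * ‖y - x‖ * ‖y - x‖ := by
      gcongr
      exact h2.trans (by gcongr)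
    linarith [show K * ‖y - x‖ ^ 3 = K * ‖y - x‖ * ‖y - x‖ * ‖y - x‖ by ring]
  -- lower bounds, from almost minimizing curves
  have hlow : ∀ L, D < L → L < D + ρ / 4 → ‖y - x‖ ≤ L / √lam ∧
      g x (y - x) (y - x) ≤ (1 + C * L) * L ^ 2 := by
    intro L hDL hLρ
    have hL0 : 0 < L := hD0.trans_lt hDL
    obtain ⟨γ, h0, h1, hγ, hlen⟩ := exists_curve_integral_lt (n := n) hDL
    set s := speedWithin n γ (Icc 0 1) with hs
    have hscont : ContinuousOn s (Icc 0 1) :=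
      continuousOn_speedWithin (uniqueDiffOn_Icc zero_lt_one) hγ
    have hs0 : ∀ t, 0 ≤ s t := speedWithin_nonneg γ _
    have hpart : ∀ t ∈ Icc (0 : ℝ) 1, ∫ τ in 0..t, s τ ≤ L := fun t ht ↦ by
      refine le_trans ?_ hlen.le
      refine intervalIntegral.integral_mono_interval le_rfl ht.1 ht.2
        (Eventually.of_forall fun τ ↦ hs0 τ) ?_
      refine ContinuousOn.intervalIntegrable ?_
      rwa [uIcc_of_le zero_le_one]
    have hpart0 : ∀ t ∈ Icc (0 : ℝ) 1, 0 ≤ ∫ τ in 0..t, s τ := fun t ht ↦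
      intervalIntegral.integral_nonneg ht.1 fun τ _ ↦ hs0 τ
    have hball : ∀ t ∈ Icc (0 : ℝ) 1, γ t ∈ φ.source ∧ φ (γ t) ∈ closedBall u₀ r₀ := by
      intro t ht
      refine hρsub ?_
      have h2 := dist_le_integral_speedWithin hγ le_rfl ht.1 ht.2
      have h3 := dist_triangle_left (γ t) q (γ 0)
      rw [h0] at h2 h3
      rw [mem_ball]
      linarith [hpart t ht]
    set c := coordCurve n q γ with hc
    have hcC : ContDiffOn ℝ 1 c (Icc 0 1) := fun t ht ↦
      contDiffWithinAt_coordCurve (hγ t ht) (hball t ht).1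
    have hsq : ∀ t ∈ Icc (0 : ℝ) 1, s t ^ 2 =
        g (c t) (derivWithin c (Icc 0 1) t) (derivWithin c (Icc 0 1) t) := fun t ht ↦
      speedWithin_sq (uniqueDiffOn_Icc zero_lt_one t ht)
        ((hcC t ht).differentiableWithinAt (by simp)) (hγ.continuousOn t ht) (hball t ht).1
    have hc0 : c 0 = x := by
      rw [hc, coordCurve, h0]; exact φ.right_inv (hrU hx0)
    have hc1 : c 1 = y := by
      rw [hc, coordCurve, h1]; exact φ.right_inv (hrU hy0)
    have hdn : ∀ t ∈ Icc (0 : ℝ) 1, lam * ‖derivWithin c (Icc 0 1) t‖ ^ 2 ≤ s t ^ 2 := fun t ht ↦ by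
      rw [hsq t ht]; exact (hbd _ (hball t ht).2 _).1
    have hct : ∀ t ∈ Icc (0 : ℝ) 1, ‖c t - x‖ ≤ L / √lam := by
      intro t ht
      have hd : ContinuousOn (derivWithin c (Icc 0 1)) (Icc 0 1) :=
        hcC.continuousOn_derivWithin (uniqueDiffOn_Icc zero_lt_one) le_rfl
      have hsub : Icc 0 t ⊆ Icc (0 : ℝ) 1 := Icc_subset_Icc_right ht.2
      have hftc : ∫ r in 0..t, derivWithin c (Icc 0 1) r = c t - c 0 := by
        refine intervalIntegral.integral_eq_sub_of_hasDeriv_right_of_le ht.1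
          (hcC.continuousOn.mono hsub) (fun r hr ↦ ?_) ?_
        · exact (((hcC.differentiableOn (by simp)) r
            (hsub (Ioo_subset_Icc_self hr))).hasDerivWithinAt.hasDerivAt
            (Icc_mem_nhds hr.1 (hr.2.trans_le ht.2))).hasDerivWithinAt
        · refine ContinuousOn.intervalIntegrable ?_
          rw [uIcc_of_le ht.1]
          exact hd.mono hsub
      rw [← hc0, ← hftc]
      have hle : ‖∫ r in 0..t, derivWithin c (Icc 0 1) r‖ ≤ ∫ r in 0..t, s r / √lam := by
        refine intervalIntegral.norm_integral_le_of_norm_le ht.1 ?_ ?_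
        · refine Eventually.of_forall fun r hr ↦ ?_
          rw [le_div_iff₀ hsl]
          refine le_of_sq_le_sq ?_ (hs0 r)
          rw [mul_pow, Real.sq_sqrt hlam.le, mul_comm]
          exact hdn r (hsub (Ioc_subset_Icc_self hr))
        · refine ContinuousOn.intervalIntegrable ?_
          rw [uIcc_of_le ht.1]
          exact (hscont.mono hsub).div_const _
      refine hle.trans ?_
      rw [intervalIntegral.integral_div]
      exact div_le_div_of_nonneg_right (hpart t ht) hsl.le
    refine ⟨by have := hct 1 (by simp); rwa [hc1] at this, ?_⟩
    have hmain := displacement_le hg (hrU hx0) (t := 1) (A := 1 + C * L) zero_le_one (by positivity)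
      hcC le_rfl hscont (fun r _ ↦ hs0 r) fun r hr ↦ by
        have e1 := (abs_le.1 (IsMetricOn.abs_sub_le (g := g) x (c r) (derivWithin c (Icc 0 1) r)
          (derivWithin c (Icc 0 1) r))).2
        rw [← hsq r hr] at e1
        have e2 := hlip x hx0 (c r) (hball r hr).2
        rw [norm_sub_rev x] at e2
        have e3 := hct r hr
        have e4 := hdn r hr
        have e5 : ‖g x - g (c r)‖ ≤ K * (L / √lam) := e2.trans (by gcongr)
        have e6 : ‖derivWithin c (Icc 0 1) r‖ ^ 2 ≤ s r ^ 2 / lam := by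
          rw [le_div_iff₀ hlam]; linarith
        have e7 : ‖g x - g (c r)‖ * ‖derivWithin c (Icc 0 1) r‖ * ‖derivWithin c (Icc 0 1) r‖ ≤
            K * (L / √lam) * (s r ^ 2 / lam) := by
          rw [mul_assoc, ← sq]
          gcongr
        have e8 : K * (L / √lam) * (s r ^ 2 / lam) = C * L * s r ^ 2 := by
          rw [hC]; field_simp
        linarith
    rw [hc0, hc1] at hmain
    refine hmain.trans ?_
    have := hpart0 1 (by simp)
    gcongr
  have hlow' : ‖y - x‖ ≤ D / √lam ∧ g x (y - x) (y - x) ≤ (1 + C * D) * D ^ 2 := by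
    have hev : ∀ᶠ L in 𝓝[>] D, D < L ∧ L < D + ρ / 4 :=
      Ioo_mem_nhdsGT (show D < D + ρ / 4 by linarith)
    have ht1 : Tendsto (fun L ↦ L / √lam) (𝓝[>] D) (𝓝 (D / √lam)) :=
      tendsto_nhdsWithin_of_tendsto_nhds (Continuous.tendsto (by fun_prop) D)
    have ht2 : Tendsto (fun L ↦ (1 + C * L) * L ^ 2) (𝓝[>] D) (𝓝 ((1 + C * D) * D ^ 2)) :=
      tendsto_nhdsWithin_of_tendsto_nhds (Continuous.tendsto (by fun_prop) D)
    exact ⟨ge_of_tendsto ht1 (hev.mono fun L hL ↦ (hlow L hL.1 hL.2).1),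
      ge_of_tendsto ht2 (hev.mono fun L hL ↦ (hlow L hL.1 hL.2).2)⟩
  have hDw : D ≤ √K * ‖y - x‖ := by
    refine le_of_sq_le_sq ?_ (by positivity)
    rw [mul_pow, Real.sq_sqrt hK.le]
    exact hup1
  have hp3 : 0 ≤ ‖y - x‖ ^ 3 := by positivity
  refine ⟨hlow'.1.trans ?_, abs_le.2 ⟨?_, ?_⟩⟩
  · rw [div_eq_inv_mul, ← one_div]
    gcongr
    linarith [show 0 ≤ C * √K ^ 3 by positivity]
  · have h1 : C * D ^ 3 ≤ C * √K ^ 3 * ‖y - x‖ ^ 3 := by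
      rw [mul_assoc, ← mul_pow]
      gcongr
    have h2 : 0 ≤ (K + 1 / √lam) * ‖y - x‖ ^ 3 := by positivity
    nlinarith [hlow'.2]
  · have h2 : 0 ≤ (1 / √lam + C * √K ^ 3) * ‖y - x‖ ^ 3 := by positivity
    nlinarith [hup2]

end Comparison

/-- A continuous curve with second differences of order `h ^ (3 / 2)` is continuously
differentiable. -/
lemma exists_hasDerivAt_of_secondDiff {E : Type*} [NormedAddCommGroup E] [NormedSpace ℝ E]
    [CompleteSpace E] {c : ℝ → E} (hc : Continuous c) {a b K : ℝ}
    (h : ∀ t s, 0 ≤ s → a ≤ t - s → t + s ≤ b →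
      ‖c (t + s) + c (t - s) - (2 : ℝ) • c t‖ ≤ K * s * √s) :
    ∃ v : ℝ → E, ContinuousOn v (Ioo a b) ∧ ∀ t ∈ Ioo a b, HasDerivAt c (v t) t := by
  suffices hloc : ∀ t₀ ∈ Ioo a b, ∃ v : ℝ → E, ∀ᶠ t in 𝓝 t₀, ContinuousAt v t ∧
      HasDerivAt c (v t) t by
    refine ⟨deriv c, fun t ht ↦ ?_, fun t ht ↦ ?_⟩
    · obtain ⟨v, hv⟩ := hloc t ht
      exact (hv.self_of_nhds.1.congr (hv.mono fun s hs ↦ hs.2.deriv.symm)).continuousWithinAt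
    · obtain ⟨v, hv⟩ := hloc t ht
      exact hv.self_of_nhds.2.differentiableAt.hasDerivAt
  intro t₀ ht₀
  obtain ⟨b', hb', hb'b⟩ := exists_between ht₀.2
  set h₀ := b - b' with hh₀
  have h₀pos : 0 < h₀ := sub_pos.2 hb'b
  obtain ⟨η, hη⟩ : ∃ η : ℕ → ℝ, ∀ k, η k = h₀ * (1 / 2) ^ k := ⟨_, fun _ ↦ rfl⟩
  have ηpos : ∀ k, 0 < η k := fun k ↦ by rw [hη]; positivity
  have ηsucc : ∀ k, η k = η (k + 1) + η (k + 1) := fun k ↦ by simp only [hη, pow_succ]; ring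
  have ηle : ∀ k, η k ≤ h₀ := fun k ↦ by
    rw [hη]
    exact mul_le_of_le_one_right h₀pos.le (pow_le_one₀ (by norm_num) (by norm_num))
  have ηlim : Tendsto η atTop (𝓝[>] 0) := by
    refine tendsto_nhdsWithin_iff.2 ⟨?_, Eventually.of_forall ηpos⟩
    have := (tendsto_pow_atTop_nhds_zero_of_lt_one (r := (1 / 2 : ℝ)) (by norm_num)
      (by norm_num)).const_mul h₀
    rw [mul_zero] at this
    exact this.congr fun k ↦ (hη k).symm
  set q : ℕ → ℝ → E := fun k t ↦ (η k)⁻¹ • (c (t + η k) - c t) with hq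
  have hqcont : ∀ k, Continuous (q k) := fun k ↦ by fun_prop
  have hdiff : ∀ k, ∀ t ∈ Ioo a b', ‖q (k + 1) t - q k t‖ ≤ K / 2 * √(η (k + 1)) := by
    intro k t ht
    have hs := ηpos (k + 1)
    have e : q (k + 1) t - q k t = -((2 * η (k + 1))⁻¹ • (c (t + η (k + 1) + η (k + 1)) +
        c (t + η (k + 1) - η (k + 1)) - (2 : ℝ) • c (t + η (k + 1)))) := by
      change (η (k + 1))⁻¹ • (c (t + η (k + 1)) - c t) - (η k)⁻¹ • (c (t + η k) - c t) = _
      rw [ηsucc k, ← add_assoc, add_sub_cancel_right, ← two_mul, mul_inv]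
      module
    rw [e, norm_neg, norm_smul, Real.norm_of_nonneg (by positivity)]
    have h1 := h (t + η (k + 1)) (η (k + 1)) hs.le (by linarith [ht.1])
      (by linarith [ht.2, ηle k, ηsucc k])
    calc _ ≤ (2 * η (k + 1))⁻¹ * (K * η (k + 1) * √(η (k + 1))) := by gcongr
      _ = _ := by field_simp
  have hsum : Summable fun k ↦ K / 2 * √(η (k + 1)) := by
    refine Summable.mul_left _ ?_
    have e : (fun k ↦ √(η (k + 1))) = fun k ↦ √h₀ * √(1 / 2) * √(1 / 2) ^ k := by
      ext k
      have : √(1 / 2 : ℝ) ^ (k + 1) = √((1 / 2) ^ (k + 1)) :=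
        (Real.sqrt_eq_iff_mul_self_eq (by positivity) (by positivity)).2 (by
          rw [← mul_pow, Real.mul_self_sqrt (by norm_num)]) |>.symm
      rw [hη, mul_assoc, ← pow_succ', this, ← Real.sqrt_mul h₀pos.le]
    rw [e]
    refine (summable_geometric_of_lt_one (Real.sqrt_nonneg _) ?_).mul_left _
    rw [Real.sqrt_lt' one_pos]; norm_num
  have hunif := tendstoUniformlyOn_tsum_nat hsum hdiff
  have hunif' : TendstoUniformlyOn q
      (fun t ↦ q 0 t + ∑' k, (q (k + 1) t - q k t)) atTop (Ioo a b') := by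
    rw [Metric.tendstoUniformlyOn_iff] at hunif ⊢
    intro ε hε
    filter_upwards [hunif ε hε] with N hN t ht
    have := hN t ht
    rw [Finset.sum_range_sub (fun k ↦ q k t)] at this
    rw [dist_eq_norm] at this ⊢
    convert this using 2
    abel
  set v : ℝ → E := fun t ↦ q 0 t + ∑' k, (q (k + 1) t - q k t) with hv
  have hvc : ContinuousOn v (Ioo a b') :=
    hunif'.continuousOn (Frequently.of_forall fun k ↦ (hqcont k).continuousOn)
  have hprim : ∀ t, HasDerivAt (fun t ↦ ∫ s in (0 : ℝ)..t, c s) (c t) t := fun t ↦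
    intervalIntegral.integral_hasDerivAt_right (hc.intervalIntegrable _ _)
      (hc.stronglyMeasurableAtFilter _ _) hc.continuousAt
  have hd : ∀ t ∈ Ioo a b', HasDerivAt c (v t) t := by
    intro t ht
    refine hasDerivAt_of_tendstoUniformlyOn isOpen_Ioo hunif'
      (f := fun k t ↦ (η k)⁻¹ • ((∫ s in (0 : ℝ)..t + η k, c s) - ∫ s in (0 : ℝ)..t, c s))
      (Eventually.of_forall fun k t _ ↦ ?_) (fun t _ ↦ ?_) ht
    · exact (((hprim _).comp_add_const t (η k)).sub (hprim t)).const_smul _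
    · exact (hprim t).tendsto_slope_zero_right.comp ηlim
  exact ⟨v, by
    filter_upwards [Ioo_mem_nhds ht₀.1 hb'] with t ht
    exact ⟨hvc.continuousAt (Ioo_mem_nhds ht.1 ht.2), hd t ht⟩⟩

/-- The lemma of du Bois-Reymond. -/
lemma hasDerivAt_of_forall_integral_eq_zero {P Q : ℝ → ℝ} {a b : ℝ} (hab : a < b)
    (hP : ContinuousOn P (Icc a b)) (hQ : ContinuousOn Q (Icc a b))
    (h : ∀ η : ℝ → ℝ, ContDiff ℝ 1 η → η a = 0 → η b = 0 →
      ∫ t in a..b, (P t * deriv η t + Q t * η t) = 0) :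
    ∀ t ∈ Ioo a b, HasDerivAt P (Q t) t := by
  wlog hcont : Continuous P ∧ Continuous Q generalizing P Q
  · have hpr : ∀ t ∈ Icc a b, ((projIcc a b hab.le t : Icc a b) : ℝ) = t := fun t ht ↦ by
      rw [projIcc_of_mem _ ht]
    have hext : ∀ F : ℝ → ℝ, ContinuousOn F (Icc a b) →
        Continuous fun t ↦ F (projIcc a b hab.le t) := fun F hF ↦
      hF.comp_continuous (continuous_subtype_val.comp continuous_projIcc) fun t ↦ Subtype.coe_prop _
    have h1 := this (hext P hP).continuousOn (hext Q hQ).continuousOn (fun η hη ha hb ↦ by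
      rw [← h η hη ha hb]
      refine intervalIntegral.integral_congr fun t ht ↦ ?_
      rw [uIcc_of_le hab.le] at ht
      simp only [hpr t ht]) ⟨hext P hP, hext Q hQ⟩
    intro t ht
    have h2 := h1 t ht
    rw [hpr t (Ioo_subset_Icc_self ht)] at h2
    refine h2.congr_of_eventuallyEq ?_
    filter_upwards [Ioo_mem_nhds ht.1 ht.2] with s hs
    rw [hpr s (Ioo_subset_Icc_self hs)]
  obtain ⟨hP, hQ⟩ := hcont
  have hprim : ∀ {F : ℝ → ℝ}, Continuous F → ∀ t, HasDerivAt (fun t ↦ ∫ s in a..t, F s) (F t) t :=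
    fun hF t ↦ intervalIntegral.integral_hasDerivAt_right (hF.intervalIntegrable _ _)
      (hF.stronglyMeasurableAtFilter _ _) hF.continuousAt
  set G : ℝ → ℝ := fun t ↦ ∫ s in a..t, Q s with hG
  have hGd := hprim hQ
  have hGc : Continuous G := continuous_iff_continuousAt.2 fun t ↦ (hGd t).continuousAt
  set m := (∫ t in a..b, (P t - G t)) / (b - a) with hm
  set R : ℝ → ℝ := fun t ↦ P t - G t - m with hR
  have hRc : Continuous R := (hP.sub hGc).sub continuous_const
  set η : ℝ → ℝ := fun t ↦ ∫ s in a..t, R s with hη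
  have hηd : ∀ t, HasDerivAt η (R t) t := hprim hRc
  have hdη : deriv η = R := funext fun t ↦ (hηd t).deriv
  have hηc : ContDiff ℝ 1 η := contDiff_one_iff_deriv.2
    ⟨fun t ↦ (hηd t).differentiableAt, by rw [hdη]; exact hRc⟩
  have ha : η a = 0 := intervalIntegral.integral_same
  have hb : η b = 0 := by
    have hne : b - a ≠ 0 := (sub_pos.2 hab).ne'
    simp only [hη, hR]
    have c1 : Continuous fun t ↦ P t - G t := hP.sub hGc
    rw [intervalIntegral.integral_sub (c1.intervalIntegrable _ _)
      intervalIntegrable_const, intervalIntegral.integral_const, hm, smul_eq_mul]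
    field_simp
    ring
  have h1 := h η hηc ha hb
  have h2 : ∫ t in a..b, (Q t * η t + G t * R t) = 0 := by
    rw [intervalIntegral.integral_deriv_mul_eq_sub (u := G) (v := η) (fun t _ ↦ hGd t)
      (fun t _ ↦ hηd t) (hQ.intervalIntegrable _ _) (hRc.intervalIntegrable _ _), ha, hb]
    ring
  have h3 : ∫ t in a..b, R t ^ 2 = 0 := by
    have e : ∀ t, R t ^ 2 = (P t * deriv η t + Q t * η t) - (Q t * η t + G t * R t) - m * R t := by
      intro t; rw [hdη]; simp only [hR]; ring
    have c1 : Continuous fun t ↦ P t * deriv η t + Q t * η t := by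
      rw [hdη]; exact (hP.mul hRc).add (hQ.mul hηc.continuous)
    have c2 : Continuous fun t ↦ Q t * η t + G t * R t := (hQ.mul hηc.continuous).add (hGc.mul hRc)
    simp only [e]
    have c3 : Continuous fun t ↦ P t * deriv η t + Q t * η t - (Q t * η t + G t * R t) := c1.sub c2
    have c4 : Continuous fun t ↦ m * R t := continuous_const.mul hRc
    rw [intervalIntegral.integral_sub (c3.intervalIntegrable _ _) (c4.intervalIntegrable _ _),
      intervalIntegral.integral_sub (c1.intervalIntegrable _ _) (c2.intervalIntegrable _ _), h1, h2,
      intervalIntegral.integral_const_mul, show ∫ t in a..b, R t = 0 from hb]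
    ring
  have h4 : ∀ t ∈ Icc a b, R t = 0 := by
    by_contra! hne
    obtain ⟨t, ht, hne⟩ := hne
    have := intervalIntegral.integral_pos hab ((hRc.pow 2).continuousOn)
      (fun s _ ↦ sq_nonneg (R s)) ⟨t, ht, sq_pos_of_ne_zero hne⟩
    exact this.ne' h3
  intro t ht
  refine ((hGd t).add_const m).congr_of_eventuallyEq ?_
  filter_upwards [Ioo_mem_nhds ht.1 ht.2] with s hs
  have := h4 s (Ioo_subset_Icc_self hs)
  simp only [hR] at this
  linarith

lemma hasDerivAt_integral_of_continuousOn {F F' : ℝ → ℝ → ℝ} {a b ε : ℝ} (hab : a ≤ b)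
    (hε : 0 < ε)
    (hF : ContinuousOn (Function.uncurry F) (Icc (-ε) ε ×ˢ Icc a b))
    (hF' : ContinuousOn (Function.uncurry F') (Icc (-ε) ε ×ˢ Icc a b))
    (hd : ∀ x ∈ Icc (-ε) ε, ∀ t ∈ Icc a b, HasDerivAt (fun x ↦ F x t) (F' x t) x) :
    HasDerivAt (fun x ↦ ∫ t in a..b, F x t) (∫ t in a..b, F' 0 t) 0 := by
  have hslice : ∀ {G : ℝ → ℝ → ℝ}, ContinuousOn (Function.uncurry G) (Icc (-ε) ε ×ˢ Icc a b) →
      ∀ x ∈ Icc (-ε) ε, IntervalIntegrable (G x) volume a b := fun hG x hx ↦ by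
    refine ContinuousOn.intervalIntegrable ?_
    rw [uIcc_of_le hab]
    exact hG.comp (f := fun t ↦ (x, t)) (by fun_prop) fun t ht ↦ ⟨hx, ht⟩
  have h0 : (0 : ℝ) ∈ Icc (-ε) ε := ⟨by linarith, hε.le⟩
  obtain ⟨B, hB⟩ := (isCompact_Icc.prod isCompact_Icc).exists_bound_of_continuousOn hF'
  have hsub : ∀ t ∈ uIoc a b, t ∈ Icc a b := fun t ht ↦ by
    rw [uIoc_of_le hab] at ht; exact Ioc_subset_Icc_self ht
  have hnhds : Icc (-ε) ε ∈ 𝓝 (0 : ℝ) := Icc_mem_nhds (by linarith) hε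
  refine (intervalIntegral.hasDerivAt_integral_of_dominated_loc_of_deriv_le
    (bound := fun _ ↦ B) hnhds ?_ (hslice hF 0 h0) (hslice hF' 0 h0).def'.aestronglyMeasurable
    ?_ intervalIntegrable_const ?_).2
  · filter_upwards [hnhds] with x hx using (hslice hF x hx).def'.aestronglyMeasurable
  · exact Eventually.of_forall fun t ht x hx ↦ hB (x, t) ⟨hx, hsub t ht⟩
  · exact Eventually.of_forall fun t ht x hx ↦ hd x hx t (hsub t ht)

section CoordinateMetric

variable {E : Type*} [NormedAddCommGroup E] [NormedSpace ℝ E]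
  {g : E → E →L[ℝ] E →L[ℝ] ℝ} {U : Set E}

namespace IsMetricOn

lemma hasFDerivAt (hg : IsMetricOn g U) {u : E} (hu : u ∈ U) : HasFDerivAt g (fderiv ℝ g u) u :=
  ((hg.contDiffOn.contDiffAt (hg.isOpen.mem_nhds hu)).differentiableAt (by simp)).hasFDerivAt

lemma continuousOn_fderiv (hg : IsMetricOn g U) : ContinuousOn (fderiv ℝ g) U :=
  hg.contDiffOn.continuousOn_fderiv_of_isOpen hg.isOpen (by simp)

/-- The first variation of the energy. -/
lemma firstVariation_eq_zero (hg : IsMetricOn g U) {c v : ℝ → E} {a b : ℝ} (hab : a < b)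
    (hc : ContinuousOn c (Icc a b)) (hv : ContinuousOn v (Icc a b)) (hU : MapsTo c (Icc a b) U)
    (w : E) (η : ℝ → ℝ) (hη : ContDiff ℝ 1 η)
    (hmin : ∀ x : ℝ, (∀ t ∈ Icc a b, c t + (x * η t) • w ∈ U) →
      ∫ t in a..b, g (c t) (v t) (v t) ≤ ∫ t in a..b, g (c t + (x * η t) • w)
        (v t + (x * deriv η t) • w) (v t + (x * deriv η t) • w)) :
    ∫ t in a..b, (g (c t) (v t) w * deriv η t +
      1 / 2 * fderiv ℝ g (c t) w (v t) (v t) * η t) = 0 := by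
  have hηd : ∀ t, HasDerivAt η (deriv η t) t := fun t ↦
    (hη.differentiable (by simp) t).hasDerivAt
  have hη' : Continuous (deriv η) := hη.continuous_deriv le_rfl
  obtain ⟨δ, hδ, hthick⟩ := (isCompact_Icc.image_of_continuousOn hc).exists_cthickening_subset_open
    hg.isOpen hU.image_subset
  obtain ⟨B, hB⟩ := isCompact_Icc.exists_bound_of_continuousOn (hη.continuous.continuousOn
    (s := Icc a b))
  obtain ⟨ε, hε, hεB⟩ : ∃ ε > 0, ε * ((|B| + 1) * (‖w‖ + 1)) ≤ δ :=
    ⟨δ / ((|B| + 1) * (‖w‖ + 1)), by positivity, by field_simp; rfl⟩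
  have hmem : ∀ x ∈ Icc (-ε) ε, ∀ t ∈ Icc a b, c t + (x * η t) • w ∈ U := by
    intro x hx t ht
    refine hthick (mem_cthickening_of_dist_le _ (c t) _ _ (mem_image_of_mem c ht) ?_)
    rw [dist_eq_norm, add_sub_cancel_left, norm_smul, norm_mul, mul_assoc]
    refine le_trans ?_ hεB
    have h1 : ‖x‖ ≤ ε := abs_le.2 hx
    have h2 : ‖η t‖ ≤ |B| + 1 := (hB t ht).trans (by linarith [le_abs_self B])
    gcongr
    linarith
  set F : ℝ → ℝ → ℝ := fun x t ↦ g (c t + (x * η t) • w)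
    (v t + (x * deriv η t) • w) (v t + (x * deriv η t) • w) with hF
  set F' : ℝ → ℝ → ℝ := fun x t ↦
    fderiv ℝ g (c t + (x * η t) • w) (η t • w) (v t + (x * deriv η t) • w)
      (v t + (x * deriv η t) • w) +
    g (c t + (x * η t) • w) (deriv η t • w) (v t + (x * deriv η t) • w) +
    g (c t + (x * η t) • w) (v t + (x * deriv η t) • w) (deriv η t • w) with hF'
  set S := Icc (-ε) ε ×ˢ Icc a b with hS
  have hsnd : MapsTo (Prod.snd : ℝ × ℝ → ℝ) S (Icc a b) := fun p hp ↦ hp.2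
  have cη : ContinuousOn (fun p : ℝ × ℝ ↦ η p.2) S :=
    (hη.continuous.comp continuous_snd).continuousOn
  have cη' : ContinuousOn (fun p : ℝ × ℝ ↦ deriv η p.2) S :=
    (hη'.comp continuous_snd).continuousOn
  have cx : ContinuousOn (fun p : ℝ × ℝ ↦ p.1) S := continuous_fst.continuousOn
  have cw : ContinuousOn (fun _ : ℝ × ℝ ↦ w) S := continuousOn_const
  have cu : ContinuousOn (fun p : ℝ × ℝ ↦ c p.2 + (p.1 * η p.2) • w) S :=
    (hc.comp continuous_snd.continuousOn hsnd).add ((cx.mul cη).smul cw)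
  have cV : ContinuousOn (fun p : ℝ × ℝ ↦ v p.2 + (p.1 * deriv η p.2) • w) S :=
    (hv.comp continuous_snd.continuousOn hsnd).add ((cx.mul cη').smul cw)
  have hmaps : MapsTo (fun p : ℝ × ℝ ↦ c p.2 + (p.1 * η p.2) • w) S U := fun p hp ↦
    hmem p.1 hp.1 p.2 hp.2
  have cg := hg.contDiffOn.continuousOn.comp cu hmaps
  have cdg := hg.continuousOn_fderiv.comp cu hmaps
  have hder := hasDerivAt_integral_of_continuousOn (F := F) (F' := F') hab.le hε
    ((cg.clm_apply cV).clm_apply cV)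
    (((((cdg.clm_apply (cη.smul cw)).clm_apply cV).clm_apply cV).add
      ((cg.clm_apply (cη'.smul cw)).clm_apply cV)).add ((cg.clm_apply cV).clm_apply (cη'.smul cw)))
    (fun x hx t ht ↦ by
      have e1 : HasDerivAt (fun x : ℝ ↦ c t + (x * η t) • w) (η t • w) x := by
        have := ((hasDerivAt_mul_const (x := x) (η t)).smul_const w).const_add (c t)
        exact this
      have e2 : HasDerivAt (fun x : ℝ ↦ v t + (x * deriv η t) • w) (deriv η t • w) x := by
        have := ((hasDerivAt_mul_const (x := x) (deriv η t)).smul_const w).const_add (v t)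
        exact this
      have e3 := (hg.hasFDerivAt (hmem x hx t ht)).comp_hasDerivAt x e1
      exact ((e3.clm_apply e2).clm_apply e2).congr_deriv (by simp [hF']))
  have hlocal : IsLocalMin (fun x ↦ ∫ t in a..b, F x t) 0 := by
    filter_upwards [Icc_mem_nhds (show -ε < 0 by linarith) hε] with x hx
    refine le_trans (le_of_eq ?_) (hmin x (hmem x hx))
    simp [hF]
  have h0 := hlocal.hasDerivAt_eq_zero hder
  have : ∫ t in a..b, (g (c t) (v t) w * deriv η t +
      1 / 2 * fderiv ℝ g (c t) w (v t) (v t) * η t) = ∫ t in a..b, 1 / 2 * F' 0 t := by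
    refine intervalIntegral.integral_congr fun t _ ↦ ?_
    simp only [hF', zero_mul, zero_smul, add_zero, map_smul, smul_apply, smul_eq_mul,
      hg.symm (c t) w (v t)]
    ring
  rw [this, intervalIntegral.integral_const_mul, h0, mul_zero]

/-- A continuously differentiable curve of least energy is a geodesic. -/
lemma hasDerivAt_of_energy_minimal [FiniteDimensional ℝ E] (hg : IsMetricOn g U) {c v : ℝ → E}
    {a b : ℝ} (hab : a < b)
    (hd : ∀ t ∈ Icc a b, HasDerivAt c (v t) t) (hv : ContinuousOn v (Icc a b))
    (hU : MapsTo c (Icc a b) U)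
    (hmin : ∀ (w : E) (η : ℝ → ℝ), ContDiff ℝ 1 η → η a = 0 → η b = 0 →
      (∀ t ∈ Icc a b, c t + η t • w ∈ U) →
      ∫ t in a..b, g (c t) (v t) (v t) ≤
        ∫ t in a..b, g (c t + η t • w) (v t + deriv η t • w) (v t + deriv η t • w)) :
    ∀ t ∈ Ioo a b, HasDerivAt v (geodAcc g (c t) (v t)) t := by
  have hc : ContinuousOn c (Icc a b) := fun t ht ↦ (hd t ht).continuousAt.continuousWithinAt
  have cg := hg.contDiffOn.continuousOn.comp hc hU
  have cdg := hg.continuousOn_fderiv.comp hc hU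
  have hEL : ∀ w, ∀ t ∈ Ioo a b, HasDerivAt (fun t ↦ g (c t) (v t) w)
      (1 / 2 * fderiv ℝ g (c t) w (v t) (v t)) t := by
    intro w
    refine hasDerivAt_of_forall_integral_eq_zero hab
      ((cg.clm_apply hv).clm_apply continuousOn_const)
      (continuousOn_const.mul (((cdg.clm_apply continuousOn_const).clm_apply hv).clm_apply hv))
      fun η hη ha hb ↦ ?_
    refine hg.firstVariation_eq_zero hab hc hv hU w η hη fun x hx ↦ ?_
    have hd' : deriv (fun t ↦ x * η t) = fun t ↦ x * deriv η t := funext fun t ↦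
      deriv_const_mul_field x
    have := hmin w (fun t ↦ x * η t) (contDiff_const.mul hη) (by simp [ha]) (by simp [hb]) hx
    rwa [hd'] at this
  have hPC : ContDiffOn ℝ 1 (fun t ↦ g (c t) (v t)) (Ioo a b) := by
    rw [contDiffOn_clm_apply]
    intro w
    rw [show (1 : WithTop ℕ∞) = 0 + 1 by rfl, contDiffOn_succ_iff_deriv_of_isOpen isOpen_Ioo]
    refine ⟨fun t ht ↦ (hEL w t ht).differentiableAt.differentiableWithinAt, by simp, ?_⟩
    rw [contDiffOn_zero]
    refine ContinuousOn.congr (f := fun t ↦ 1 / 2 * fderiv ℝ g (c t) w (v t) (v t)) ?_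
      fun t ht ↦ (hEL w t ht).deriv
    exact (continuousOn_const.mul (((cdg.clm_apply continuousOn_const).clm_apply hv).clm_apply
      hv)).mono Ioo_subset_Icc_self
  intro t ht
  have ht' := Ioo_subset_Icc_self ht
  have hu := hU ht'
  have hgc : HasDerivAt (fun s ↦ g (c s)) (fderiv ℝ g (c t) (v t)) t :=
    (hg.hasFDerivAt hu).comp_hasDerivAt t (hd t ht')
  have hvd : DifferentiableAt ℝ v t := by
    have e1 : v =ᶠ[𝓝 t] fun s ↦ (g (c s)).inverse (g (c s) (v s)) := by
      filter_upwards [Ioo_mem_nhds ht.1 ht.2] with s hs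
      obtain ⟨e, he⟩ := hg.isInvertible (hU (Ioo_subset_Icc_self hs))
      simp [← he]
    refine DifferentiableAt.congr_of_eventuallyEq ?_ e1
    refine DifferentiableAt.clm_apply ?_
      ((hPC.contDiffAt (Ioo_mem_nhds ht.1 ht.2)).differentiableAt (by simp))
    obtain ⟨e, he⟩ := hg.isInvertible hu
    have h1 : ContDiffAt ℝ ∞ (ContinuousLinearMap.inverse : (E →L[ℝ] E →L[ℝ] ℝ) → _) (g (c t)) := by
      rw [← he]; exact contDiffAt_map_inverse e
    exact (h1.differentiableAt (by simp)).comp t hgc.differentiableAt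
  have ha := hvd.hasDerivAt
  rw [← (hg.geodAcc_iff hu).2 (fun w ↦ ?_)]
  · exact ha
  · have h1 := ((hgc.clm_apply ha).clm_apply (hasDerivAt_const t w)).unique (hEL w t ht)
    simp only [add_apply, map_zero, add_zero] at h1
    rw [lowerChristoffel_apply]
    linarith

end IsMetricOn

end CoordinateMetric

section Minimizers

variable {n : ℕ} {M : Type*} [MetricSpace M] [ChartedSpace (EuclideanSpace ℝ (Fin n)) M]
  [IsManifold (𝓡 n) ∞ M] [RiemannianBundle (fun x : M ↦ TangentSpace (𝓡 n) x)]
  [IsContMDiffRiemannianBundle (𝓡 n) ∞ (EuclideanSpace ℝ (Fin n))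
      (fun x : M ↦ TangentSpace (𝓡 n) x)]
  [IsRiemannianManifold (𝓡 n) M]

/-- In a chart, a curve of constant metric speed has second differences of order `h ^ (3 / 2)`
and is Lipschitz, and its chords have almost constant speed. -/
lemma exists_secondDiff_le {f : ℝ → M} {a b D t₀ : ℝ} (hD : 0 ≤ D) (ht₀ : t₀ ∈ Ioo a b)
    (hf : ∀ s ∈ Icc a b, ∀ t ∈ Icc a b, dist (f s) (f t) = D * |s - t|) :
    ∃ δ > 0, ∃ K, Icc (t₀ - δ) (t₀ + δ) ⊆ Icc a b ∧
      (∀ t ∈ Icc (t₀ - δ) (t₀ + δ), f t ∈ (extChartAt (𝓡 n) (f t₀)).source) ∧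
      ContinuousOn (coordCurve n (f t₀) f) (Icc (t₀ - δ) (t₀ + δ)) ∧
      (∀ t s, 0 ≤ s → t₀ - δ ≤ t - s → t + s ≤ t₀ + δ →
        ‖coordCurve n (f t₀) f (t + s) + coordCurve n (f t₀) f (t - s) -
          (2 : ℝ) • coordCurve n (f t₀) f t‖ ≤ K * s * √s) ∧
      ∀ t s, 0 ≤ s → t₀ - δ ≤ t → t + s ≤ t₀ + δ →
        |D ^ 2 * s ^ 2 - metricForm (f t₀) (coordCurve n (f t₀) f t)
          (coordCurve n (f t₀) f (t + s) - coordCurve n (f t₀) f t)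
          (coordCurve n (f t₀) f (t + s) - coordCurve n (f t₀) f t)| ≤ K * s ^ 3 := by
  set x₀ := f t₀ with hx₀
  set φ := extChartAt (𝓡 n) x₀ with hφ
  set c := coordCurve n x₀ f with hc
  set g := metricForm (n := n) x₀ with hgdef
  have hg : IsMetricOn g φ.target := isMetricOn_metricForm (n := n) x₀
  obtain ⟨r, hr, K, hK, hrU, hcomp⟩ := exists_comparison (n := n) x₀
  obtain ⟨r', hr', lam, hlam, K', hK', -, hbd, hlip⟩ :=
    hg.exists_bounds (mem_extChartAt_target (I := 𝓡 n) x₀)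
  have hfc : ContinuousAt f t₀ := by
    have hlim : Tendsto (fun t ↦ D * |t - t₀|) (𝓝 t₀) (𝓝 0) := by
      have : Continuous fun t ↦ D * |t - t₀| := by fun_prop
      simpa using this.tendsto t₀
    refine tendsto_iff_dist_tendsto_zero.2 (hlim.congr' ?_)
    filter_upwards [Icc_mem_nhds ht₀.1 ht₀.2] with t ht
    exact (hf t ht t₀ (Ioo_subset_Icc_self ht₀)).symm
  have hev : ∀ᶠ t in 𝓝 t₀, (f t ∈ φ.source ∧ c t ∈ closedBall (φ x₀) r ∧
      c t ∈ closedBall (φ x₀) r') ∧ t ∈ Icc a b := by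
    have h1 : ContinuousAt c t₀ := (continuousAt_extChartAt (I := 𝓡 n) x₀).comp hfc
    exact ((hfc.eventually_mem ((isOpen_extChartAt_source (I := 𝓡 n) x₀).mem_nhds
      (mem_extChartAt_source x₀))).and ((h1.eventually_mem (closedBall_mem_nhds _ hr)).and
      (h1.eventually_mem (closedBall_mem_nhds _ hr')))).and (Icc_mem_nhds ht₀.1 ht₀.2)
  obtain ⟨δ, hδ, hball⟩ := nhds_basis_closedBall.eventually_iff.1 hev
  rw [Real.closedBall_eq_Icc] at hball
  set J := Icc (t₀ - δ) (t₀ + δ) with hJ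
  have hsymm : ∀ t ∈ J, φ.symm (c t) = f t := fun t ht ↦ φ.left_inv (hball ht).1.1
  set Q := K * D with hQ
  have hQ0 : 0 ≤ Q := by positivity
  have hL : ∀ s ∈ J, ∀ t ∈ J, ‖c t - c s‖ ≤ Q * |s - t| := fun s hs t ht ↦ by
    have h1 := (hcomp (c s) (hball hs).1.2.1 (c t) (hball ht).1.2.1).1
    rwa [hsymm s hs, hsymm t ht, hf s (hball hs).2 t (hball ht).2, ← mul_assoc] at h1
  have hcd : ∀ s ∈ J, ∀ t ∈ J, |D ^ 2 * (s - t) ^ 2 - g (c s) (c t - c s) (c t - c s)| ≤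
      K * (Q * |s - t|) ^ 3 := fun s hs t ht ↦ by
    have h1 := (hcomp (c s) (hball hs).1.2.1 (c t) (hball ht).1.2.1).2
    rw [hsymm s hs, hsymm t ht, hf s (hball hs).2 t (hball ht).2, mul_pow, sq_abs] at h1
    refine h1.trans ?_
    gcongr
    exact hL s hs t ht
  set W := (12 * K + 4 * K') * Q ^ 3 with hW
  have hW0 : 0 ≤ W := by positivity
  refine ⟨δ, hδ, √(W / lam) + K * Q ^ 3, fun t ht ↦ (hball ht).2, fun t ht ↦ (hball ht).1.1,
    fun t ht ↦ ?_, fun t s hs h1 h2 ↦ ?_, fun t s hs h1 h2 ↦ ?_⟩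
  · refine tendsto_iff_norm_sub_tendsto_zero.2 ?_
    have hlim : Tendsto (fun s ↦ Q * |t - s|) (𝓝[J] t) (𝓝 0) := by
      have : Continuous fun s ↦ Q * |t - s| := by fun_prop
      simpa using (this.tendsto t).mono_left nhdsWithin_le_nhds
    refine squeeze_zero' (Eventually.of_forall fun _ ↦ norm_nonneg _) ?_ hlim
    filter_upwards [self_mem_nhdsWithin] with s hs using hL t ht s hs
  · have htJ : t ∈ J := ⟨by linarith, by linarith⟩
    have hpJ : t + s ∈ J := ⟨by linarith, by linarith⟩
    have hmJ : t - s ∈ J := ⟨by linarith, by linarith⟩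
    obtain ⟨A, hA⟩ : ∃ A, A = c (t + s) - c t := ⟨_, rfl⟩
    obtain ⟨B, hB⟩ : ∃ B, B = c (t - s) - c t := ⟨_, rfl⟩
    have eAB : c (t + s) - c (t - s) = A - B := by rw [hA, hB]; abel
    have i1 : |t - (t + s)| = s := by rw [sub_add_cancel_left, abs_neg, abs_of_nonneg hs]
    have i2 : |t - (t - s)| = s := by rw [sub_sub_cancel, abs_of_nonneg hs]
    have i3 : |t - s - (t + s)| = 2 * s := by
      rw [show t - s - (t + s) = -(2 * s) by ring, abs_neg, abs_of_nonneg (by positivity)]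
    have n1 := hcd t htJ _ hpJ
    have n2 := hcd t htJ _ hmJ
    have n3 := hcd _ hmJ _ hpJ
    have l2 := hL t htJ _ hmJ
    have l3 := hL _ hmJ _ hpJ
    rw [← hA, i1] at n1
    rw [← hB, i2] at n2
    rw [eAB, i3] at n3
    rw [← hB, i2] at l2
    rw [eAB, i3] at l3
    have n4 : |g (c (t - s)) (A - B) (A - B) - g (c t) (A - B) (A - B)| ≤
        K' * (Q * s) * (Q * (2 * s)) * (Q * (2 * s)) := by
      refine (IsMetricOn.abs_sub_le _ _ _ _).trans ?_
      have h3 := hlip _ (hball hmJ).1.2.2 _ (hball htJ).1.2.2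
      rw [← hB] at h3
      have h4 : ‖g (c (t - s)) - g (c t)‖ ≤ K' * (Q * s) := h3.trans (by gcongr)
      gcongr
    have hpar : g (c t) (A + B) (A + B) = 2 * g (c t) A A + 2 * g (c t) B B -
        g (c t) (A - B) (A - B) := by
      simp only [map_add, map_sub, add_apply, sub_apply]; ring
    have hle : lam * ‖A + B‖ ^ 2 ≤ W * s ^ 3 := by
      refine (hbd _ (hball htJ).1.2.2 _).1.trans ?_
      rw [hpar, hW]
      have m1 := (abs_le.1 n1).1
      have m2 := (abs_le.1 n2).1
      have m3 := (abs_le.1 n3).2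
      have m4 := (abs_le.1 n4).2
      linarith
    have eg : c (t + s) + c (t - s) - (2 : ℝ) • c t = A + B := by
      rw [hA, hB, two_smul]; abel
    rw [eg]
    have : ‖A + B‖ ≤ √(W / lam) * s * √s := by
      refine le_of_sq_le_sq ?_ (by positivity)
      rw [mul_pow, mul_pow, Real.sq_sqrt (by positivity), Real.sq_sqrt hs, div_mul_eq_mul_div,
        div_mul_eq_mul_div, le_div_iff₀ hlam]
      linarith
    refine this.trans ?_
    gcongr
    linarith [show 0 ≤ K * Q ^ 3 by positivity]
  · have htJ : t ∈ J := ⟨h1, by linarith⟩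
    have hpJ : t + s ∈ J := ⟨by linarith, h2⟩
    have := hcd t htJ _ hpJ
    rw [sub_add_cancel_left, abs_neg, abs_of_nonneg hs, neg_sq] at this
    refine this.trans ?_
    rw [mul_pow, ← mul_assoc]
    gcongr
    linarith [Real.sqrt_nonneg (W / lam)]

/-- A curve whose metric speed is constant on an interval is a geodesic in its interior. -/
lemma isGeodAt_of_dist_eq {f : ℝ → M} {a b D t₀ : ℝ} (hD : 0 ≤ D) (ht₀ : t₀ ∈ Ioo a b)
    (hf : ∀ s ∈ Icc a b, ∀ t ∈ Icc a b, dist (f s) (f t) = D * |s - t|) :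
    IsGeodAt n f t₀ ∧ speedWithin n f univ t₀ = D := by
  obtain ⟨δ, hδ, K, hsub, hsrc, hcont, hsd, hchord⟩ := exists_secondDiff_le (n := n) hD ht₀ hf
  set x₀ := f t₀ with hx₀
  set φ := extChartAt (𝓡 n) x₀ with hφ
  set c₀ := coordCurve n x₀ f with hc₀
  set g := metricForm (n := n) x₀ with hgdef
  have hg : IsMetricOn g φ.target := isMetricOn_metricForm (n := n) x₀
  have hle : t₀ - δ ≤ t₀ + δ := by linarith
  set c : ℝ → Coord n := fun t ↦ c₀ (projIcc (t₀ - δ) (t₀ + δ) hle t) with hc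
  have hcc : Continuous c := hcont.comp_continuous
    (continuous_subtype_val.comp continuous_projIcc) fun t ↦ Subtype.coe_prop _
  have hceq : ∀ t ∈ Icc (t₀ - δ) (t₀ + δ), c t = c₀ t := fun t ht ↦ by
    rw [hc]; simp only [projIcc_of_mem _ ht]
  obtain ⟨v, hvc, hvd⟩ := exists_hasDerivAt_of_secondDiff hcc (a := t₀ - δ) (b := t₀ + δ) (K := K)
    (fun t s hs h1 h2 ↦ by
      rw [hceq t ⟨by linarith, by linarith⟩, hceq (t + s) ⟨by linarith, by linarith⟩,
        hceq (t - s) ⟨by linarith, by linarith⟩]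
      exact hsd t s hs h1 h2)
  have htar : ∀ t ∈ Icc (t₀ - δ) (t₀ + δ), c t ∈ φ.target := fun t ht ↦ by
    rw [hceq t ht]; exact coordCurve_mem_target (hsrc t ht)
  have hspeed : ∀ t ∈ Ioo (t₀ - δ) (t₀ + δ), g (c t) (v t) (v t) = D ^ 2 := by
    intro t ht
    have hs := (hvd t ht).tendsto_slope_zero_right
    have h1 : Tendsto (fun s ↦ |D ^ 2 - g (c t) (s⁻¹ • (c (t + s) - c t))
        (s⁻¹ • (c (t + s) - c t))|) (𝓝[>] 0) (𝓝 |D ^ 2 - g (c t) (v t) (v t)|) := by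
      have hq : Continuous fun w ↦ |D ^ 2 - g (c t) w w| := by fun_prop
      exact (hq.tendsto (v t)).comp hs
    have h2 : Tendsto (fun s : ℝ ↦ K * s) (𝓝[>] 0) (𝓝 0) := by
      have : Continuous fun s : ℝ ↦ K * s := by fun_prop
      simpa using (this.tendsto 0).mono_left nhdsWithin_le_nhds
    have h3 : |D ^ 2 - g (c t) (v t) (v t)| ≤ 0 := by
      refine le_of_tendsto_of_tendsto h1 h2 ?_
      filter_upwards [Ioo_mem_nhdsGT (sub_pos.2 ht.2)] with s hs
      have hs0 : 0 < s := hs.1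
      have h4 := hchord t s hs0.le ht.1.le (by linarith [hs.2])
      rw [← hceq t (Ioo_subset_Icc_self ht), ← hceq (t + s) ⟨by linarith [ht.1], by linarith [hs.2]⟩]
        at h4
      simp only [map_smul, smul_apply, smul_eq_mul]
      have e : D ^ 2 - s⁻¹ * (s⁻¹ * g (c t) (c (t + s) - c t) (c (t + s) - c t)) =
          (D ^ 2 * s ^ 2 - g (c t) (c (t + s) - c t) (c (t + s) - c t)) / s ^ 2 := by
        field_simp
      rw [e, abs_div, abs_of_pos (show 0 < s ^ 2 by positivity), div_le_iff₀ (by positivity)]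
      exact h4.trans (le_of_eq (by ring))
    have := abs_eq_zero.1 (le_antisymm h3 (abs_nonneg _))
    linarith
  set p := t₀ - δ / 2 with hp
  set q := t₀ + δ / 2 with hq
  have hpq : p < q := by rw [hp, hq]; linarith
  have hJ : Icc p q ⊆ Ioo (t₀ - δ) (t₀ + δ) := fun t ht ↦
    ⟨by linarith [ht.1], by linarith [ht.2]⟩
  have hJ' : Icc p q ⊆ Icc (t₀ - δ) (t₀ + δ) := hJ.trans Ioo_subset_Icc_self
  have hcC : ContDiffOn ℝ 1 c (Icc p q) := by
    have : ContDiffOn ℝ 1 c (Ioo (t₀ - δ) (t₀ + δ)) := by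
      rw [show (1 : WithTop ℕ∞) = 0 + 1 by rfl, contDiffOn_succ_iff_deriv_of_isOpen isOpen_Ioo]
      refine ⟨fun t ht ↦ (hvd t ht).differentiableAt.differentiableWithinAt, by simp, ?_⟩
      rw [contDiffOn_zero]
      exact hvc.congr fun t ht ↦ (hvd t ht).deriv
    exact this.mono hJ
  have hsymm : ∀ t ∈ Icc p q, φ.symm (c t) = f t := fun t ht ↦ by
    rw [hceq t (hJ' ht)]; exact φ.left_inv (hsrc t (hJ' ht))
  have hacc := hg.hasDerivAt_of_energy_minimal hpq (fun t ht ↦ hvd t (hJ ht)) (hvc.mono hJ)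
    (fun t ht ↦ htar t (hJ' ht)) (fun w η hη ha hb hmem ↦ by
      have e1 : ∫ t in p..q, g (c t) (v t) (v t) = (q - p) * D ^ 2 := by
        have : ∫ t in p..q, g (c t) (v t) (v t) = ∫ t in p..q, D ^ 2 := by
          refine intervalIntegral.integral_congr fun t ht ↦ ?_
          rw [uIcc_of_le hpq.le] at ht
          exact hspeed t (hJ ht)
        rw [this, intervalIntegral.integral_const, smul_eq_mul]
      have e2 := dist_sq_le_energy (x₀ := x₀) (c := fun t ↦ c t + η t • w) hpq
        (hcC.add (hη.contDiffOn.smul contDiffOn_const)) hmem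
      have hpm : p ∈ Icc p q := ⟨le_rfl, hpq.le⟩
      have hqm : q ∈ Icc p q := ⟨hpq.le, le_rfl⟩
      simp only [ha, hb, zero_smul, add_zero] at e2
      rw [hsymm p hpm, hsymm q hqm, hf p (hsub (hJ' hpm)) q (hsub (hJ' hqm)), mul_pow, sq_abs] at e2
      have e3 : ∫ t in p..q, g (c t + η t • w) (derivWithin (fun t ↦ c t + η t • w) (Icc p q) t)
          (derivWithin (fun t ↦ c t + η t • w) (Icc p q) t) =
          ∫ t in p..q, g (c t + η t • w) (v t + deriv η t • w) (v t + deriv η t • w) := by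
        refine intervalIntegral.integral_congr fun t ht ↦ ?_
        rw [uIcc_of_le hpq.le] at ht
        have hd : derivWithin (fun t ↦ c t + η t • w) (Icc p q) t = v t + deriv η t • w :=
          ((hvd t (hJ ht)).add (((hη.differentiable (by simp) t).hasDerivAt).smul_const
            w)).hasDerivWithinAt.derivWithin (uniqueDiffOn_Icc hpq t ht)
        simp only [hd]
      rw [e3] at e2
      rw [e1]
      have hpos : 0 < q - p := sub_pos.2 hpq
      refine le_of_mul_le_mul_left ?_ hpos
      exact le_trans (le_of_eq (by ring)) e2)
  have hnear : ∀ᶠ t in 𝓝 t₀, t ∈ Ioo p q :=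
    Ioo_mem_nhds (by rw [hp]; linarith) (by rw [hq]; linarith)
  have hce : c₀ =ᶠ[𝓝 t₀] c :=
    hnear.mono fun t ht ↦ (hceq t (hJ' (Ioo_subset_Icc_self ht))).symm
  have hsol : IsSolAt g c t₀ := IsSolAt.of_hasDerivAt (v := v)
    (hnear.mono fun t ht ↦ hvd t (hJ (Ioo_subset_Icc_self ht))) (hnear.mono hacc)
  have hG : IsGeodInChart n x₀ f t₀ :=
    ⟨hnear.mono fun t ht ↦ hsrc t (hJ' (Ioo_subset_Icc_self ht)), hsol.congr hce⟩
  refine ⟨hG, (sq_eq_sq₀ (speedWithin_nonneg _ _ _) hD).1 ?_⟩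
  have ht₀' : t₀ ∈ Ioo (t₀ - δ) (t₀ + δ) := ⟨by linarith, by linarith⟩
  rw [hG.speedWithin_sq, ← hspeed t₀ ht₀', hceq t₀ (Ioo_subset_Icc_self ht₀'),
    show deriv c₀ t₀ = v t₀ by rw [hce.deriv_eq]; exact (hvd t₀ ht₀').deriv]

/-- The theorem of Hopf and Rinow: any two points of a complete connected Riemannian manifold are
joined by a minimizing geodesic. -/
lemma exists_isExp_norm_le [CompleteSpace M] [ConnectedSpace M] (p z : M) :
    ∃ v : TangentSpace (𝓡 n) p, ‖v‖ ≤ dist p z ∧ IsExp p v z := by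
  have : LocallyCompactSpace M := Manifold.locallyCompact_of_finiteDimensional (𝓡 n)
  have hmin := hasAlmostMinimizers n M
  have : ProperSpace M := hmin.properSpace
  obtain ⟨f, rfl, rfl, hf⟩ := hmin.exists_minimizer p z
  have hgeo : ∀ t ∈ Ioo (0 : ℝ) 1, IsGeodAt n f t ∧ speedWithin n f univ t = dist (f 0) (f 1) :=
    fun t ht ↦ isGeodAt_of_dist_eq dist_nonneg ht hf
  have hhalf : (1 / 2 : ℝ) ∈ Ioo (0 : ℝ) 1 := by norm_num
  obtain ⟨τ, hτ, hτf⟩ := exists_complete_geodesic (n := n) (γ := fun s ↦ f (s + 1 / 2))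
    (IsGeodAt.comp_add _ (by rw [zero_add]; exact (hgeo _ hhalf).1))
  set σ : ℝ → M := fun t ↦ τ (t + (-(1 / 2))) with hσ
  have hσg : ∀ t, IsGeodAt n σ t := fun t ↦ IsGeodAt.comp_add _ (hτ _)
  have hσf : σ =ᶠ[𝓝 (1 / 2)] f := by
    have h1 : Tendsto (fun t : ℝ ↦ t + (-(1 / 2))) (𝓝 (1 / 2)) (𝓝 0) := by
      have := (continuous_add_const (-(1 / 2) : ℝ)).tendsto (1 / 2)
      rwa [add_neg_cancel] at this
    filter_upwards [h1.eventually hτf] with t ht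
    simpa [hσ] using ht
  have heqIoo : EqOn σ f (Ioo 0 1) :=
    IsGeodAt.eqOn_Ioo (fun t _ ↦ hσg t) (fun t ht ↦ (hgeo t ht).1) hhalf hσf
  have hfc : ContinuousOn f (Icc 0 1) := by
    intro t ht
    refine tendsto_iff_dist_tendsto_zero.2 ?_
    have hlim : Tendsto (fun s ↦ dist (f 0) (f 1) * |s - t|) (𝓝[Icc 0 1] t) (𝓝 0) := by
      have : Continuous fun s ↦ dist (f 0) (f 1) * |s - t| := by fun_prop
      simpa using (this.tendsto t).mono_left nhdsWithin_le_nhds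
    refine hlim.congr' ?_
    filter_upwards [self_mem_nhdsWithin] with s hs using (hf s hs t ht).symm
  have hσc : Continuous σ := continuous_iff_continuousAt.2 fun t ↦ (hσg t).continuousAt
  have heq : EqOn σ f (Icc 0 1) :=
    heqIoo.of_subset_closure hσc.continuousOn hfc Ioo_subset_Icc_self
      (by rw [closure_Ioo zero_ne_one])
  have h0 : σ 0 = f 0 := heq ⟨le_rfl, zero_le_one⟩
  have h1 : σ 1 = f 1 := heq ⟨zero_le_one, le_rfl⟩
  have hspeed : speedWithin n σ univ 0 = dist (f 0) (f 1) := by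
    rw [IsGeodAt.speed_eq (a := -1) (b := 1) (t := 1 / 2) (fun t _ ↦ hσg t) (by norm_num)
      (by norm_num), ← (hgeo _ hhalf).2]
    have hsrc := mem_extChartAt_source (I := 𝓡 n) (f (1 / 2))
    have hc : coordCurve n (f (1 / 2)) σ =ᶠ[𝓝 (1 / 2)] coordCurve n (f (1 / 2)) f :=
      hσf.mono fun t ht ↦ by rw [coordCurve, coordCurve, ht]
    have e1 := ((hσg (1 / 2)).inChart (by rw [hσf.self_of_nhds]; exact hsrc)).speedWithin_sq
    have e2 := ((hgeo _ hhalf).1.inChart hsrc).speedWithin_sq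
    rw [hc.deriv_eq, hc.self_of_nhds, ← e2] at e1
    exact (sq_eq_sq₀ (speedWithin_nonneg _ _ _) (speedWithin_nonneg _ _ _)).1 e1
  rw [← h0, ← h1] at *
  refine ⟨mfderiv 𝓘(ℝ, ℝ) (𝓡 n) σ 0 (1 : ℝ), ?_, σ,
    isGeodesicOn_of_isGeodAt zero_lt_one fun t _ ↦ hσg t, curveLift_Icc_eq (hσg 0), rfl⟩
  rw [speedWithin, mfderivWithin_univ] at hspeed
  exact hspeed.le

end Minimizers

end StrongConvexSets

end

theorem mainTheorem6 {n : ℕ} {M : Type*} [MetricSpace M]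
    [ChartedSpace (EuclideanSpace ℝ (Fin n)) M] [IsManifold (𝓡 n) ∞ M]
    [RiemannianBundle (fun x : M ↦ TangentSpace (𝓡 n) x)]
    [IsContMDiffRiemannianBundle (𝓡 n) ∞ (EuclideanSpace ℝ (Fin n))
      (fun x : M ↦ TangentSpace (𝓡 n) x)]
    [IsRiemannianManifold (𝓡 n) M] [CompleteSpace M] [ConnectedSpace M]
    (d : M → M → ℝ) (hd : StrongConvexSets.IsDistanceFunction d)
    (l L : ℝ) (hl : 0 < l) (hlL : l ≤ L)
    (hequiv : ∀ x y : M, l * dist x y ≤ d x y ∧ d x y ≤ L * dist x y)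
    (C : Set M) (α : ℝ) :
    (StrongConvexSets.IsGeodesicallyStronglyConvex n d α C →
      StrongConvexSets.IsDoubleGeodesicallyStronglyConvex n d (α / L) C) ∧
    (StrongConvexSets.IsDoubleGeodesicallyStronglyConvex n d α C →
      StrongConvexSets.IsGeodesicallyStronglyConvex n d (l * α) C) := by
  have hL : 0 < L := hl.trans_le hlL
  refine ⟨fun h ↦ ⟨h.1, fun x hx y hy γ hγ hC t ht v hv ↦ ?_⟩,
    fun h ↦ ⟨h.1, fun x hx y hy γ hγ hC t ht z hz ↦ ?_⟩⟩
  · obtain ⟨q, hq, hdist⟩ := StrongConvexSets.exists_isExp (γ t) v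
    refine ⟨q, h.2 x hx y hy γ hγ hC t ht ?_, hq⟩
    calc d (γ t) q ≤ L * dist (γ t) q := (hequiv _ _).2
      _ ≤ L * (α / L * t * (1 - t) * d x y ^ 2) := by gcongr; exact hdist.trans hv
      _ = α * t * (1 - t) * d x y ^ 2 := by field_simp
  · obtain ⟨v, hv, hexp⟩ := StrongConvexSets.exists_isExp_norm_le (n := n) (γ t) z
    have hz' : d (γ t) z ≤ l * α * t * (1 - t) * d x y ^ 2 := hz
    have h1 : dist (γ t) z ≤ α * t * (1 - t) * d x y ^ 2 := by
      refine le_of_mul_le_mul_left ((hequiv _ _).1.trans (hz'.trans (le_of_eq ?_))) hl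
      ring
    obtain ⟨q, hqC, hq⟩ := h.2 x hx y hy γ hγ hC t ht v (hv.trans h1)
    rwa [hexp.unique hq]
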